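/- Notation. Let $n,m,Q\ge 1$ be integers, $B_r(x)\subset\mathbb R^n$ the open ball, $B_1=B_1(0)$. Let $\mathcal A_Q(\mathbb R^m)$ be the set of unordered $Q$-tuples $T=\sum_{i=1}^Q[\![P_i]\!]$ of points of $\mathbb R^m$ with the metric $\mathcal G(\sum_i[\![P_i]\!],\sum_i[\![S_i]\!])=\min_\sigma(\sum_i|P_i-S_{\sigma(i)}|^2)^{1/2}$, $\sigma$ ranging over the permutations of $\{1,\dots,Q\}$, and $|T|=\mathcal G(T,Q[\![0]\!])$. For $\Omega\subset\mathbb R^n$ open, a measurable $f:\Omega\to\mathcal A_Q(\mathbb R^m)$ is in $W^{1,2}(\Omega,\mathcal A_Q(\mathbb R^m))$ if there are nonnegative $\vartheta_1,\dots,\vartheta_n\in L^2(\Omega)$ such that for every $T\in\mathcal A_Q(\mathbb R^m)$ one has $\mathcal G(f,T)\in W^{1,2}(\Omega)$ and $|\partial_j\mathcal G(f,T)|\le\vartheta_j$ a.e. in $\Omega$ for all $j$. Such an $f$ is approximately differentiable at a.e. $x\in\Omega$: there are points $f_i(x)$ and linear maps $Df_i(x):\mathbb R^n\to\mathbb R^m$,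 $i=1,\dots,Q$, with $f(x)=\sum_i[\![f_i(x)]\!]$, $Df_i(x)=Df_k(x)$ whenever $f_i(x)=f_k(x)$, and $\mathcal G\big(f(y),\sum_i[\![f_i(x)+Df_i(x)(y-x)]\!]\big)=o(|y-x|)$ as $y\to x$ within some measurable subset of $\Omega$ that contains $x$ and has density $1$ at $x$. Put $|Df|^2=\sum_i|Df_i|^2$, with $\langle A:B\rangle$ the Hilbert–Schmidt product and $|A|^2=\langle A:A\rangle$. A map $f\in W^{1,2}(\Omega,\mathcal A_Q(\mathbb R^m))$ is *Dir-stationary* if $$\int_\Omega\sum_{i=1}^Q\big[\langle Df_i(x):D_x\psi(x,f_i(x))\rangle+\langle Df_i(x):D_u\psi(x,f_i(x))\cdot Df_i(x)\rangle\big]\,dx=0$$ for every $\psi\in C^\infty(\Omega\times\mathbb R^m;\mathbb R^m)$ with compact support in $x$ (that is, vanishing for $x$ outside a compact subset of $\Omega$) for which there is a constant $C$ with $|D_u\psi|\le C$ and $|\psi|+|D_x\psi|\le C(1+|u|)$, and $$2\int_\Omega\sum_{i=1}^Q\langle Df_i:Df_i\cdot D\varphi\rangle\,dx-\int_\Omega|Df|^2\,\mathrm{div}\,\varphi\,dx=0\qquad\text{for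 all }\varphi\in C_c^\infty(\Omega;\mathbb R^n).$$ **Proposition 4.3 (Doubling estimate).** Let $f\in W^{1,2}(B_1,\mathcal A_Q(\mathbb R^m))$ be Dir-stationary in $B_1\subset\mathbb R^n$. Then for every $x\in B_1$ there exist a radius $r_x>0$ with $B_{2r_x}(x)\subset B_1$ and a constant $C_x$ such that $$\int_{B_{2r}(x)}|f|^2\le C_x\int_{B_r(x)}|f|^2\qquad\text{for all }0<r\le r_x.$$ -/

import Mathlib

open MeasureTheory Filter Topology Asymptotics
open scoped ContDiff

noncomputable section

namespace QValued

/-- Euclidean space `ℝⁿ`. -/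
abbrev Rn (n : ℕ) : Type := EuclideanSpace ℝ (Fin n)

/-- `𝒜_Q(ℝᵐ)`: unordered `Q`-tuples of points of `ℝᵐ`, i.e. the measures `∑ᵢ ⟦Pᵢ⟧`, `Pᵢ ∈ ℝᵐ`. -/
abbrev AQ (Q m : ℕ) : Type := Sym (Rn m) Q

variable {Q n m : ℕ}

/-- The `Q`-point `∑ᵢ ⟦Pᵢ⟧`. -/
def AQ.sum (P : Fin Q → Rn m) : AQ Q m := Sym.mk (Finset.univ.val.map P) (by simp)

/-- The metric `G(T, S) = min_σ (∑ᵢ |Pᵢ - S_{σ(i)}|²)^{1/2}` on `𝒜_Q(ℝᵐ)`, the minimum being taken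
over all ways of enumerating the points of `T` and of `S`. -/
def AQ.G (T S : AQ Q m) : ℝ :=
  sInf {d : ℝ | ∃ P R : Fin Q → Rn m, AQ.sum P = T ∧ AQ.sum R = S ∧
    d = Real.sqrt (∑ i, ‖P i - R i‖ ^ 2)}

/-- `|T| = G(T, Q⟦0⟧)`. -/
def AQ.abs (T : AQ Q m) : ℝ := AQ.G T (AQ.sum fun _ => 0)

/-- The standard basis vector `eⱼ` of `ℝⁿ`. -/
def e (j : Fin n) : Rn n := EuclideanSpace.single j 1

/-- The Hilbert–Schmidt product `⟨A : B⟩` of linear maps `ℝⁿ → ℝᵐ`. -/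
def hsInner (A B : Rn n →L[ℝ] Rn m) : ℝ := ∑ j : Fin n, inner ℝ (A (e j)) (B (e j))

/-- `g` is the weak gradient of the scalar function `u` in `Ω`
(used for square integrable `u` and `g`). -/
def HasWeakGradient (Ω : Set (Rn n)) (u : Rn n → ℝ) (g : Rn n → Rn n) : Prop :=
  ∀ φ : Rn n → ℝ, ContDiff ℝ ∞ φ → HasCompactSupport φ → tsupport φ ⊆ Ω → ∀ j : Fin n,
    ∫ x in Ω, u x * fderiv ℝ φ x (e j) = - ∫ x in Ω, g x j * φ x

/-- `f ∈ W^{1,2}(Ω, 𝒜_Q(ℝᵐ))`: there are `ϑ₁, …, ϑₙ ∈ L²(Ω; [0,∞))` such that, for every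
`T ∈ 𝒜_Q(ℝᵐ)`, the function `x ↦ G(f(x), T)` is in `W^{1,2}(Ω)` and `|∂ⱼ G(f, T)| ≤ ϑⱼ` a.e. in `Ω`
for every `j`. Measurability of `f` with respect to the (separable) metric `G` is the measurability
of all the functions `G(f, T)`, which is part of `MemLp`. -/
def MemW12 (Ω : Set (Rn n)) (f : Rn n → AQ Q m) : Prop :=
  ∃ ϑ : Fin n → Rn n → ℝ,
    (∀ j, MemLp (ϑ j) 2 (volume.restrict Ω) ∧ ∀ x, 0 ≤ ϑ j x) ∧
    ∀ T : AQ Q m,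
      MemLp (fun x => AQ.G (f x) T) 2 (volume.restrict Ω) ∧
      ∃ g : Rn n → Rn n, MemLp g 2 (volume.restrict Ω) ∧
        HasWeakGradient Ω (fun x => AQ.G (f x) T) g ∧
        ∀ j, ∀ᵐ x ∂(volume.restrict Ω), |g x j| ≤ ϑ j x

/-- `J = (fᵢ(x), Dfᵢ(x))ᵢ` consists of the values of the `Q`-valued map `f` at `x` and of its
approximate differentials there: there is a measurable `A ⊆ Ω` containing `x`, of density one at
`x`, along which `f` has the first order expansion `∑ᵢ ⟦fᵢ(x) + Dfᵢ(x)·(y - x)⟧`; moreover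
`Dfᵢ(x) = Dfₖ(x)` whenever `fᵢ(x) = fₖ(x)`. Up to a permutation there is at most one such `J`. -/
def IsApproxJet (Ω : Set (Rn n)) (f : Rn n → AQ Q m) (x : Rn n)
    (J : Fin Q → Rn m × (Rn n →L[ℝ] Rn m)) : Prop :=
  f x = AQ.sum (fun i => (J i).1) ∧
  (∀ i k, (J i).1 = (J k).1 → (J i).2 = (J k).2) ∧
  ∃ A : Set (Rn n), MeasurableSet A ∧ A ⊆ Ω ∧ x ∈ A ∧
    Tendsto (fun r : ℝ => volume (A ∩ Metric.ball x r) / volume (Metric.ball x r))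
      (𝓝[>] 0) (𝓝 1) ∧
    (fun y => AQ.G (f y) (AQ.sum fun i => (J i).1 + (J i).2 (y - x))) =o[𝓝[A] x] fun y => y - x

open Classical in
/-- The pairs `(fᵢ(x), Dfᵢ(x))`, `i = 1, …, Q`, at a point `x` of approximate differentiability of
`f` in `Ω`; zero at the other points. Only expressions symmetric in `i` are formed from it. -/
def approxJet (Ω : Set (Rn n)) (f : Rn n → AQ Q m) (x : Rn n) :
    Fin Q → Rn m × (Rn n →L[ℝ] Rn m) :=
  if h : ∃ J, IsApproxJet Ω f x J then h.choose else 0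

/-- Test maps `ψ(x, u)` for outer variations in `Ω`: smooth, compactly supported in `x ∈ Ω`,
with `|D_u ψ| ≤ C` and `|ψ| + |D_x ψ| ≤ C (1 + |u|)` (extended by zero for `x ∉ Ω`). -/
def IsOuterTest (Ω : Set (Rn n)) (ψ : Rn n → Rn m → Rn m) : Prop :=
  ContDiff ℝ ∞ (fun p : Rn n × Rn m => ψ p.1 p.2) ∧
  (∃ K : Set (Rn n), IsCompact K ∧ K ⊆ Ω ∧ ∀ x, x ∉ K → ∀ u, ψ x u = 0) ∧
  ∃ C : ℝ, ∀ x u, ‖fderiv ℝ (fun v => ψ x v) u‖ ≤ C ∧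
    ‖ψ x u‖ + ‖fderiv ℝ (fun y => ψ y u) x‖ ≤ C * (1 + ‖u‖)

/-- `𝒪(f, ψ) = ∫ ∑ᵢ [⟨Dfᵢ : D_x ψ(x, fᵢ)⟩ + ⟨Dfᵢ : D_u ψ(x, fᵢ) · Dfᵢ⟩] dx`. -/
def outerVariation (Ω : Set (Rn n)) (f : Rn n → AQ Q m) (ψ : Rn n → Rn m → Rn m) : ℝ :=
  ∫ x in Ω, ∑ i : Fin Q,
    (hsInner (approxJet Ω f x i).2 (fderiv ℝ (fun y => ψ y (approxJet Ω f x i).1) x) +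
      hsInner (approxJet Ω f x i).2
        ((fderiv ℝ (fun v => ψ x v) (approxJet Ω f x i).1).comp (approxJet Ω f x i).2))

/-- The divergence of a vector field on `ℝⁿ`. -/
def divergence (φ : Rn n → Rn n) (x : Rn n) : ℝ := ∑ j : Fin n, fderiv ℝ φ x (e j) j

/-- `ℐ(f, φ) = 2 ∫ ∑ᵢ ⟨Dfᵢ : Dfᵢ · Dφ⟩ - ∫ |Df|² div φ`, where `|Df|² = ∑ᵢ |Dfᵢ|²`. -/
def innerVariation (Ω : Set (Rn n)) (f : Rn n → AQ Q m) (φ : Rn n → Rn n) : ℝ :=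
  2 * (∫ x in Ω, ∑ i : Fin Q,
      hsInner (approxJet Ω f x i).2 ((approxJet Ω f x i).2.comp (fderiv ℝ φ x))) -
    ∫ x in Ω, (∑ i : Fin Q, hsInner (approxJet Ω f x i).2 (approxJet Ω f x i).2) * divergence φ x

/-- `f ∈ W^{1,2}(Ω, 𝒜_Q(ℝᵐ))` is Dir-stationary in `Ω`: stationary for the Dirichlet energy with
respect to both outer and inner variations. -/
def IsDirStationary (Ω : Set (Rn n)) (f : Rn n → AQ Q m) : Prop :=
  MemW12 Ω f ∧
  (∀ ψ : Rn n → Rn m → Rn m, IsOuterTest Ω ψ → outerVariation Ω f ψ = 0) ∧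
  (∀ φ : Rn n → Rn n, ContDiff ℝ ∞ φ → HasCompactSupport φ → tsupport φ ⊆ Ω →
    innerVariation Ω f φ = 0)

end QValued

end

noncomputable section

namespace QValued

open scoped Convolution
open ContinuousLinearMap (lsmul)

variable {Q n m : ℕ}

/-! The argument is Almgren's monotonicity of the frequency function, in a smoothed form. With s =
|z - x|²/r², a smooth cutoff φ(s) vanishing for s ≥ 1 and w = -φ', put H(r) = ∫ w |f|², D(r) = ∫ φ
|Df|² and E(r) = ∫ w ∑ᵢ |Dfᵢ(z - x)|². The outer variation along φ·u gives r² D = 2 ∫ w ∑ᵢ ⟨fᵢ,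
Dfᵢ(z - x)⟩; integrating by parts for |f|² then yields r H' = n H + r² D. The inner variation along
φ·(z - x) yields r D' = (n - 2) D + 4 E / r². Cauchy–Schwarz says (r² D)² ≤ 4 H E, which is exactly
what makes I = r² D / H nondecreasing. Since r H' / H = n + I, the value of I at one radius bounds
the growth of H at all smaller ones, so H / r^k is nonincreasing for some k and H(4r) ≤ 4^k H(r).
These steps are `IsDirStationary.exists_frequency_data` and `exists_doubling_of_frequency`. No
unique continuation is needed: if H vanishes at some radius, then f = 0 a.e. near x and the estimate
is trivial there.

The bulk of the work is to make these computations legitimate when the Sobolev space is defined only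
through the scalar functions G(f, T), while the variations involve approximate differentials. A
Poincaré inequality at Lebesgue points (`integral_ball_sub_affine_le`) shows that f is Lipschitz at
small scales on sets exhausting the domain (`DominatesGradients.exists_lipschitz_pieces`). On such
sets f splits locally into Lipschitz selections wherever the number of distinct values is constant
(`exists_local_selection`), so countably many sheets describe f up to a null set
(`DominatesGradients.exists_sheets`). At density points of a sheet the approximate differentials are
the derivatives of its selections, uniquely up to a permutation (`IsApproxJet.exists_perm`). This
gives measurability, the bound |Dfᵢ| ≤ c Θ with Θ in L² (`DominatesGradients.ae_norm_le`), and the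
chain rule |f| ∇|f|·v = ∑ᵢ ⟨fᵢ, Dfᵢ v⟩ (`DominatesGradients.ae_abs_mul_grad`), which links the weak
gradient of |f| to the outer variation. -/

/-- A sequence of bump functions at the origin of `ℝⁿ` with radii tending to zero. -/
def bump (n k : ℕ) : ContDiffBump (0 : Rn n) where
  rIn := 1 / (2 * ((k : ℝ) + 1))
  rOut := 1 / ((k : ℝ) + 1)
  rIn_pos := by positivity
  rIn_lt_rOut := by
    apply one_div_lt_one_div_of_lt <;> nlinarith [Nat.cast_nonneg (α := ℝ) k]

lemma bump_rOut_le_one (k : ℕ) : (bump n k).rOut ≤ 1 := by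
  change 1 / ((k : ℝ) + 1) ≤ 1
  rw [div_le_one (by positivity)]
  linarith [Nat.cast_nonneg (α := ℝ) k]

lemma tendsto_bump_rOut : Tendsto (fun k => (bump n k).rOut) atTop (𝓝 0) :=
  tendsto_one_div_add_atTop_nhds_zero_nat

/-! ### Mollification in L². -/

section Mollification

variable {F : Type*} [NormedAddCommGroup F] [NormedSpace ℝ F]

/-- The normalized mollifier. -/
def eta (n k : ℕ) : Rn n → ℝ := (bump n k).normed volume

/-- Mollification at scale `1 / (k + 1)`. -/
def moll (k : ℕ) (w : Rn n → F) : Rn n → F := eta n k ⋆[lsmul ℝ ℝ, volume] w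

lemma moll_apply (k : ℕ) (w : Rn n → F) (x : Rn n) : moll k w x = ∫ t, eta n k (x - t) • w t := by
  rw [moll, convolution_lsmul_swap]

lemma eta_nonneg (k : ℕ) (x : Rn n) : 0 ≤ eta n k x := (bump n k).nonneg_normed x

lemma contDiff_eta (k : ℕ) : ContDiff ℝ ∞ (eta n k) := (bump n k).contDiff_normed

lemma hasCompactSupport_eta (k : ℕ) : HasCompactSupport (eta n k) :=
  (bump n k).hasCompactSupport_normed

lemma integrable_eta_smul {k : ℕ} {w : Rn n → F} (hw : LocallyIntegrable w) (x : Rn n) :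
    Integrable (fun t => eta n k (x - t) • w t) := by
  have h := (hasCompactSupport_eta (n := n) k).convolutionExists_left (lsmul ℝ ℝ)
    (contDiff_eta k).continuous hw x
  exact h.integrable_swap

lemma integral_eta_sub (k : ℕ) (x : Rn n) : ∫ t, eta n k (x - t) = 1 := by
  rw [integral_sub_left_eq_self (eta n k)]
  exact (bump n k).integral_normed

lemma integrable_eta_sub (k : ℕ) (x : Rn n) : Integrable (fun t => eta n k (x - t)) :=
  ((bump n k).integrable_normed (μ := volume)).comp_sub_left x

lemma MemLp.locallyIntegrable_two {E : Type*} [NormedAddCommGroup E] {w : Rn n → E} (hw : MemLp w 2) : LocallyIntegrable w :=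
  hw.locallyIntegrable (by norm_num)

lemma MemLp.integrable_norm_sq {E α : Type*} [NormedAddCommGroup E] [MeasurableSpace α]
    {μ : Measure α} {w : α → E}
    (hw : MemLp w 2 μ) : Integrable (fun x => ‖w x‖ ^ 2) μ :=
  (memLp_two_iff_integrable_sq_norm hw.1).1 hw

/-- Jensen's inequality for the probability density η(x - t) dt, obtained from the nonnegativity of
the variance of `‖w‖` about its mean c. -/
lemma norm_moll_sq_le {w : Rn n → F} (hw : MemLp w 2) (k : ℕ) (x : Rn n) :
    ‖moll k w x‖ ^ 2 ≤ moll k (fun y => ‖w y‖ ^ 2) x := by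
  have hl := MemLp.locallyIntegrable_two hw
  have h1 : ‖moll k w x‖ ≤ ∫ t, eta n k (x - t) * ‖w t‖ := by
    rw [moll_apply]
    refine (norm_integral_le_integral_norm _).trans_eq (integral_congr_ae ?_)
    filter_upwards with t
    rw [norm_smul, Real.norm_of_nonneg (eta_nonneg k _)]
  have i1 : Integrable (fun t => eta n k (x - t) * ‖w t‖) :=
    (integrable_eta_smul hl x).norm.congr (by
      filter_upwards with t
      rw [norm_smul, Real.norm_of_nonneg (eta_nonneg k _)])
  have i2 : Integrable (fun t => eta n k (x - t) * ‖w t‖ ^ 2) := by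
    simpa using integrable_eta_smul (k := k) (MemLp.integrable_norm_sq hw).locallyIntegrable x
  set c := ∫ t, eta n k (x - t) * ‖w t‖
  have h2 : 0 ≤ ∫ t, eta n k (x - t) * (‖w t‖ - c) ^ 2 :=
    integral_nonneg fun t => mul_nonneg (eta_nonneg k _) (sq_nonneg _)
  have h3 : ∫ t, eta n k (x - t) * (‖w t‖ - c) ^ 2
      = (∫ t, eta n k (x - t) * ‖w t‖ ^ 2) - 2 * c * c + c ^ 2 * 1 := by
    rw [← integral_eta_sub k x, ← integral_const_mul (c ^ 2),
      show 2 * c * c = ∫ t, 2 * c * (eta n k (x - t) * ‖w t‖) from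
        (integral_const_mul _ _).symm, ← integral_sub i2 (i1.const_mul _), ← integral_add]
    · congr 1; ext t; ring
    · exact i2.sub (i1.const_mul _)
    · exact (integrable_eta_sub k x).const_mul _
  have h4 : moll k (fun y => ‖w y‖ ^ 2) x = ∫ t, eta n k (x - t) * ‖w t‖ ^ 2 := by
    rw [moll_apply]; simp
  have h5 : ‖moll k w x‖ ^ 2 ≤ c ^ 2 := pow_le_pow_left₀ (norm_nonneg _) h1 2
  rw [h4]; nlinarith

lemma integral_moll {w : Rn n → ℝ} (hw : Integrable w) (k : ℕ) :
    Integrable (moll k w) ∧ ∫ x, moll k w x = ∫ x, w x := by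
  have h0 : Integrable (eta n k) := (bump n k).integrable_normed
  refine ⟨h0.integrable_convolution _ hw, ?_⟩
  have := integral_convolution (lsmul ℝ ℝ) h0 hw (ν := volume) (μ := volume)
  rw [moll, this]
  have : ∫ t, eta n k t = 1 := (bump n k).integral_normed
  simp [this]

lemma continuous_moll {w : Rn n → F} (hw : LocallyIntegrable w) (k : ℕ) : Continuous (moll k w) :=
  (hasCompactSupport_eta k).continuous_convolution_left _ (contDiff_eta k).continuous hw

/-- Mollification contracts the L² norm: Jensen pointwise, then mollifying ‖w‖² preserves its
integral. -/
lemma memLp_moll {w : Rn n → F} (hw : MemLp w 2) (k : ℕ) :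
    MemLp (moll k w) 2 ∧ ∫ x, ‖moll k w x‖ ^ 2 ≤ ∫ x, ‖w x‖ ^ 2 := by
  have hc := continuous_moll (MemLp.locallyIntegrable_two hw) k
  have hi := integral_moll (MemLp.integrable_norm_sq hw) k
  have h1 : Integrable fun x => ‖moll k w x‖ ^ 2 := by
    refine hi.1.mono' (hc.norm.pow 2).aestronglyMeasurable ?_
    filter_upwards with x
    rw [Real.norm_of_nonneg (by positivity)]
    exact norm_moll_sq_le hw k x
  refine ⟨(memLp_two_iff_integrable_sq_norm hc.aestronglyMeasurable).2 h1, ?_⟩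
  rw [← hi.2]
  exact integral_mono h1 hi.1 (norm_moll_sq_le hw k)

lemma moll_sub {v w : Rn n → F} (hv : LocallyIntegrable v) (hw : LocallyIntegrable w) (k : ℕ)
    (x : Rn n) : moll k (fun y => v y - w y) x = moll k v x - moll k w x := by
  simp only [moll_apply, smul_sub]
  exact integral_sub (integrable_eta_smul hv x) (integrable_eta_smul hw x)

/-- Dominated convergence: all mollifying radii are at most 1, so the differences live on one fixed
compact set and are bounded by 2M. -/
lemma tendsto_moll_of_continuous [CompleteSpace F] {v : Rn n → F} (hv : Continuous v)
    (hs : HasCompactSupport v) :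
    Tendsto (fun k => ∫ x, ‖moll k v x - v x‖ ^ 2) atTop (𝓝 0) := by
  obtain ⟨M, hM⟩ := hs.exists_bound_of_continuous hv
  have hM0 : 0 ≤ M := (norm_nonneg _).trans (hM 0)
  set K := Metric.cthickening 1 (tsupport v)
  have hK : IsCompact K := hs.isCompact.cthickening
  have hb : ∀ k x, ‖moll k v x - v x‖ ≤ 2 * M := by
    intro k x
    rw [← dist_eq_norm]
    refine (bump n k).dist_normed_convolution_le hv.aestronglyMeasurable fun y _ => ?_
    rw [dist_eq_norm]
    exact (norm_sub_le _ _).trans (by linarith [hM x, hM y])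
  have hz : ∀ k x, x ∉ K → moll k v x - v x = 0 := by
    intro k x hx
    rw [sub_eq_zero]
    have h0 : ∀ y ∈ Metric.ball x (bump n k).rOut, v y = 0 := by
      intro y hy
      by_contra h
      refine hx (Metric.mem_cthickening_of_dist_le x y 1 _ (subset_tsupport _ h) ?_)
      rw [dist_comm]
      exact (Metric.mem_ball.1 hy).le.trans (bump_rOut_le_one k)
    refine (bump n k).normed_convolution_eq_right fun y hy => ?_
    rw [h0 y hy, h0 x (Metric.mem_ball_self (bump n k).rOut_pos)]
  have := tendsto_integral_of_dominated_convergence (μ := volume)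
    (F := fun k x => ‖moll k v x - v x‖ ^ 2) (f := fun _ => 0)
    (K.indicator fun _ => (2 * M) ^ 2) ?_ ?_ ?_ ?_
  · simpa using this
  · intro k
    exact (((continuous_moll hv.locallyIntegrable k).sub hv).norm.pow 2).aestronglyMeasurable
  · exact (integrable_indicator_iff hK.measurableSet).2
      (integrableOn_const hK.measure_lt_top.ne)
  · intro k
    filter_upwards with x
    rw [Real.norm_of_nonneg (by positivity)]
    by_cases hx : x ∈ K
    · rw [Set.indicator_of_mem hx]
      exact pow_le_pow_left₀ (norm_nonneg _) (hb k x) 2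
    · rw [Set.indicator_of_notMem hx, hz k x hx]; simp
  · filter_upwards with x
    have := ContDiffBump.convolution_tendsto_right_of_continuous (μ := volume)
      (tendsto_bump_rOut (n := n)) hv x
    have := ((this.sub_const (v x)).norm).pow 2
    rw [sub_self, norm_zero, zero_pow two_ne_zero] at this
    exact this

lemma norm_add_three_sq_le {E : Type*} [NormedAddCommGroup E] (a b c : E) :
    ‖a + b + c‖ ^ 2 ≤ 3 * (‖a‖ ^ 2 + ‖b‖ ^ 2 + ‖c‖ ^ 2) := by
  have h : ‖a + b + c‖ ≤ ‖a‖ + ‖b‖ + ‖c‖ := norm_add₃_le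
  have h2 := pow_le_pow_left₀ (norm_nonneg _) h 2
  nlinarith [sq_nonneg (‖a‖ - ‖b‖), sq_nonneg (‖a‖ - ‖c‖), sq_nonneg (‖b‖ - ‖c‖)]

/-- Mollifications of an `L²` function converge to it in `L²`. -/
theorem tendsto_moll [CompleteSpace F] {w : Rn n → F} (hw : MemLp w 2) :
    Tendsto (fun k => ∫ x, ‖moll k w x - w x‖ ^ 2) atTop (𝓝 0) := by
  rw [Metric.tendsto_atTop]
  intro ε hε
  have hw2 : MemLp w (ENNReal.ofReal 2) := by simpa using hw
  -- Approximation by a continuous, compactly supported v. The error splits into three terms, each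
  -- with squared norm at most ε/12; the factor 3 of `norm_add_three_sq_le` leaves 3ε/4.
  obtain ⟨v, hvs, hvI, hvc, hvm⟩ :=
    hw2.exists_hasCompactSupport_integral_rpow_sub_le (p := 2) (by norm_num)
      (ε := ε / 12) (by positivity)
  have hvm : MemLp v 2 := by simpa using hvm
  have hvI : ∫ x, ‖w x - v x‖ ^ 2 ≤ ε / 12 := by simpa only [Real.rpow_two] using hvI
  obtain ⟨N, hN⟩ := (Metric.tendsto_atTop.1 (tendsto_moll_of_continuous hvc hvs)) (ε / 12)
    (by positivity)
  refine ⟨N, fun k hk => ?_⟩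
  have h1 := hN k hk
  rw [Real.dist_eq, sub_zero, abs_of_nonneg (integral_nonneg fun _ => by positivity)] at h1 ⊢
  have hd : MemLp (fun x => w x - v x) 2 := hw.sub hvm
  have hk' := memLp_moll hd k
  have hk2 : MemLp (fun x => moll k v x - v x) 2 := (memLp_moll hvm k).1.sub hvm
  have hk3 : MemLp (fun x => moll k w x - w x) 2 := (memLp_moll hw k).1.sub hw
  have e1 : ∀ x, ‖moll k w x - w x‖ ^ 2 ≤ 3 * (‖moll k (fun x => w x - v x) x‖ ^ 2 +
      ‖moll k v x - v x‖ ^ 2 + ‖w x - v x‖ ^ 2) := by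
    intro x
    have := norm_add_three_sq_le (moll k (fun x => w x - v x) x) (moll k v x - v x) (v x - w x)
    rw [norm_sub_rev (v x) (w x)] at this
    refine le_trans (le_of_eq ?_) this
    rw [moll_sub (MemLp.locallyIntegrable_two hw) (MemLp.locallyIntegrable_two hvm)]
    congr 2; abel
  have e2 := integral_mono (MemLp.integrable_norm_sq hk3)
    ((((MemLp.integrable_norm_sq hk'.1).add (MemLp.integrable_norm_sq hk2)).add
      (MemLp.integrable_norm_sq hd)).const_mul 3) e1
  have i1 := MemLp.integrable_norm_sq hk'.1
  have i2 := MemLp.integrable_norm_sq hk2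
  have i3 : Integrable fun x => ‖moll k (fun x => w x - v x) x‖ ^ 2 + ‖moll k v x - v x‖ ^ 2 :=
    i1.add i2
  simp only [Pi.add_apply] at e2
  rw [integral_const_mul, integral_add i3 (MemLp.integrable_norm_sq hd), integral_add i1 i2] at e2
  linarith [hk'.2]

end Mollification

/-! ### Cauchy–Schwarz and limits of products of L² functions. -/

section CauchySchwarz

variable {α : Type*} [MeasurableSpace α] {μ : Measure α}

lemma integrable_mul_of_memLp {a b : α → ℝ} (ha : MemLp a 2 μ) (hb : MemLp b 2 μ) :
    Integrable (fun x => a x * b x) μ :=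
  ha.integrable_mul hb

/-- The quadratic t ↦ ∫ (t b - a)² is nonnegative, so its discriminant is not positive. -/
lemma sq_integral_mul_le {a b : α → ℝ} (ha : MemLp a 2 μ) (hb : MemLp b 2 μ) :
    (∫ x, a x * b x ∂μ) ^ 2 ≤ (∫ x, a x ^ 2 ∂μ) * ∫ x, b x ^ 2 ∂μ := by
  have h : ∀ t : ℝ, 0 ≤ (∫ x, b x ^ 2 ∂μ) * (t * t) + (-2 * ∫ x, a x * b x ∂μ) * t +
      ∫ x, a x ^ 2 ∂μ := by
    intro t
    have h1 : 0 ≤ ∫ x, (t * b x - a x) ^ 2 ∂μ := integral_nonneg fun _ => sq_nonneg _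
    have i1 : Integrable (fun x => t * t * b x ^ 2 + (-2 * t) * (a x * b x)) μ :=
      (hb.integrable_sq.const_mul _).add ((integrable_mul_of_memLp ha hb).const_mul _)
    have h2 : ∫ x, (t * b x - a x) ^ 2 ∂μ =
        t * t * (∫ x, b x ^ 2 ∂μ) + (-2 * t) * (∫ x, a x * b x ∂μ) + ∫ x, a x ^ 2 ∂μ := by
      rw [← integral_const_mul, ← integral_const_mul, ← integral_add
        (hb.integrable_sq.const_mul _) ((integrable_mul_of_memLp ha hb).const_mul _),
        ← integral_add i1 ha.integrable_sq]
      congr 1; ext x; ring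
    linarith
  have := discrim_le_zero h
  rw [discrim] at this
  nlinarith

lemma tendsto_integral_mul_zero {a b : ℕ → α → ℝ} {B : ℝ} (ha : ∀ k, MemLp (a k) 2 μ)
    (hb : ∀ k, MemLp (b k) 2 μ) (ha0 : Tendsto (fun k => ∫ x, a k x ^ 2 ∂μ) atTop (𝓝 0))
    (hB : ∀ᶠ k in atTop, ∫ x, b k x ^ 2 ∂μ ≤ B) :
    Tendsto (fun k => ∫ x, a k x * b k x ∂μ) atTop (𝓝 0) := by
  have h1 : Tendsto (fun k => (∫ x, a k x * b k x ∂μ) ^ 2) atTop (𝓝 0) := by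
    refine squeeze_zero' (Eventually.of_forall fun _ => sq_nonneg _) (g := fun k =>
      (∫ x, a k x ^ 2 ∂μ) * B) ?_ (by simpa using ha0.mul_const B)
    filter_upwards [hB] with k hk
    exact (sq_integral_mul_le (ha k) (hb k)).trans
      (mul_le_mul_of_nonneg_left hk (integral_nonneg fun _ => sq_nonneg _))
  have h2 := h1.sqrt
  simp only [Real.sqrt_sq_eq_abs, Real.sqrt_zero] at h2
  exact (tendsto_zero_iff_abs_tendsto_zero _).2 h2

/-- Write ab - a'b' = (a - a')(b - b') + (a - a')b' + (b - b')a'; after multiplication by the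
bounded c, every term has a factor tending to 0 in L². -/
lemma tendsto_integral_mul_mul {a b : ℕ → α → ℝ} {a' b' c : α → ℝ} {M : ℝ}
    (ha : ∀ k, MemLp (a k) 2 μ) (hb : ∀ k, MemLp (b k) 2 μ) (ha' : MemLp a' 2 μ)
    (hb' : MemLp b' 2 μ) (hc : AEStronglyMeasurable c μ) (hM : ∀ x, ‖c x‖ ≤ M)
    (hta : Tendsto (fun k => ∫ x, (a k x - a' x) ^ 2 ∂μ) atTop (𝓝 0))
    (htb : Tendsto (fun k => ∫ x, (b k x - b' x) ^ 2 ∂μ) atTop (𝓝 0)) :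
    Tendsto (fun k => ∫ x, a k x * b k x * c x ∂μ) atTop (𝓝 (∫ x, a' x * b' x * c x ∂μ)) := by
  have mc : ∀ {w : α → ℝ}, MemLp w 2 μ → MemLp (fun x => w x * c x) 2 μ := fun hw =>
    (hw.const_mul M).mono (hw.1.mul hc) (by
      filter_upwards with x
      have := (norm_nonneg _).trans (hM x)
      rw [norm_mul, norm_mul, Real.norm_of_nonneg this, mul_comm]
      exact mul_le_mul_of_nonneg_right (hM x) (norm_nonneg _))
  have da : ∀ k, MemLp (fun x => a k x - a' x) 2 μ := fun k => (ha k).sub ha'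
  have db : ∀ k, MemLp (fun x => b k x - b' x) 2 μ := fun k => (hb k).sub hb'
  have hbd : ∀ᶠ k in atTop, ∫ x, ((b k x - b' x) * c x) ^ 2 ∂μ ≤ M ^ 2 := by
    filter_upwards [htb.eventually (gt_mem_nhds one_pos)] with k hk
    calc ∫ x, ((b k x - b' x) * c x) ^ 2 ∂μ ≤ ∫ x, M ^ 2 * (b k x - b' x) ^ 2 ∂μ := by
          refine integral_mono (mc (db k)).integrable_sq ((db k).integrable_sq.const_mul _) ?_
          intro x
          have := pow_le_pow_left₀ (norm_nonneg _) (hM x) 2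
          simp only [Real.norm_eq_abs, sq_abs] at this
          change ((b k x - b' x) * c x) ^ 2 ≤ M ^ 2 * (b k x - b' x) ^ 2
          rw [mul_pow, mul_comm]
          exact mul_le_mul_of_nonneg_right this (sq_nonneg _)
      _ ≤ M ^ 2 := by
          rw [integral_const_mul]; nlinarith [sq_nonneg M]
  have t1 := tendsto_integral_mul_zero da (fun k => mc (db k)) hta hbd
  have t2 := tendsto_integral_mul_zero da (fun _ => mc hb') hta
    (Eventually.of_forall fun _ => le_rfl)
  have t3 := tendsto_integral_mul_zero db (fun _ => mc ha') htb
    (Eventually.of_forall fun _ => le_rfl)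
  have t4 := ((t1.add t2).add t3).add_const (∫ x, a' x * b' x * c x ∂μ)
  simp only [zero_add] at t4
  refine t4.congr fun k => ?_
  have i1 := integrable_mul_of_memLp (da k) (mc (db k))
  have i2 := integrable_mul_of_memLp (da k) (mc hb')
  have i3 := integrable_mul_of_memLp (db k) (mc ha')
  have i4 : Integrable (fun x => a' x * b' x * c x) μ := by
    simpa only [mul_assoc] using integrable_mul_of_memLp ha' (mc hb')
  have i12 : Integrable (fun x => (a k x - a' x) * ((b k x - b' x) * c x) +
      (a k x - a' x) * (b' x * c x)) μ := i1.add i2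
  have i123 : Integrable (fun x => (a k x - a' x) * ((b k x - b' x) * c x) +
      (a k x - a' x) * (b' x * c x) + (b k x - b' x) * (a' x * c x)) μ := i12.add i3
  rw [← integral_add i1 i2, ← integral_add i12 i3, ← integral_add i123 i4]
  congr 1; ext x; ring

end CauchySchwarz

/-! ### Mollified Sobolev functions and the product rule. -/

lemma memLp_indicator {F : Type*} [NormedAddCommGroup F] {Ω : Set (Rn n)} (hΩ : IsOpen Ω)
    {u : Rn n → F} (hu : MemLp u 2 (volume.restrict Ω)) : MemLp (Ω.indicator u) 2 :=
  (memLp_indicator_iff_restrict hΩ.measurableSet).2 hu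

lemma contDiff_moll {F : Type*} [NormedAddCommGroup F] [NormedSpace ℝ F] [CompleteSpace F]
    {w : Rn n → F} (hw : LocallyIntegrable w) (k : ℕ) :
    ContDiff ℝ ∞ (moll k w) :=
  (hasCompactSupport_eta k).contDiff_convolution_left _ (contDiff_eta k) hw

lemma memLp_coord {μ : Measure (Rn n)} {g : Rn n → Rn n} (hg : MemLp g 2 μ) (j : Fin n) :
    MemLp (fun x => g x j) 2 μ :=
  (EuclideanSpace.proj (𝕜 := ℝ) j).comp_memLp' hg

lemma moll_coord {g : Rn n → Rn n} (hg : LocallyIntegrable g) (k : ℕ) (x : Rn n) (j : Fin n) :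
    (moll k g x) j = moll k (fun y => g y j) x := by
  rw [moll_apply, moll_apply]
  have := (EuclideanSpace.proj (𝕜 := ℝ) j).integral_comp_comm (integrable_eta_smul (k := k) hg x)
  simpa using this.symm

lemma fderiv_moll_apply {u : Rn n → ℝ} (hul : LocallyIntegrable u) (k : ℕ) (x v : Rn n) :
    fderiv ℝ (moll k u) x v = ∫ t, fderiv ℝ (eta n k) (x - t) v * u t := by
  have hη1 : ContDiff ℝ 1 (eta n k) := (contDiff_eta k).of_le (by simp)
  have h1 := ((hasCompactSupport_eta k).hasFDerivAt_convolution_left (lsmul ℝ ℝ) hη1 hul x).fderiv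
  have hI := (((hasCompactSupport_eta k).fderiv ℝ).convolutionExists_left
      ((lsmul ℝ ℝ).precompL (Rn n)) (hη1.continuous_fderiv one_ne_zero) hul x).integrable_swap
  rw [moll, h1, convolution_eq_swap, ContinuousLinearMap.integral_apply hI]
  rfl

/-- If the mollifying ball around x lies in Ω, then t ↦ η(x - t) is an admissible test function. The
sign from differentiating it in t cancels the sign in the definition of the weak gradient. -/
lemma fderiv_moll {Ω : Set (Rn n)} (hΩ : IsOpen Ω) {u : Rn n → ℝ} {g : Rn n → Rn n}
    (hu : MemLp u 2 (volume.restrict Ω)) (hg : MemLp g 2 (volume.restrict Ω))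
    (h : HasWeakGradient Ω u g) {k : ℕ} {x : Rn n}
    (hx : Metric.closedBall x (bump n k).rOut ⊆ Ω) (j : Fin n) :
    fderiv ℝ (moll k (Ω.indicator u)) x (e j) = (moll k (Ω.indicator g) x) j := by
  have hul := MemLp.locallyIntegrable_two (memLp_indicator hΩ hu)
  have hgl := MemLp.locallyIntegrable_two (memLp_indicator hΩ hg)
  rw [fderiv_moll_apply hul]
  set φ : Rn n → ℝ := fun t => eta n k (x - t) with hφ
  have hφs : ContDiff ℝ ∞ φ := (contDiff_eta k).comp (contDiff_const.sub contDiff_id)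
  have hφc : HasCompactSupport φ :=
    (hasCompactSupport_eta k).comp_homeomorph (Homeomorph.subLeft x)
  have hφd : ∀ t, fderiv ℝ φ t (e j) = - fderiv ℝ (eta n k) (x - t) (e j) := by
    intro t
    have h2 : HasFDerivAt φ ((fderiv ℝ (eta n k) (x - t)).comp
        (-ContinuousLinearMap.id ℝ (Rn n))) t :=
      HasFDerivAt.comp t ((contDiff_eta k).differentiable (by simp) _).hasFDerivAt
        ((hasFDerivAt_id t).const_sub x)
    rw [h2.fderiv]; simp
  have hφt : tsupport φ ⊆ Ω := by
    refine subset_trans ?_ hx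
    refine closure_minimal ?_ Metric.isClosed_closedBall
    intro t ht
    have : x - t ∈ Function.support (eta n k) := ht
    rw [eta, (bump n k).support_normed_eq] at this
    rw [Metric.mem_closedBall, dist_comm, dist_eq_norm]
    simpa using (mem_ball_zero_iff.1 this).le
  have h3 := h φ hφs hφc hφt j
  rw [moll_coord hgl, moll_apply]
  simp only [hφd, mul_neg, integral_neg, neg_inj] at h3
  rw [← integral_indicator hΩ.measurableSet, ← integral_indicator hΩ.measurableSet] at h3
  refine Eq.trans (integral_congr_ae ?_) (h3.trans (integral_congr_ae ?_))
  · filter_upwards with t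
    by_cases ht : t ∈ Ω <;> simp [ht, mul_comm]
  · filter_upwards with t
    by_cases ht : t ∈ Ω <;> simp [ht, mul_comm, hφ]

lemma eventually_closedBall_bump_subset {Ω K : Set (Rn n)} (hΩ : IsOpen Ω) (hK : IsCompact K)
    (hKΩ : K ⊆ Ω) : ∀ᶠ k in atTop, ∀ x ∈ K, Metric.closedBall x (bump n k).rOut ⊆ Ω := by
  obtain ⟨δ, hδ, hδΩ⟩ := hK.exists_cthickening_subset_open hΩ hKΩ
  filter_upwards [tendsto_bump_rOut.eventually (gt_mem_nhds hδ)] with k hk x hx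
  exact (Metric.closedBall_subset_closedBall hk.le).trans
    ((Metric.closedBall_subset_cthickening hx δ).trans hδΩ)

/-- The product rule for the square of a Sobolev function. -/
theorem integral_sq_mul_fderiv {Ω : Set (Rn n)} (hΩ : IsOpen Ω) {u : Rn n → ℝ} {g : Rn n → Rn n}
    (hu : MemLp u 2 (volume.restrict Ω)) (hg : MemLp g 2 (volume.restrict Ω))
    (h : HasWeakGradient Ω u g) {φ : Rn n → ℝ} (hφ : ContDiff ℝ ∞ φ) (hφc : HasCompactSupport φ)
    (hφΩ : tsupport φ ⊆ Ω) (j : Fin n) :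
    ∫ x in Ω, u x ^ 2 * fderiv ℝ φ x (e j) = - ∫ x in Ω, 2 * (u x * g x j) * φ x := by
  have hu' := memLp_indicator hΩ hu
  have hg' := memLp_indicator hΩ hg
  have hul := MemLp.locallyIntegrable_two hu'
  have hgl := MemLp.locallyIntegrable_two hg'
  set U := Ω.indicator u
  set G := Ω.indicator g
  have hφ1 : Continuous (fun x => fderiv ℝ φ x (e j)) :=
    (hφ.continuous_fderiv (by simp)).clm_apply continuous_const
  have hφ1c : HasCompactSupport (fun x => fderiv ℝ φ x (e j)) := hφc.fderiv_apply ℝ (e j)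
  obtain ⟨M, hM⟩ := hφc.exists_bound_of_continuous hφ.continuous
  obtain ⟨M1, hM1⟩ := hφ1c.exists_bound_of_continuous hφ1
  have mG : ∀ k, (fun x => moll k G x j) = moll k (fun x => G x j) := fun k =>
    funext fun x => moll_coord hgl k x j
  have tU := tendsto_moll hu'
  have tG := tendsto_moll (memLp_coord hg' j)
  simp only [Real.norm_eq_abs, sq_abs] at tU tG
  have T1 := tendsto_integral_mul_mul (fun k => (memLp_moll hu' k).1) (fun k => (memLp_moll hu' k).1)
    hu' hu' hφ1.aestronglyMeasurable hM1 tU tU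
  have T2 := (tendsto_integral_mul_mul (fun k => (memLp_moll hu' k).1)
    (fun k => (memLp_moll (memLp_coord hg' j) k).1) hu' (memLp_coord hg' j)
    hφ.continuous.aestronglyMeasurable hM tU tG).const_mul (-2)
  -- For the mollified functions this is classical integration by parts. The formula for their
  -- gradient is needed only on the support of φ, hence only for k large.
  have hk : ∀ᶠ k in atTop, ∫ x, moll k U x * moll k U x * fderiv ℝ φ x (e j) =
      -2 * ∫ x, moll k U x * moll k (fun x => G x j) x * φ x := by
    filter_upwards [eventually_closedBall_bump_subset hΩ hφc.isCompact hφΩ] with k hk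
    have hv := contDiff_moll hul k
    have hvd := hv.differentiable (by simp)
    have hd : ∀ x, HasFDerivAt (fun x => moll k U x * moll k U x)
        (moll k U x • fderiv ℝ (moll k U) x + moll k U x • fderiv ℝ (moll k U) x) x := fun x =>
      (hvd x).hasFDerivAt.mul (hvd x).hasFDerivAt
    have c1 : Continuous (fun x => fderiv ℝ (fun x => moll k U x * moll k U x) x (e j)) :=
      ((hv.mul hv).continuous_fderiv (by simp)).clm_apply continuous_const
    have ibp := integral_mul_fderiv_eq_neg_fderiv_mul_of_integrable (μ := volume)
      (f := fun x => moll k U x * moll k U x) (g := φ) (v := e j)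
      ((c1.mul hφ.continuous).integrable_of_hasCompactSupport hφc.mul_left)
      (((hv.continuous.mul hv.continuous).mul hφ1).integrable_of_hasCompactSupport hφ1c.mul_left)
      (((hv.continuous.mul hv.continuous).mul hφ.continuous).integrable_of_hasCompactSupport
        hφc.mul_left)
      (fun x _ => (hd x).differentiableAt) (fun x _ => hφ.differentiable (by simp) x)
    rw [ibp, ← integral_neg, ← integral_const_mul]
    refine integral_congr_ae ?_
    filter_upwards with x
    by_cases hx : x ∈ tsupport φ
    · rw [(hd x).fderiv, ← moll_coord hgl, ← fderiv_moll hΩ hu hg h (hk x hx) j]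
      simp only [add_apply, smul_apply, smul_eq_mul, U]
      ring
    · rw [image_eq_zero_of_notMem_tsupport hx]; simp
  have := tendsto_nhds_unique (T1.congr' hk) T2
  rw [← integral_indicator hΩ.measurableSet, ← integral_indicator hΩ.measurableSet, ← integral_neg]
  rw [← integral_const_mul] at this
  refine Eq.trans (integral_congr_ae ?_) (this.trans (integral_congr_ae ?_))
  · filter_upwards with x
    by_cases hx : x ∈ Ω <;> simp [hx, U, sq]
  · filter_upwards with x
    by_cases hx : x ∈ Ω <;> simp [hx, U, G]
    ring

/-! ### Lebesgue points and the Poincaré inequality. -/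

/-- The volume of the unit ball of `ℝⁿ`. -/
def unitVol (n : ℕ) : ℝ := volume.real (Metric.ball (0 : Rn n) 1)

lemma unitVol_pos : 0 < unitVol n :=
  ENNReal.toReal_pos (Metric.measure_ball_pos _ _ one_pos).ne' Metric.isBounded_ball.measure_lt_top.ne

lemma volume_real_ball (x : Rn n) {r : ℝ} (hr : 0 < r) :
    volume.real (Metric.ball x r) = r ^ n * unitVol n := by
  rw [unitVol, Measure.real, Measure.addHaar_ball_of_pos volume x hr]
  simp [Measure.real, hr.le]

/-- `x` is a Lebesgue point of `w`. -/
def IsLebesguePoint {F : Type*} [NormedAddCommGroup F] (w : Rn n → F) (x : Rn n) : Prop :=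
  ∀ ε > 0, ∃ ρ₀ > 0, ∀ ρ, 0 < ρ → ρ < ρ₀ → ∫ y in Metric.ball x ρ, ‖w y - w x‖ ≤ ε * ρ ^ n

lemma ball_ae_eq_closedBall (x : Rn n) {r : ℝ} (hr : 0 < r) :
    Metric.ball x r =ᵐ[volume] Metric.closedBall x r := by
  have h0 : volume (Metric.sphere x r) = 0 := Measure.addHaar_sphere_of_ne_zero _ x hr.ne'
  have := (ae_eq_set_union (ae_eq_refl (μ := volume) (Metric.ball x r)) (ae_eq_empty.2 h0)).symm
  rwa [Metric.ball_union_sphere, Set.union_empty] at this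

/-- Lebesgue differentiation along closed balls; spheres are null, and the volume of the unit ball
is absorbed in ε. -/
theorem ae_isLebesguePoint {F : Type*} [NormedAddCommGroup F] {w : Rn n → F}
    (hw : LocallyIntegrable w) : ∀ᵐ x, IsLebesguePoint w x := by
  filter_upwards [IsUnifLocDoublingMeasure.ae_tendsto_average_norm_sub (μ := volume) hw 1]
    with x hx ε hε
  have h1 := hx (l := 𝓝[>] (0 : ℝ)) (fun _ => x) (fun r => r) tendsto_id (by
    filter_upwards [self_mem_nhdsWithin] with r hr
    exact Metric.mem_closedBall_self (by simpa using (Set.mem_Ioi.1 hr).le))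
  have hε' : 0 < ε / unitVol n := div_pos hε unitVol_pos
  obtain ⟨ρ₀, hρ₀, h2⟩ := mem_nhdsGT_iff_exists_Ioo_subset.1
    (h1.eventually (gt_mem_nhds hε'))
  refine ⟨ρ₀, hρ₀, fun ρ h0 h3 => ?_⟩
  have h4 : ⨍ y in Metric.closedBall x ρ, ‖w y - w x‖ < ε / unitVol n := h2 ⟨h0, h3⟩
  rw [setAverage_eq, ← setIntegral_congr_set (ball_ae_eq_closedBall x h0),
    measureReal_congr (ball_ae_eq_closedBall x h0).symm, volume_real_ball x h0, smul_eq_mul,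
    inv_mul_lt_iff₀ (mul_pos (pow_pos h0 n) unitVol_pos)] at h4
  have := unitVol_pos (n := n)
  refine h4.le.trans (le_of_eq ?_)
  field_simp

lemma indicator_ball_homothety (F : Rn n → ℝ) (x : Rn n) (r : ℝ) {t : ℝ} (ht : 0 < t) :
    (Metric.ball x r).indicator (fun z => F (x + t • (z - x))) =
      fun z => (Metric.ball x (t * r)).indicator F (x + t • (z - x)) := by
  ext z
  have : z ∈ Metric.ball x r ↔ x + t • (z - x) ∈ Metric.ball x (t * r) := by
    simp only [Metric.mem_ball, dist_eq_norm, add_sub_cancel_left, norm_smul,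
      Real.norm_of_nonneg ht.le]
    exact (mul_lt_mul_iff_right₀ ht).symm
  by_cases hz : z ∈ Metric.ball x r
  · rw [Set.indicator_of_mem hz, Set.indicator_of_mem (this.1 hz)]
  · rw [Set.indicator_of_notMem hz, Set.indicator_of_notMem (fun h => hz (this.2 h))]

lemma locallyIntegrable_norm {F : Type*} [NormedAddCommGroup F] {w : Rn n → F}
    (hw : LocallyIntegrable w) : LocallyIntegrable fun x => ‖w x‖ := by
  intro x
  obtain ⟨s, hs, h⟩ := hw x
  exact ⟨s, hs, h.norm⟩

lemma setIntegral_ball_homothety (F : Rn n → ℝ) (x : Rn n) (r : ℝ) {t : ℝ} (ht : 0 < t) :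
    ∫ z in Metric.ball x r, F (x + t • (z - x)) = (t ^ n)⁻¹ * ∫ z in Metric.ball x (t * r), F z := by
  rw [← integral_indicator Metric.isOpen_ball.measurableSet,
    ← integral_indicator Metric.isOpen_ball.measurableSet]
  rw [indicator_ball_homothety F x r ht]
  set I := (Metric.ball x (t * r)).indicator F
  rw [integral_sub_right_eq_self (fun z => I (x + t • z)) x,
    Measure.integral_comp_smul volume (fun z => I (x + z)) t, integral_add_left_eq_self I x]
  simp [abs_of_pos ht]

lemma integrable_prod_ball_Icc {N : Rn n → ℝ} (hN : Continuous N) (x : Rn n) (r δ : ℝ) :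
    Integrable (Function.uncurry fun (z : Rn n) (t : ℝ) => N (x + t • (z - x)))
      ((volume.restrict (Metric.ball x r)).prod (volume.restrict (Set.Ioc δ 1))) := by
  rw [Measure.prod_restrict]
  have hc : Continuous (Function.uncurry fun (z : Rn n) (t : ℝ) => N (x + t • (z - x))) := by
    unfold Function.uncurry; fun_prop
  have : IntegrableOn (Function.uncurry fun (z : Rn n) (t : ℝ) => N (x + t • (z - x)))
      (Metric.closedBall x r ×ˢ Set.Icc δ 1) (volume.prod volume) :=
    hc.continuousOn.integrableOn_compact ((isCompact_closedBall x r).prod isCompact_Icc)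
  exact this.mono_set (Set.prod_mono Metric.ball_subset_closedBall Set.Ioc_subset_Icc_self)

/-- A Poincaré type inequality on a ball for smooth functions. -/
lemma integral_ball_sub_homothety_le {v : Rn n → ℝ} (hv : ContDiff ℝ ∞ v) (x a : Rn n) {r δ C : ℝ}
    (hr : 0 < r) (hδ : 0 < δ) (hδ1 : δ < 1)
    (hC : ∀ t, δ ≤ t → t ≤ 1 →
      ∫ z in Metric.ball x (t * r), ‖fderiv ℝ v z - innerSL ℝ a‖ ≤ C * t ^ n) (hC0 : 0 ≤ C) :
    ∫ z in Metric.ball x r, |v z - v (x + δ • (z - x)) - (1 - δ) * inner ℝ a (z - x)| ≤ r * C := by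
  set N : Rn n → ℝ := fun z => ‖fderiv ℝ v z - innerSL ℝ a‖
  have hdc : Continuous (fderiv ℝ v) := hv.continuous_fderiv (by simp)
  have hN : Continuous N := (hdc.sub continuous_const).norm
  have hvd := hv.differentiable (by simp)
  -- The fundamental theorem of calculus on the segment from x + δ(z - x) to z, applied to v minus
  -- the linear function with gradient a. The length bound |z - x| < r produces the factor r.
  have hpt : ∀ z ∈ Metric.ball x r,
      |v z - v (x + δ • (z - x)) - (1 - δ) * inner ℝ a (z - x)| ≤
        r * ∫ t in Set.Ioc δ 1, N (x + t • (z - x)) := by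
    intro z hz
    have hd : ∀ t : ℝ, HasDerivAt (fun t : ℝ => v (x + t • (z - x)) - t * inner ℝ a (z - x))
        ((fderiv ℝ v (x + t • (z - x)) - innerSL ℝ a) (z - x)) t := by
      intro t
      have h1 : HasDerivAt (fun t : ℝ => x + t • (z - x)) (z - x) t := by
        simpa using ((hasDerivAt_id t).smul_const (z - x)).const_add x
      have h2 := (hvd (x + t • (z - x))).hasFDerivAt.comp_hasDerivAt t h1
      have h3 := h2.sub ((hasDerivAt_id t).mul_const (inner ℝ a (z - x)))
      refine h3.congr_deriv ?_
      simp
    have hcont : Continuous fun t : ℝ => (fderiv ℝ v (x + t • (z - x)) - innerSL ℝ a) (z - x) :=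
      ((hdc.comp (by fun_prop)).sub continuous_const).clm_apply continuous_const
    have h4 := intervalIntegral.integral_eq_sub_of_hasDerivAt (a := δ) (b := 1)
      (fun t _ => hd t) (hcont.intervalIntegrable _ _)
    have h5 : v z - v (x + δ • (z - x)) - (1 - δ) * inner ℝ a (z - x) =
        ∫ t in Set.Ioc δ 1, (fderiv ℝ v (x + t • (z - x)) - innerSL ℝ a) (z - x) := by
      rw [← intervalIntegral.integral_of_le hδ1.le, h4, one_smul, add_sub_cancel]; ring
    have hcN : Continuous fun t : ℝ => N (x + t • (z - x)) := hN.comp (by fun_prop)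
    rw [h5, ← Real.norm_eq_abs, ← integral_const_mul]
    refine (norm_integral_le_integral_norm _).trans (integral_mono
      (hcont.norm.integrableOn_Ioc) ((hcN.const_mul r).integrableOn_Ioc) fun t => ?_)
    change ‖(fderiv ℝ v (x + t • (z - x)) - innerSL ℝ a) (z - x)‖ ≤ r * N (x + t • (z - x))
    rw [mul_comm]
    refine (ContinuousLinearMap.le_opNorm _ _).trans
      (mul_le_mul_of_nonneg_left ?_ (norm_nonneg _))
    rw [← dist_eq_norm]; exact (Metric.mem_ball.1 hz).le
  have hI := integrable_prod_ball_Icc hN x r δ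
  have hc1 : Continuous fun z => v (x + δ • (z - x)) := hv.continuous.comp (by fun_prop)
  have hc2 : Continuous fun z : Rn n => inner ℝ a (z - x) := by fun_prop
  have hc3 : Continuous fun z => |v z - v (x + δ • (z - x)) - (1 - δ) * inner ℝ a (z - x)| :=
    ((hv.continuous.sub hc1).sub (hc2.const_mul _)).abs
  -- Fubini, then the homothety of ratio t turns the inner integral into one over the ball of radius
  -- t r, where `hC` applies; its factor t^n cancels the Jacobian.
  calc _ ≤ ∫ z in Metric.ball x r, r * ∫ t in Set.Ioc δ 1, N (x + t • (z - x)) := by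
        refine setIntegral_mono_on ?_ (hI.integral_prod_left.const_mul r)
          Metric.isOpen_ball.measurableSet hpt
        exact (hc3.continuousOn.integrableOn_compact (isCompact_closedBall x r)).mono_set
          Metric.ball_subset_closedBall
    _ = r * ∫ t in Set.Ioc δ 1, ∫ z in Metric.ball x r, N (x + t • (z - x)) := by
        rw [integral_const_mul, integral_integral_swap hI]
    _ ≤ r * ∫ t in Set.Ioc δ 1, C := by
        refine mul_le_mul_of_nonneg_left (setIntegral_mono_on hI.integral_prod_right
          (by simp) measurableSet_Ioc ?_) hr.le
        intro t ht
        have ht0 : 0 < t := hδ.trans ht.1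
        rw [setIntegral_ball_homothety N x r ht0, inv_mul_le_iff₀ (pow_pos ht0 n), mul_comm (t ^ n)]
        exact hC t ht.1.le ht.2
    _ ≤ r * C := by
        refine mul_le_mul_of_nonneg_left ?_ hr.le
        simp only [integral_const, MeasurableSet.univ, measureReal_restrict_apply, Set.univ_inter,
          Real.volume_real_Ioc_of_le hδ1.le, smul_eq_mul]
        nlinarith

lemma eq_innerSL_of_apply_e {L : Rn n →L[ℝ] ℝ} {b : Rn n} (h : ∀ j, L (e j) = b j) :
    L = innerSL ℝ b := by
  refine ContinuousLinearMap.coe_injective ((EuclideanSpace.basisFun (Fin n) ℝ).toBasis.ext ?_)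
  intro j
  have := h j
  simp only [e] at this
  simp [this, EuclideanSpace.inner_single_right]

lemma setIntegral_norm_le_sqrt {F : Type*} [NormedAddCommGroup F] {w : Rn n → F} (hw : MemLp w 2)
    {s : Set (Rn n)} (hs : volume s ≠ ⊤) :
    ∫ x in s, ‖w x‖ ≤ Real.sqrt (volume.real s * ∫ x, ‖w x‖ ^ 2) := by
  have : IsFiniteMeasure (volume.restrict s) := ⟨by simpa using hs.lt_top⟩
  refine Real.le_sqrt_of_sq_le ?_
  have h := sq_integral_mul_le (μ := volume.restrict s) (a := fun _ => (1 : ℝ))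
    (b := fun x => ‖w x‖) (memLp_const 1) (hw.restrict s).norm
  simp only [one_mul, one_pow, integral_const, smul_eq_mul, mul_one] at h
  refine h.trans ?_
  rw [measureReal_restrict_apply_univ]
  refine mul_le_mul_of_nonneg_left ?_ measureReal_nonneg
  exact setIntegral_le_integral (MemLp.integrable_norm_sq hw)
    (Eventually.of_forall fun _ => by positivity)

/-- A Poincaré type inequality at a Lebesgue point of a Sobolev function, for balls contained in
the domain. -/
theorem integral_ball_sub_affine_le {Ω : Set (Rn n)} (hΩ : IsOpen Ω) {u : Rn n → ℝ}
    {g : Rn n → Rn n} (hu : MemLp u 2 (volume.restrict Ω)) (hg : MemLp g 2 (volume.restrict Ω))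
    (h : HasWeakGradient Ω u g) {x : Rn n} (hx : IsLebesguePoint (Ω.indicator u) x) (a : Rn n)
    {r C : ℝ} (hr : 0 < r) (hrΩ : Metric.closedBall x r ⊆ Ω) (hC0 : 0 ≤ C)
    (hC : ∀ s, 0 < s → s ≤ r → ∫ y in Metric.ball x s, ‖g y - a‖ ≤ C * s ^ n) :
    ∫ z in Metric.ball x r, |u z - u x - inner ℝ a (z - x)| ≤ r * (C * r ^ n) := by
  have hu' := memLp_indicator hΩ hu
  have hg' := memLp_indicator hΩ hg
  have hul := MemLp.locallyIntegrable_two hu'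
  have hgl := MemLp.locallyIntegrable_two hg'
  have hxΩ : x ∈ Ω := hrΩ (Metric.mem_closedBall_self hr.le)
  have hbΩ : Metric.ball x r ⊆ Ω := Metric.ball_subset_closedBall.trans hrΩ
  set U := Ω.indicator u with hU
  set G := Ω.indicator g with hG
  set B := Metric.ball x r with hB
  have hBm : MeasurableSet B := Metric.isOpen_ball.measurableSet
  have hBf : volume B ≠ ⊤ := Metric.isBounded_ball.measure_lt_top.ne
  have hLHS : ∫ z in B, |u z - u x - inner ℝ a (z - x)| =
      ∫ z in B, |U z - U x - inner ℝ a (z - x)| := by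
    refine setIntegral_congr_fun hBm fun z hz => ?_
    simp [hU, hbΩ hz, hxΩ]
  rw [hLHS]
  have loc : ∀ {w : Rn n → ℝ}, LocallyIntegrable w → ∀ s, IntegrableOn w (Metric.ball x s) :=
    fun hw s => (hw.integrableOn_isCompact (isCompact_closedBall x s)).mono_set
      Metric.ball_subset_closedBall
  refine le_of_forall_pos_le_add fun ε hε => ?_
  -- the choice of the ratio of the homothety
  obtain ⟨ρ₀, hρ₀, hleb⟩ := hx (ε / 4 / r ^ n) (by positivity)
  set A := ∫ z in B, |inner ℝ a (z - x)|
  have hA : 0 ≤ A := integral_nonneg fun _ => abs_nonneg _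
  obtain ⟨δ, hδ, hδ1, hδρ, hδA⟩ : ∃ δ : ℝ, 0 < δ ∧ δ < 1 ∧ δ * r < ρ₀ ∧ δ * A ≤ ε / 4 := by
    refine ⟨min (1 / 2) (min (ρ₀ / (2 * r)) (ε / 4 / (A + 1))), by positivity, ?_, ?_, ?_⟩
    · exact (min_le_left _ _).trans_lt (by norm_num)
    · calc _ ≤ ρ₀ / (2 * r) * r := by
            gcongr; exact (min_le_right _ _).trans (min_le_left _ _)
        _ < ρ₀ := by field_simp; norm_num
    · calc _ ≤ ε / 4 / (A + 1) * (A + 1) := by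
            gcongr
            · exact (min_le_right _ _).trans (min_le_right _ _)
            · linarith
        _ = ε / 4 := by field_simp
  -- the mollified functions
  set V := volume.real B
  have tU := ((tendsto_moll hu').const_mul V).sqrt
  have tG := ((tendsto_moll hg').const_mul V).sqrt
  rw [mul_zero, Real.sqrt_zero] at tU tG
  have tt : Tendsto (fun k => Real.sqrt (V * ∫ x, ‖moll k U x - U x‖ ^ 2) * (1 + (δ ^ n)⁻¹) +
      r * (Real.sqrt (V * ∫ x, ‖moll k G x - G x‖ ^ 2) * (δ ^ n)⁻¹)) atTop (𝓝 0) := by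
    simpa using (tU.mul_const (1 + (δ ^ n)⁻¹)).add ((tG.mul_const ((δ ^ n)⁻¹)).const_mul r)
  -- The scale of mollification is chosen after δ, because undoing the homothety multiplies the
  -- mollification errors by δ^(-n).
  obtain ⟨k, hk, hkε⟩ := ((eventually_closedBall_bump_subset hΩ (isCompact_closedBall x r) hrΩ).and
    (tt.eventually (gt_mem_nhds (show 0 < ε / 2 by positivity)))).exists
  set v := moll k U with hv
  have hvs : ContDiff ℝ ∞ v := contDiff_moll hul k
  set dU := Real.sqrt (V * ∫ x, ‖moll k U x - U x‖ ^ 2)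
  set dG := Real.sqrt (V * ∫ x, ‖moll k G x - G x‖ ^ 2)
  have hdU : ∫ z in B, ‖v z - U z‖ ≤ dU :=
    setIntegral_norm_le_sqrt ((memLp_moll hu' k).1.sub hu') hBf
  have hdG : ∫ z in B, ‖moll k G z - G z‖ ≤ dG :=
    setIntegral_norm_le_sqrt ((memLp_moll hg' k).1.sub hg') hBf
  have hGd : LocallyIntegrable (fun z => ‖moll k G z - G z‖) :=
    locallyIntegrable_norm (MemLp.locallyIntegrable_two ((memLp_moll hg' k).1.sub hg'))
  have hUd : LocallyIntegrable (fun z => ‖v z - U z‖) :=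
    locallyIntegrable_norm (MemLp.locallyIntegrable_two ((memLp_moll hu' k).1.sub hu'))
  have hGa : LocallyIntegrable (fun z => ‖G z - a‖) :=
    locallyIntegrable_norm (hgl.sub (locallyIntegrable_const a))
  have hUx : LocallyIntegrable (fun z => ‖U z - U x‖) :=
    locallyIntegrable_norm (hul.sub (locallyIntegrable_const (U x)))
  have hδr : 0 < δ * r := mul_pos hδ hr
  have hsub : ∀ t : ℝ, 0 < t → t ≤ 1 → Metric.ball x (t * r) ⊆ B := fun t _ ht =>
    Metric.ball_subset_ball (by nlinarith)
  -- On the ball of radius t r the gradient error is at most C (t r)^n + dG, and dG ≤ dG δ^(-n) t^n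
  -- since t ≥ δ.
  have hsmooth := integral_ball_sub_homothety_le hvs x a hr hδ hδ1 (C := C * r ^ n + dG * (δ ^ n)⁻¹)
    (by
      intro t ht ht1
      have ht0 : 0 < t := hδ.trans_le ht
      have e1 : ∀ z ∈ Metric.ball x (t * r), ‖fderiv ℝ v z - innerSL ℝ a‖ ≤
          ‖G z - a‖ + ‖moll k G z - G z‖ := by
        intro z hz
        have hz' : z ∈ B := hsub t ht0 ht1 hz
        have : fderiv ℝ v z = innerSL ℝ (moll k G z) := eq_innerSL_of_apply_e fun j =>
          fderiv_moll hΩ hu hg h (hk z (Metric.ball_subset_closedBall hz')) j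
        rw [this, ← map_sub, innerSL_apply_norm]
        refine (le_of_eq ?_).trans (norm_add_le _ _)
        congr 1; abel
      have hcd : Continuous fun z => ‖fderiv ℝ v z - innerSL ℝ a‖ :=
        ((hvs.continuous_fderiv (by simp)).sub continuous_const).norm
      have hi2 : IntegrableOn (fun z => ‖G z - a‖ + ‖moll k G z - G z‖) (Metric.ball x (t * r)) :=
        (loc hGa _).add (loc hGd _)
      refine (setIntegral_mono_on (loc hcd.locallyIntegrable _) hi2
        Metric.isOpen_ball.measurableSet e1).trans ?_
      rw [integral_add (loc hGa _) (loc hGd _), add_mul]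
      refine add_le_add ?_ ?_
      · have := hC (t * r) (mul_pos ht0 hr) (by nlinarith)
        rw [mul_assoc, ← mul_pow, mul_comm r t]
        refine (le_of_eq ?_).trans this
        refine setIntegral_congr_fun Metric.isOpen_ball.measurableSet fun z hz => ?_
        simp [hG, hbΩ (hsub t ht0 ht1 hz)]
      · have h1 : ∫ z in Metric.ball x (t * r), ‖moll k G z - G z‖ ≤ dG :=
          (setIntegral_mono_set (loc hGd r) (Eventually.of_forall fun _ => norm_nonneg _)
            (hsub t ht0 ht1).eventuallyLE).trans hdG
        have h2 : 1 ≤ (δ ^ n)⁻¹ * t ^ n := by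
          rw [le_inv_mul_iff₀ (pow_pos hδ n), mul_one]
          exact pow_le_pow_left₀ hδ.le ht n
        have h3 : 0 ≤ dG := Real.sqrt_nonneg _
        rw [mul_assoc]
        nlinarith)
    (by have : 0 ≤ dG := Real.sqrt_nonneg _
        positivity)
  have hhom : ∀ {w : Rn n → ℝ}, LocallyIntegrable w →
      IntegrableOn (fun z => w (x + δ • (z - x))) B := by
    intro w hw
    have h1 : IntegrableOn w (Metric.ball x (δ * r)) := loc hw _
    rw [← integrable_indicator_iff Metric.isOpen_ball.measurableSet] at h1 ⊢
    have h2 := ((h1.comp_add_left x).comp_smul hδ.ne').comp_sub_right x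
    rw [indicator_ball_homothety w x r hδ]
    exact h2
  have hc2 : Continuous fun z : Rn n => inner ℝ a (z - x) := by fun_prop
  have hc1 : Continuous fun z => |v z - v (x + δ • (z - x)) - (1 - δ) * inner ℝ a (z - x)| :=
    ((hvs.continuous.sub (hvs.continuous.comp (by fun_prop))).sub (hc2.const_mul _)).abs
  have I1 := loc hUd r
  have I2 := loc hc1.locallyIntegrable r
  have I3 := hhom hUd
  have I4 := hhom hUx
  have I5 := loc (hc2.abs.const_mul δ).locallyIntegrable r
  -- Telescoping through v(z), v(x + δ(z - x)) and u(x + δ(z - x)): two mollification errors, the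
  -- smooth inequality, the oscillation at the Lebesgue point x, and the part δ⟨a, z - x⟩ of the
  -- linear function not covered by the segment.
  have hpt : ∀ z, |U z - U x - inner ℝ a (z - x)| ≤ ‖v z - U z‖ +
      |v z - v (x + δ • (z - x)) - (1 - δ) * inner ℝ a (z - x)| +
      ‖v (x + δ • (z - x)) - U (x + δ • (z - x))‖ + ‖U (x + δ • (z - x)) - U x‖ +
      δ * |inner ℝ a (z - x)| := by
    intro z
    simp only [Real.norm_eq_abs]
    rw [abs_sub_comm (v z) (U z), ← abs_of_pos hδ, ← abs_mul, abs_of_pos hδ,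
      ← abs_neg (δ * inner ℝ a (z - x))]
    refine le_trans (le_of_eq ?_) ((abs_add_le _ _).trans (add_le_add_left ((abs_add_le _ _).trans
      (add_le_add_left ((abs_add_le _ _).trans (add_le_add_left (abs_add_le _ _) _)) _)) _))
    congr 1; ring
  have J1 : ∫ z in B, ‖v (x + δ • (z - x)) - U (x + δ • (z - x))‖ ≤ (δ ^ n)⁻¹ * dU := by
    rw [setIntegral_ball_homothety (fun z => ‖v z - U z‖) x r hδ]
    refine mul_le_mul_of_nonneg_left ?_ (by positivity)
    exact (setIntegral_mono_set (loc hUd r) (Eventually.of_forall fun _ => norm_nonneg _)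
      (hsub δ hδ hδ1.le).eventuallyLE).trans hdU
  have J2 : ∫ z in B, ‖U (x + δ • (z - x)) - U x‖ ≤ ε / 4 := by
    rw [setIntegral_ball_homothety (fun z => ‖U z - U x‖) x r hδ, inv_mul_le_iff₀ (pow_pos hδ n)]
    refine (hleb (δ * r) hδr hδρ).trans (le_of_eq ?_)
    rw [mul_pow]; field_simp
  have I12 := I1.add I2
  have I123 := I12.add I3
  have I1234 := I123.add I4
  have hlast := setIntegral_mono_on (s := B)
    (loc (locallyIntegrable_norm ((hul.sub (locallyIntegrable_const (U x))).sub
      hc2.locallyIntegrable)) r)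
    (I1234.add I5) hBm (fun z _ => hpt z)
  rw [integral_add' I1234 I5, integral_add' I123 I4, integral_add' I12 I3, integral_add' I1 I2,
    integral_const_mul] at hlast
  simp only [Real.norm_eq_abs] at hlast hdU hsmooth J1 J2
  rw [← hB] at hlast hsmooth
  change ∫ z in B, |U z - U x - inner ℝ a (z - x)| ≤ _ + _ + _ + _ + δ * A at hlast
  linarith

/-! ### Unordered tuples: optimal matchings and local selections. -/

section UnorderedTuples

/-- Equal multiplicities give bijections between corresponding fibres of P and R, which glue to a
permutation. -/
lemma AQ.sum_eq_sum_iff {P R : Fin Q → Rn m} :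
    AQ.sum P = AQ.sum R ↔ ∃ σ : Equiv.Perm (Fin Q), ∀ i, R (σ i) = P i := by
  classical
  constructor
  · intro h
    have h1 : Finset.univ.val.map P = Finset.univ.val.map R := congrArg Subtype.val h
    have h2 : ∀ b, Nonempty ({i // P i = b} ≃ {i // R i = b}) := by
      intro b
      refine ⟨Fintype.equivOfCardEq ?_⟩
      have h3 := congrArg (Multiset.count b) h1
      rw [Multiset.count_map, Multiset.count_map] at h3
      rw [Fintype.card_subtype, Fintype.card_subtype]
      simpa only [Finset.card, Finset.filter_val, eq_comm] using h3
    have ε := fun b => (h2 b).some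
    refine ⟨(Equiv.sigmaFiberEquiv P).symm.trans ((Equiv.sigmaCongrRight ε).trans
      (Equiv.sigmaFiberEquiv R)), fun i => ?_⟩
    exact (ε (P i) ⟨i, rfl⟩).2
  · rintro ⟨σ, hσ⟩
    refine Subtype.ext ?_
    change Finset.univ.val.map P = Finset.univ.val.map R
    have : P = R ∘ σ := funext fun i => (hσ i).symm
    rw [this, ← Multiset.map_map]
    congr 1
    have := Finset.map_univ_equiv σ
    exact congrArg Finset.val this

lemma AQ.sum_comp_perm (P : Fin Q → Rn m) (σ : Equiv.Perm (Fin Q)) :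
    AQ.sum (P ∘ σ) = AQ.sum P :=
  AQ.sum_eq_sum_iff.2 ⟨σ, fun _ => rfl⟩

lemma AQ.exists_sum_eq (T : AQ Q m) : ∃ P : Fin Q → Rn m, AQ.sum P = T := by
  obtain ⟨s, hs⟩ := T
  obtain ⟨l, rfl⟩ := Quot.exists_rep s
  have hl : l.length = Q := hs
  subst hl
  refine ⟨l.get, Subtype.ext ?_⟩
  change Finset.univ.val.map l.get = (l : Multiset (Rn m))
  rw [Fin.univ_val_map, List.ofFn_get]

/-- The Euclidean distance of ordered tuples. -/
def tupleDist (P R : Fin Q → Rn m) : ℝ := Real.sqrt (∑ i, ‖P i - R i‖ ^ 2)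

lemma tupleDist_self (P : Fin Q → Rn m) : tupleDist P P = 0 := by simp [tupleDist]

lemma tupleDist_comm (P R : Fin Q → Rn m) : tupleDist P R = tupleDist R P := by
  simp only [tupleDist, norm_sub_rev]

lemma tupleDist_triangle (P R S : Fin Q → Rn m) :
    tupleDist P S ≤ tupleDist P R + tupleDist R S := by
  have h := dist_triangle (WithLp.toLp 2 P : PiLp 2 fun _ : Fin Q => Rn m) (WithLp.toLp 2 R)
    (WithLp.toLp 2 S)
  rw [PiLp.dist_eq_of_L2, PiLp.dist_eq_of_L2, PiLp.dist_eq_of_L2] at h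
  simp only [dist_eq_norm] at h
  exact h

lemma tupleDist_comp_perm (P R : Fin Q → Rn m) (σ : Equiv.Perm (Fin Q)) :
    tupleDist (P ∘ σ) (R ∘ σ) = tupleDist P R := by
  simp only [tupleDist, Function.comp]
  rw [Equiv.sum_comp σ fun i => ‖P i - R i‖ ^ 2]

lemma norm_sub_le_tupleDist (P R : Fin Q → Rn m) (i : Fin Q) : ‖P i - R i‖ ≤ tupleDist P R :=
  Real.le_sqrt_of_sq_le
    (Finset.single_le_sum (f := fun i => ‖P i - R i‖ ^ 2) (fun _ _ => sq_nonneg _)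
      (Finset.mem_univ i))

lemma continuous_tupleDist (P : Fin Q → Rn m) : Continuous fun R => tupleDist P R := by
  unfold tupleDist; fun_prop

lemma AQ.G_sum_le (P R : Fin Q → Rn m) (σ : Equiv.Perm (Fin Q)) :
    AQ.G (AQ.sum P) (AQ.sum R) ≤ tupleDist P (R ∘ σ) := by
  refine csInf_le ⟨0, ?_⟩ ⟨P, R ∘ σ, rfl, AQ.sum_comp_perm R σ, rfl⟩
  rintro d ⟨_, _, _, _, rfl⟩
  exact Real.sqrt_nonneg _

lemma AQ.G_sum_le_tupleDist (P R : Fin Q → Rn m) :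
    AQ.G (AQ.sum P) (AQ.sum R) ≤ tupleDist P R :=
  AQ.G_sum_le P R 1

/-- There are finitely many permutations, so one is optimal; any other enumerations of the two
tuples differ from P and R by permutations, so they do no better. -/
lemma AQ.exists_G_sum_eq (P R : Fin Q → Rn m) :
    ∃ σ : Equiv.Perm (Fin Q), AQ.G (AQ.sum P) (AQ.sum R) = tupleDist P (R ∘ σ) := by
  obtain ⟨σ, hσ⟩ := Finite.exists_min fun σ : Equiv.Perm (Fin Q) => tupleDist P (R ∘ σ)
  refine ⟨σ, le_antisymm (AQ.G_sum_le P R σ) ?_⟩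
  refine le_csInf ⟨_, P, R, rfl, rfl, rfl⟩ ?_
  rintro d ⟨P', R', hP, hR, rfl⟩
  obtain ⟨τ, hτ⟩ := AQ.sum_eq_sum_iff.1 hP.symm
  obtain ⟨κ, hκ⟩ := AQ.sum_eq_sum_iff.1 hR
  have h1 := hσ (τ.trans κ)
  refine h1.trans (le_of_eq ?_)
  change _ = tupleDist P' R'
  rw [← tupleDist_comp_perm P' R' τ]
  congr 1
  · exact funext fun i => (hτ i).symm
  · exact funext fun i => hκ (τ i)

lemma AQ.G_nonneg (T S : AQ Q m) : 0 ≤ AQ.G T S := by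
  refine Real.sInf_nonneg ?_
  rintro d ⟨_, _, _, _, rfl⟩
  exact Real.sqrt_nonneg _

lemma AQ.G_self (T : AQ Q m) : AQ.G T T = 0 := by
  obtain ⟨P, rfl⟩ := AQ.exists_sum_eq T
  exact le_antisymm ((AQ.G_sum_le_tupleDist P P).trans_eq (tupleDist_self P)) (AQ.G_nonneg _ _)

lemma AQ.G_comm (T S : AQ Q m) : AQ.G T S = AQ.G S T := by
  unfold AQ.G
  congr 1
  ext d
  constructor
  · rintro ⟨P, R, hP, hR, rfl⟩
    exact ⟨R, P, hR, hP, tupleDist_comm P R⟩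
  · rintro ⟨P, R, hP, hR, rfl⟩
    exact ⟨R, P, hR, hP, tupleDist_comm P R⟩

lemma AQ.G_triangle (T S U : AQ Q m) : AQ.G T U ≤ AQ.G T S + AQ.G S U := by
  obtain ⟨P, rfl⟩ := AQ.exists_sum_eq T
  obtain ⟨R, rfl⟩ := AQ.exists_sum_eq S
  obtain ⟨W, rfl⟩ := AQ.exists_sum_eq U
  obtain ⟨σ, hσ⟩ := AQ.exists_G_sum_eq P R
  obtain ⟨τ, hτ⟩ := AQ.exists_G_sum_eq R W
  rw [hσ, hτ, ← tupleDist_comp_perm R (W ∘ τ) σ]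
  exact (AQ.G_sum_le P W (σ.trans τ)).trans (tupleDist_triangle _ _ _)

lemma AQ.sq_abs_sum (P : Fin Q → Rn m) : (AQ.sum P).abs ^ 2 = ∑ i, ‖P i‖ ^ 2 := by
  obtain ⟨σ, hσ⟩ := AQ.exists_G_sum_eq P fun _ => 0
  rw [AQ.abs, hσ, tupleDist, Real.sq_sqrt (Finset.sum_nonneg fun _ _ => sq_nonneg _)]
  simp

lemma AQ.abs_nonneg (T : AQ Q m) : 0 ≤ T.abs := AQ.G_nonneg _ _

/-- The null sets attached to the functions G(f, T) depend on T; countably many T must suffice. -/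
lemma AQ.exists_countable_dense (Q m : ℕ) : ∃ D : Set (AQ Q m), D.Countable ∧
    ∀ T, ∀ ε > 0, ∃ S ∈ D, AQ.G T S < ε := by
  refine ⟨Set.range fun k => AQ.sum (TopologicalSpace.denseSeq (Fin Q → Rn m) k),
    Set.countable_range _, fun T ε hε => ?_⟩
  obtain ⟨P, rfl⟩ := AQ.exists_sum_eq T
  have ho : IsOpen {R | tupleDist P R < ε} := isOpen_lt (continuous_tupleDist P) continuous_const
  obtain ⟨k, hk⟩ := (TopologicalSpace.denseRange_denseSeq (Fin Q → Rn m)).exists_mem_open ho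
    ⟨P, by simpa [tupleDist_self] using hε⟩
  exact ⟨_, ⟨k, rfl⟩, (AQ.G_sum_le_tupleDist _ _).trans_lt hk⟩

/-- The number of distinct points of an unordered tuple. -/
def AQ.numPts (T : AQ Q m) : ℕ := Set.ncard {p | p ∈ T}

lemma AQ.numPts_sum (P : Fin Q → Rn m) : (AQ.sum P).numPts = (Set.range P).ncard := by
  unfold AQ.numPts
  congr 1
  ext p
  have : p ∈ AQ.sum P ↔ p ∈ Finset.univ.val.map P := Iff.rfl
  simp [this]

lemma exists_separation (P : Fin Q → Rn m) :
    ∃ δ > 0, ∀ i k, P i ≠ P k → δ ≤ ‖P i - P k‖ := by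
  by_cases h : ∃ q : Fin Q × Fin Q, P q.1 ≠ P q.2
  · obtain ⟨q, hq⟩ := h
    have : Nonempty {q : Fin Q × Fin Q // P q.1 ≠ P q.2} := ⟨⟨q, hq⟩⟩
    obtain ⟨a, ha⟩ := Finite.exists_min
      fun q : {q : Fin Q × Fin Q // P q.1 ≠ P q.2} => ‖P q.1.1 - P q.1.2‖
    exact ⟨_, norm_pos_iff.2 (sub_ne_zero.2 a.2), fun i k hik => ha ⟨(i, k), hik⟩⟩
  · push Not at h
    -- All points coincide, so any positive separation is vacuous.
    exact ⟨1, one_pos, fun i k hik => absurd (h (i, k)) hik⟩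

/-- P is a function of g, so it has at most as many values; with equal finite counts, that function
is injective on the values of g. -/
lemma ncard_range_le_of_factors {P g : Fin Q → Rn m} (h : ∀ i k, g i = g k → P i = P k) :
    (Set.range P).ncard ≤ (Set.range g).ncard ∧
      ((Set.range g).ncard = (Set.range P).ncard → ∀ i k, P i = P k → g i = g k) := by
  have hf : Function.FactorsThrough P g := fun i k => h i k
  set φ := Function.extend g P fun _ => 0
  have hφ : ∀ i, φ (g i) = P i := fun i => hf.extend_apply _ i
  have hr : Set.range P = φ '' Set.range g := by
    rw [← Set.range_comp]
    exact congrArg Set.range (funext fun i => (hφ i).symm)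
  refine ⟨hr ▸ Set.ncard_image_le (Set.finite_range g), fun he i k hik => ?_⟩
  rw [hr] at he
  have := (Set.ncard_image_iff (Set.finite_range g)).1 he.symm
  exact this ⟨i, rfl⟩ ⟨k, rfl⟩ (by rw [hφ, hφ, hik])

/-- A `Q`-valued function which is Lipschitz at small scales on `E` splits, near a point of `E` and
where the number of distinct values is constant, into Lipschitz functions any two of which are
identical or disjoint. -/
theorem exists_local_selection {f : Rn n → AQ Q m} {E : Set (Rn n)} {K δ₀ : ℝ} (hK : 0 ≤ K)
    (hδ₀ : 0 < δ₀)
    (hf : ∀ x ∈ E, ∀ y ∈ E, dist x y < δ₀ → AQ.G (f x) (f y) ≤ K * dist x y) {x₀ : Rn n}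
    (hx₀ : x₀ ∈ E) :
    ∃ ρ > 0, (∀ y ∈ E ∩ Metric.ball x₀ ρ, (f x₀).numPts ≤ (f y).numPts) ∧
      ∃ g : Fin Q → Rn n → Rn m,
        (∀ y ∈ E ∩ Metric.ball x₀ ρ, f y = AQ.sum fun i => g i y) ∧
        (∀ i, ∀ y ∈ E ∩ Metric.ball x₀ ρ, (f y).numPts = (f x₀).numPts →
          ∀ z ∈ E ∩ Metric.ball x₀ ρ, (f z).numPts = (f x₀).numPts →
          ‖g i y - g i z‖ ≤ K * dist y z) ∧
        (∀ i k, ∀ y ∈ E ∩ Metric.ball x₀ ρ, (f y).numPts = (f x₀).numPts → g i y = g k y →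
          ∀ z ∈ E ∩ Metric.ball x₀ ρ, (f z).numPts = (f x₀).numPts → g i z = g k z) := by
  obtain ⟨P, hP⟩ := AQ.exists_sum_eq (f x₀)
  obtain ⟨δ, hδ, hsep⟩ := exists_separation P
  choose R hR using fun y => AQ.exists_sum_eq (f y)
  choose σ hσ using fun y => AQ.exists_G_sum_eq P (R y)
  set g : Fin Q → Rn n → Rn m := fun i y => R y (σ y i)
  have hgsum : ∀ y, (AQ.sum fun i => g i y) = f y := fun y =>
    (AQ.sum_comp_perm (R y) (σ y)).trans (hR y)
  -- The first bound lets `hf` apply to any two points of the ball; the second keeps every selected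
  -- value within δ/8 of the corresponding Pᵢ.
  set ρ := min (δ₀ / 2) (δ / (8 * (K + 1)))
  have hρ : 0 < ρ := by positivity
  have hKρ : (K + 1) * ρ ≤ δ / 8 := by
    calc (K + 1) * ρ ≤ (K + 1) * (δ / (8 * (K + 1))) := by gcongr; exact min_le_right _ _
      _ = δ / 8 := by field_simp
  have hρ₀ : ρ ≤ δ₀ / 2 := min_le_left _ _
  have hg : ∀ y ∈ E ∩ Metric.ball x₀ ρ, ∀ i, ‖P i - g i y‖ ≤ δ / 8 := by
    intro y hy i
    have hd : dist x₀ y < ρ := by rw [dist_comm]; exact hy.2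
    have h1 := hf x₀ hx₀ y hy.1 (by linarith)
    rw [← hP, ← hR y, hσ y] at h1
    have h2 := norm_sub_le_tupleDist P (R y ∘ σ y) i
    have h3 := dist_nonneg (x := x₀) (y := y)
    exact h2.trans (h1.trans (by nlinarith))
  have hfac : ∀ y ∈ E ∩ Metric.ball x₀ ρ, ∀ z ∈ E ∩ Metric.ball x₀ ρ, ∀ i k, P i ≠ P k →
      3 / 4 * δ ≤ ‖g i y - g k z‖ := by
    intro y hy z hz i k hik
    have h1 := hsep i k hik
    have h2 : ‖P i - P k‖ ≤ ‖P i - g i y‖ + ‖g i y - g k z‖ + ‖P k - g k z‖ := by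
      rw [norm_sub_rev (P k) (g k z)]
      refine le_trans (le_of_eq ?_) norm_add₃_le
      congr 1; abel
    linarith [hg y hy i, hg z hz k]
  have hfac' : ∀ y ∈ E ∩ Metric.ball x₀ ρ, ∀ i k, g i y = g k y → P i = P k := by
    intro y hy i k hik
    by_contra h
    have := hfac y hy y hy i k h
    rw [hik, sub_self, norm_zero] at this
    linarith
  have hnum : ∀ y, (f y).numPts = (Set.range fun i => g i y).ncard := fun y => by
    rw [← hgsum y, AQ.numPts_sum]
  have hnum₀ : (f x₀).numPts = (Set.range P).ncard := by rw [← hP, AQ.numPts_sum]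
  -- With the number of distinct values unchanged, the values clustered at one point of P cannot
  -- split.
  have hiff : ∀ y ∈ E ∩ Metric.ball x₀ ρ, (f y).numPts = (f x₀).numPts →
      ∀ i k, P i = P k → g i y = g k y := fun y hy he => by
    rw [hnum₀, hnum y] at he
    exact (ncard_range_le_of_factors (hfac' y hy)).2 he
  refine ⟨ρ, hρ, fun y hy => ?_, g, fun y _ => (hgsum y).symm, ?_, ?_⟩
  · rw [hnum₀, hnum y]
    exact (ncard_range_le_of_factors (hfac' y hy)).1
  · intro i y hy hye z hz hze
    have hd : dist y z < 2 * ρ := by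
      have h1 := Metric.mem_ball.1 hy.2
      have h2 := Metric.mem_ball.1 hz.2
      linarith [dist_triangle_right y z x₀]
    have h1 := hf y hy.1 z hz.1 (by linarith)
    rw [← hgsum y, ← hgsum z] at h1
    obtain ⟨τ, hτ⟩ := AQ.exists_G_sum_eq (fun i => g i y) fun i => g i z
    rw [hτ] at h1
    have h2 : ‖g i y - g (τ i) z‖ ≤ K * dist y z :=
      (norm_sub_le_tupleDist (fun i => g i y) ((fun i => g i z) ∘ τ) i).trans h1
    -- The optimal matching moves points by at most K·2ρ ≤ δ/4, whereas different clusters are at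
    -- least 3δ/4 apart.
    have h3 : P (τ i) = P i := by
      by_contra h
      have h4 := hfac y hy z hz i (τ i) (Ne.symm h)
      nlinarith [dist_nonneg (x := y) (y := z)]
    rwa [hiff z hz hze _ _ h3] at h2
  · intro i k y hy _ hik z hz hze
    exact hiff z hz hze i k (hfac' y hy i k hik)

end UnorderedTuples

/-! ### Sets of density one and linear maps controlled along them. -/

section Density

/-- The set `A` has density one at `x`. -/
def HasDensityOne (A : Set (Rn n)) (x : Rn n) : Prop :=
  ∀ ε > 0, ∃ ρ₀ > 0, ∀ ρ, 0 < ρ → ρ < ρ₀ → volume.real (Metric.ball x ρ \ A) ≤ ε * ρ ^ n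

lemma HasDensityOne.inter {A B : Set (Rn n)} {x : Rn n} (hA : HasDensityOne A x)
    (hB : HasDensityOne B x) : HasDensityOne (A ∩ B) x := by
  intro ε hε
  obtain ⟨ρ₁, h1, hA⟩ := hA (ε / 2) (by positivity)
  obtain ⟨ρ₂, h2, hB⟩ := hB (ε / 2) (by positivity)
  refine ⟨min ρ₁ ρ₂, lt_min h1 h2, fun ρ h0 h => ?_⟩
  rw [Set.sdiff_inter]
  refine (measureReal_union_le _ _).trans ?_
  linarith [hA ρ h0 (h.trans_le (min_le_left _ _)), hB ρ h0 (h.trans_le (min_le_right _ _))]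

lemma volume_ball_ne_top (x : Rn n) (ρ : ℝ) : volume (Metric.ball x ρ) ≠ ⊤ :=
  Metric.isBounded_ball.measure_lt_top.ne

lemma HasDensityOne.of_tendsto {A : Set (Rn n)} (hAm : MeasurableSet A) {x : Rn n}
    (h : Tendsto (fun r : ℝ => volume (A ∩ Metric.ball x r) / volume (Metric.ball x r))
      (𝓝[>] 0) (𝓝 1)) : HasDensityOne A x := by
  intro ε hε
  have h1 := (ENNReal.tendsto_toReal ENNReal.one_ne_top).comp h
  have h2 : ∀ᶠ r in 𝓝[>] (0 : ℝ), 1 - ε / unitVol n <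
      (volume (A ∩ Metric.ball x r) / volume (Metric.ball x r)).toReal := by
    refine h1.eventually (lt_mem_nhds ?_)
    have : 0 < ε / unitVol n := div_pos hε unitVol_pos
    rw [ENNReal.toReal_one]
    linarith
  obtain ⟨ρ₀, hρ₀, h3⟩ := mem_nhdsGT_iff_exists_Ioo_subset.1 h2
  refine ⟨ρ₀, hρ₀, fun ρ h0 hρ => ?_⟩
  have h4 : 1 - ε / unitVol n <
      (volume (A ∩ Metric.ball x ρ) / volume (Metric.ball x ρ)).toReal := h3 ⟨h0, hρ⟩
  rw [ENNReal.toReal_div] at h4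
  change _ < volume.real (A ∩ Metric.ball x ρ) / volume.real (Metric.ball x ρ) at h4
  have h5 := measureReal_inter_add_sdiff (μ := volume) (s := Metric.ball x ρ) (t := A) hAm
    (volume_ball_ne_top x ρ)
  have hω := unitVol_pos (n := n)
  have hρn := pow_pos h0 n
  rw [volume_real_ball x h0] at h4 h5
  rw [lt_div_iff₀ (by positivity), Set.inter_comm] at h4
  have h6 : (1 - ε / unitVol n) * (ρ ^ n * unitVol n) = ρ ^ n * unitVol n - ε * ρ ^ n := by
    field_simp
  linarith

lemma HasDensityOne.tendsto {A : Set (Rn n)} (hAm : MeasurableSet A) {x : Rn n}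
    (h : HasDensityOne A x) :
    Tendsto (fun r : ℝ => volume (A ∩ Metric.ball x r) / volume (Metric.ball x r))
      (𝓝[>] 0) (𝓝 1) := by
  have hle : ∀ r : ℝ, volume (A ∩ Metric.ball x r) / volume (Metric.ball x r) ≤ 1 := fun r =>
    (ENNReal.div_le_div_right (measure_mono Set.inter_subset_right) _).trans ENNReal.div_self_le_one
  have hfin : ∀ r : ℝ, volume (A ∩ Metric.ball x r) / volume (Metric.ball x r) ≠ ⊤ := fun r =>
    ((hle r).trans_lt ENNReal.one_lt_top).ne
  rw [← ENNReal.tendsto_toReal_iff hfin ENNReal.one_ne_top, ENNReal.toReal_one, Metric.tendsto_nhds]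
  intro ε hε
  have hω := unitVol_pos (n := n)
  obtain ⟨ρ₀, hρ₀, h1⟩ := h (ε / 2 * unitVol n) (by positivity)
  filter_upwards [Ioo_mem_nhdsGT hρ₀] with ρ hρ
  have h0 := hρ.1
  have h2 := h1 ρ h0 hρ.2
  have h5 := measureReal_inter_add_sdiff (μ := volume) (s := Metric.ball x ρ) (t := A) hAm
    (volume_ball_ne_top x ρ)
  have hρn := pow_pos h0 n
  have h6 : (volume (A ∩ Metric.ball x ρ) / volume (Metric.ball x ρ)).toReal ≤ 1 := by
    simpa using ENNReal.toReal_mono ENNReal.one_ne_top (hle ρ)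
  rw [Real.dist_eq, abs_sub_comm, abs_of_nonneg (by linarith)]
  rw [ENNReal.toReal_div]
  change 1 - volume.real (A ∩ Metric.ball x ρ) / volume.real (Metric.ball x ρ) < ε
  rw [volume_real_ball x h0] at h5 ⊢
  rw [sub_lt_comm, lt_div_iff₀ (by positivity), Set.inter_comm]
  have : 0 < ε * (ρ ^ n * unitVol n) := by positivity
  nlinarith

/-- A Lebesgue point of the indicator of S that lies in S is a density point. -/
lemma ae_hasDensityOne {S : Set (Rn n)} (hS : MeasurableSet S) :
    ∀ᵐ x, x ∈ S → HasDensityOne S x := by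
  have hl : LocallyIntegrable (S.indicator fun _ : Rn n => (1 : ℝ)) :=
    (locallyIntegrable_const (1 : ℝ)).indicator hS
  filter_upwards [ae_isLebesguePoint hl] with x hx hxS ε hε
  obtain ⟨ρ₀, h0, h⟩ := hx ε hε
  refine ⟨ρ₀, h0, fun ρ h1 h2 => le_trans (le_of_eq ?_) (h ρ h1 h2)⟩
  have : ∀ y, ‖S.indicator (fun _ => (1 : ℝ)) y - S.indicator (fun _ => (1 : ℝ)) x‖ =
      Sᶜ.indicator (fun _ => (1 : ℝ)) y := by
    intro y
    by_cases hy : y ∈ S <;> simp [hy, hxS]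
  simp_rw [this]
  rw [setIntegral_indicator hS.compl]
  simp [Set.sdiff_eq]

/-- Comparison of a linear map with a function of small average along a set of density one. -/
theorem opNorm_le_of_average_le {F : Type*} [NormedAddCommGroup F] [NormedSpace ℝ F]
    {A : Set (Rn n)} (hAm : MeasurableSet A) {x : Rn n} (hA : HasDensityOne A x)
    (L : Rn n →L[ℝ] F) {h : Rn n → ℝ} {a : ℝ} {R : ℝ} (hR : 0 < R) (h0 : ∀ z, 0 ≤ h z)
    (hi : IntegrableOn h (Metric.ball x R))
    (hL : ∀ ε > 0, ∃ ρ₀ > 0, ∀ z ∈ A, dist z x < ρ₀ → ‖L (z - x)‖ ≤ h z + ε * ‖z - x‖)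
    (ha : ∀ ε > 0, ∃ ρ₀ > 0, ∀ ρ, 0 < ρ → ρ < ρ₀ →
      ∫ z in Metric.ball x ρ, h z ≤ (a + ε) * (ρ * ρ ^ n)) :
    ‖L‖ * ((1 / 8) ^ n * unitVol n) ≤ 8 * a := by
  have hω := unitVol_pos (n := n)
  set c := (1 / 8) ^ n * unitVol n with hc
  have hc0 : 0 < c := by positivity
  have ha0 : 0 ≤ a := by
    refine le_of_forall_pos_le_add fun ε hε => ?_
    obtain ⟨ρ₀, hρ₀, h1⟩ := ha ε hε
    have h2 := h1 (ρ₀ / 2) (by positivity) (by linarith)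
    have h3 : 0 ≤ ∫ z in Metric.ball x (ρ₀ / 2), h z := integral_nonneg fun z => h0 z
    exact nonneg_of_mul_nonneg_left (h3.trans h2) (by positivity)
  by_contra! hcon
  have hl : 0 < ‖L‖ := by
    by_contra h
    have : ‖L‖ = 0 := le_antisymm (not_lt.1 h) (norm_nonneg _)
    rw [this] at hcon; linarith
  set l := ‖L‖
  -- The last condition forces (l/8 - ε)(c - ε) > a + ε, contradicting the final averaged estimate.
  obtain ⟨ε, hε, hεl, hεc, hεs⟩ : ∃ ε : ℝ, 0 < ε ∧ ε < l / 8 ∧ ε < c ∧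
      ε * (1 + l / 8 + c) < l * c / 8 - a := by
    have hp : 0 < l * c / 8 - a := by linarith
    refine ⟨min (min (l / 16) (c / 2)) ((l * c / 8 - a) / (2 * (1 + l / 8 + c))),
      by positivity, ?_, ?_, ?_⟩
    · exact ((min_le_left _ _).trans (min_le_left _ _)).trans_lt (by linarith)
    · exact ((min_le_left _ _).trans (min_le_right _ _)).trans_lt (by linarith)
    · calc _ ≤ (l * c / 8 - a) / (2 * (1 + l / 8 + c)) * (1 + l / 8 + c) := by
            gcongr; exact min_le_right _ _
        _ = (l * c / 8 - a) / 2 := by field_simp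
        _ < _ := by linarith
  obtain ⟨v, hv1, hv2⟩ := L.exists_lt_apply_of_lt_opNorm (r := l / 2) (by linarith)
  obtain ⟨ρ₁, hρ₁, h1⟩ := hA ε hε
  obtain ⟨ρ₂, hρ₂, h2⟩ := hL ε hε
  obtain ⟨ρ₃, hρ₃, h3⟩ := ha ε hε
  obtain ⟨ρ, hρ, hlt⟩ := exists_between (show 0 < min (min ρ₁ ρ₂) (min ρ₃ R) by positivity)
  simp only [lt_min_iff] at hlt
  obtain ⟨⟨hlt1, hlt2⟩, hlt3, hltR⟩ := hlt
  -- As v is nearly norming, |L(z - x)| ≥ (ρ/2)(l/2) - l ρ/8 = l ρ/8 on the ball of radius ρ/8 about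
  -- y. Almost all of this ball lies in A.
  set y := x + (ρ / 2) • v
  set D := Metric.ball y (1 / 8 * ρ)
  have hDB : D ⊆ Metric.ball x ρ := by
    refine Metric.ball_subset_ball' ?_
    have : dist y x ≤ ρ / 2 := by
      rw [dist_eq_norm, add_sub_cancel_left, norm_smul, Real.norm_of_nonneg (by positivity)]
      nlinarith [norm_nonneg v]
    linarith
  have hDm : MeasurableSet (D ∩ A) := Metric.isOpen_ball.measurableSet.inter hAm
  have hvol : (c - ε) * ρ ^ n ≤ volume.real (D ∩ A) := by
    have h5 := measureReal_inter_add_sdiff (μ := volume) (s := D) (t := A) hAm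
      (volume_ball_ne_top y _)
    rw [volume_real_ball y (by positivity), mul_pow] at h5
    have h6 : volume.real (D \ A) ≤ ε * ρ ^ n :=
      (measureReal_mono (Set.sdiff_subset_sdiff_left hDB)
        (measure_ne_top_of_subset Set.sdiff_subset (volume_ball_ne_top x ρ))).trans (h1 ρ hρ hlt1)
    rw [hc]
    linarith
  have hiρ : IntegrableOn h (Metric.ball x ρ) :=
    hi.mono_set (Metric.ball_subset_ball hltR.le)
  have hlow : ∀ z ∈ D ∩ A, (l / 8 - ε) * ρ ≤ h z := by
    intro z hz
    have hzB : dist z x < ρ := hDB hz.1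
    have h5 := h2 z hz.2 (hzB.trans hlt2)
    have h6 : ‖z - x‖ ≤ ρ := by rw [← dist_eq_norm]; exact hzB.le
    have h7 : L (z - x) = (ρ / 2) • L v + L (z - y) := by
      rw [← map_smul, ← map_add]; congr 1; simp only [y]; abel
    have h8 : ‖L (z - y)‖ ≤ l * (1 / 8 * ρ) := by
      refine (L.le_opNorm _).trans (mul_le_mul_of_nonneg_left ?_ hl.le)
      rw [← dist_eq_norm]; exact (Metric.mem_ball.1 hz.1).le
    have h9 : ‖(ρ / 2) • L v‖ = ρ / 2 * ‖L v‖ := by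
      rw [norm_smul, Real.norm_of_nonneg (by positivity)]
    have h10 : ‖(ρ / 2) • L v‖ ≤ ‖L (z - x)‖ + ‖L (z - y)‖ := by
      rw [h7]
      simpa using norm_sub_le ((ρ / 2) • L v + L (z - y)) (L (z - y))
    rw [h9] at h10
    nlinarith
  have hint : (l / 8 - ε) * ρ * volume.real (D ∩ A) ≤ ∫ z in Metric.ball x ρ, h z := by
    calc (l / 8 - ε) * ρ * volume.real (D ∩ A) = ∫ z in D ∩ A, (l / 8 - ε) * ρ := by
          simp [mul_comm]
      _ ≤ ∫ z in D ∩ A, h z := by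
          refine setIntegral_mono_on (integrableOn_const ?_)
            (hiρ.mono_set (Set.inter_subset_left.trans hDB)) hDm hlow
          exact measure_ne_top_of_subset Set.inter_subset_left (volume_ball_ne_top y _)
      _ ≤ ∫ z in Metric.ball x ρ, h z :=
          setIntegral_mono_set hiρ (Eventually.of_forall h0)
            (Set.inter_subset_left.trans hDB).eventuallyLE
  have h11 := h3 ρ hρ hlt3
  have hρn := pow_pos hρ n
  have h12 : (l / 8 - ε) * (c - ε) * (ρ * ρ ^ n) ≤ (a + ε) * (ρ * ρ ^ n) := by
    have : (l / 8 - ε) * ρ * ((c - ε) * ρ ^ n) ≤ (l / 8 - ε) * ρ * volume.real (D ∩ A) :=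
      mul_le_mul_of_nonneg_left hvol (mul_nonneg (by linarith) hρ.le)
    nlinarith
  have h13 := le_of_mul_le_mul_right h12 (by positivity)
  nlinarith

/-- The averaged comparison with h = 0 and a = 0; it gives uniqueness of approximate differentials.
-/
lemma eq_zero_of_isLittleO_of_hasDensityOne {F : Type*} [NormedAddCommGroup F] [NormedSpace ℝ F]
    {A : Set (Rn n)} (hAm : MeasurableSet A) {x : Rn n} (hA : HasDensityOne A x)
    (L : Rn n →L[ℝ] F)
    (hL : ∀ ε > 0, ∃ ρ₀ > 0, ∀ z ∈ A, dist z x < ρ₀ → ‖L (z - x)‖ ≤ ε * ‖z - x‖) : L = 0 := by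
  have h := opNorm_le_of_average_le hAm hA L (h := fun _ => 0) (a := 0) one_pos (fun _ => le_rfl)
    integrableOn_zero (by simpa using hL) (fun ε hε => ⟨1, one_pos, fun ρ hρ _ => by
      simp only [integral_zero]; positivity⟩)
  have hω := unitVol_pos (n := n)
  rw [mul_zero] at h
  have h2 : ‖L‖ ≤ 0 := nonpos_of_mul_nonpos_left h (by positivity)
  exact norm_le_zero_iff.1 h2

end Density

/-! ### From the Sobolev condition to Lipschitz sheets. -/

section Sheets

/-- `Θ` is an `L²` function on `Ω` that dominates the gradients of all functions `G(f, T)`. -/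
structure DominatesGradients (Ω : Set (Rn n)) (f : Rn n → AQ Q m) (Θ : Rn n → ℝ) : Prop where
  memLp : MemLp Θ 2 (volume.restrict Ω)
  nonneg : ∀ x, 0 ≤ Θ x
  sobolev : ∀ T : AQ Q m, MemLp (fun x => AQ.G (f x) T) 2 (volume.restrict Ω) ∧
    ∃ g : Rn n → Rn n, MemLp g 2 (volume.restrict Ω) ∧
      HasWeakGradient Ω (fun x => AQ.G (f x) T) g ∧
      ∀ᵐ x ∂(volume.restrict Ω), ‖g x‖ ≤ Θ x

lemma norm_le_sum_abs (v : Rn n) : ‖v‖ ≤ ∑ j, |v j| := by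
  have h := (EuclideanSpace.basisFun (Fin n) ℝ).sum_repr v
  conv_lhs => rw [← h]
  refine (norm_sum_le _ _).trans (Finset.sum_le_sum fun j _ => ?_)
  rw [norm_smul, (EuclideanSpace.basisFun (Fin n) ℝ).norm_eq_one, mul_one]
  simp

lemma MemW12.exists_dominatesGradients {Ω : Set (Rn n)} {f : Rn n → AQ Q m} (hf : MemW12 Ω f) :
    ∃ Θ, DominatesGradients Ω f Θ := by
  obtain ⟨ϑ, h1, h2⟩ := hf
  refine ⟨fun x => ∑ j, ϑ j x, memLp_finsetSum _ fun j _ => (h1 j).1,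
    fun x => Finset.sum_nonneg fun j _ => (h1 j).2 x, fun T => ⟨(h2 T).1, ?_⟩⟩
  obtain ⟨g, hg, hw, hb⟩ := (h2 T).2
  refine ⟨g, hg, hw, ?_⟩
  filter_upwards [ae_all_iff.2 hb] with x hx
  exact (norm_le_sum_abs _).trans (Finset.sum_le_sum fun j _ => hx j)

variable {Ω : Set (Rn n)} {f : Rn n → AQ Q m} {Θ : Rn n → ℝ}

lemma integrableOn_ball_of_memLp {F : Type*} [NormedAddCommGroup F] {w : Rn n → F}
    (hw : MemLp w 2 (volume.restrict Ω)) {x : Rn n} {r : ℝ} (h : Metric.ball x r ⊆ Ω) :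
    IntegrableOn w (Metric.ball x r) := by
  have : IsFiniteMeasure (volume.restrict (Metric.ball x r)) :=
    ⟨by simpa using (volume_ball_ne_top x r).lt_top⟩
  exact (hw.mono_measure (Measure.restrict_mono h le_rfl)).integrable (by norm_num)

/-- Almost everywhere, the mean oscillation of a Sobolev `Q`-valued function is controlled by the
averages of its gradient. -/
theorem DominatesGradients.ae_integral_ball_G_le (hΩ : IsOpen Ω) (h : DominatesGradients Ω f Θ) :
    ∀ᵐ x, ∀ r C : ℝ, 0 < r → Metric.closedBall x r ⊆ Ω → 0 ≤ C →
      (∀ s, 0 < s → s ≤ r → ∫ y in Metric.ball x s, Θ y ≤ C * s ^ n) →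
      ∫ z in Metric.ball x r, AQ.G (f z) (f x) ≤ r * (C * r ^ n) := by
  obtain ⟨D, hD, hdense⟩ := AQ.exists_countable_dense Q m
  have h1 : ∀ᵐ x, ∀ T ∈ D, IsLebesguePoint (Ω.indicator fun x => AQ.G (f x) T) x := by
    rw [ae_ball_iff hD]
    exact fun T _ => ae_isLebesguePoint (MemLp.locallyIntegrable_two
      (memLp_indicator hΩ (h.sobolev T).1))
  filter_upwards [h1] with x hx r C hr hrΩ hC hCs
  have hbΩ : Metric.ball x r ⊆ Ω := Metric.ball_subset_closedBall.trans hrΩ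
  have hω := unitVol_pos (n := n)
  refine le_of_forall_pos_le_add fun ε hε => ?_
  -- The target f(x) varies with x, so it is replaced by a nearby T from the countable set; the
  -- replacement costs at most 2 G(f(x), T) times the volume of the ball.
  obtain ⟨T, hT, hTε⟩ := hdense (f x) (ε / (2 * (r ^ n * unitVol n))) (by positivity)
  obtain ⟨hG, g, hg, hw, hgΘ⟩ := h.sobolev T
  have h2 := integral_ball_sub_affine_le hΩ hG hg hw (hx T hT) 0 hr hrΩ hC (fun s hs hsr => by
    have hsΩ : Metric.ball x s ⊆ Ω := (Metric.ball_subset_ball hsr).trans hbΩ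
    refine le_trans (setIntegral_mono_ae_restrict ?_ (integrableOn_ball_of_memLp h.memLp hsΩ) ?_)
      (hCs s hs hsr)
    · simp only [sub_zero]
      exact (integrableOn_ball_of_memLp hg hsΩ).norm
    · filter_upwards [ae_restrict_of_ae_restrict_of_subset hsΩ hgΘ] with y hy
      simpa using hy)
  simp only [inner_zero_left, sub_zero] at h2
  have i1 := integrableOn_ball_of_memLp (h.sobolev (f x)).1 hbΩ
  have i2 : IntegrableOn (fun z => |AQ.G (f z) T - AQ.G (f x) T|) (Metric.ball x r) :=
    ((integrableOn_ball_of_memLp hG hbΩ).sub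
      (integrableOn_const (volume_ball_ne_top x r))).abs
  have i3 : IntegrableOn (fun _ : Rn n => 2 * AQ.G (f x) T) (Metric.ball x r) :=
    integrableOn_const (volume_ball_ne_top x r)
  have h3 : ∫ z in Metric.ball x r, AQ.G (f z) (f x) ≤
      ∫ z in Metric.ball x r, (|AQ.G (f z) T - AQ.G (f x) T| + 2 * AQ.G (f x) T) := by
    refine setIntegral_mono i1 (i2.add i3) fun z => ?_
    have := AQ.G_triangle (f z) T (f x)
    have := le_abs_self (AQ.G (f z) T - AQ.G (f x) T)
    change AQ.G (f z) (f x) ≤ |AQ.G (f z) T - AQ.G (f x) T| + 2 * AQ.G (f x) T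
    linarith [AQ.G_comm T (f x)]
  rw [integral_add i2 i3] at h3
  have h4 : ∫ z in Metric.ball x r, 2 * AQ.G (f x) T ≤ ε := by
    rw [setIntegral_const, volume_real_ball x hr, smul_eq_mul]
    have := (lt_div_iff₀ (by positivity)).1 hTε
    linarith
  linarith

/-- Dominated convergence: as the centre moves, the indicators converge off the sphere, which is
null. -/
lemma continuous_setIntegral_ball {w : Rn n → ℝ} (hw : Integrable w) {s : ℝ} (hs : 0 < s) :
    Continuous fun x => ∫ y in Metric.ball x s, w y := by
  rw [continuous_iff_continuousAt]
  intro x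
  simp_rw [← integral_indicator Metric.isOpen_ball.measurableSet]
  refine tendsto_integral_filter_of_dominated_convergence (fun y => ‖w y‖) ?_ ?_ hw.norm ?_
  · exact Eventually.of_forall fun x =>
      hw.aestronglyMeasurable.indicator Metric.isOpen_ball.measurableSet
  · exact Eventually.of_forall fun x => Eventually.of_forall fun y => norm_indicator_le_norm_self _ _
  · have h0 : volume (Metric.sphere x s) = 0 := Measure.addHaar_sphere_of_ne_zero _ x hs.ne'
    filter_upwards [compl_mem_ae_iff.2 h0] with y hy
    have hc : Tendsto (fun x' => dist y x') (𝓝 x) (𝓝 (dist y x)) :=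
      (continuous_const.dist continuous_id).tendsto x
    refine tendsto_const_nhds.congr' ?_
    rcases lt_or_gt_of_ne (show dist y x ≠ s from hy) with hlt | hgt
    · filter_upwards [hc.eventually (gt_mem_nhds hlt)] with x' hx'
      rw [Set.indicator_of_mem (Metric.mem_ball.2 hlt), Set.indicator_of_mem (Metric.mem_ball.2 hx')]
    · filter_upwards [hc.eventually (lt_mem_nhds hgt)] with x' hx'
      rw [Set.indicator_of_notMem (fun h => (Metric.mem_ball.1 h).not_gt hgt),
        Set.indicator_of_notMem (fun h => (Metric.mem_ball.1 h).not_gt hx')]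

/-- The set where the averages of `w` at scales at most `2 / (k + 1)` are bounded by `k`, at some
distance from the complement of `Ω`. -/
def maximalSublevel (Ω : Set (Rn n)) (w : Rn n → ℝ) (k : ℕ) : Set (Rn n) :=
  {x | ENNReal.ofReal (2 * (1 / ((k : ℝ) + 1))) < Metric.infEDist x Ωᶜ} ∩
    ⋂ s ∈ Set.Ioc (0 : ℝ) (2 * (1 / ((k : ℝ) + 1))), {x | ∫ y in Metric.ball x s, w y ≤ k * s ^ n}

/-- Continuity in the centre makes the condition closed for each radius, so the uncountable
intersection over radii is still closed. -/
lemma measurableSet_maximalSublevel {w : Rn n → ℝ} (hw : Integrable w) (k : ℕ) :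
    MeasurableSet (maximalSublevel Ω w k) := by
  refine (isOpen_lt continuous_const Metric.continuous_infEDist).measurableSet.inter
    (IsClosed.measurableSet ?_)
  exact isClosed_biInter fun s hs =>
    isClosed_le (continuous_setIntegral_ball hw hs.1) continuous_const

lemma closedBall_subset_of_lt_infEDist {x : Rn n} {r : ℝ}
    (h : ENNReal.ofReal r < Metric.infEDist x Ωᶜ) : Metric.closedBall x r ⊆ Ω := by
  intro y hy
  by_contra hyΩ
  have h1 := Metric.infEDist_le_edist_of_mem (x := x) (show y ∈ Ωᶜ from hyΩ)
  have h2 : edist x y ≤ ENNReal.ofReal r := by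
    rw [edist_dist, dist_comm]
    exact ENNReal.ofReal_le_ofReal hy
  exact (h.trans_le (h1.trans h2)).false

/-- At a Lebesgue point the small-scale averages stay bounded. Increasing k both shrinks the range
of scales and raises the bound. -/
lemma ae_exists_mem_maximalSublevel (hΩ : IsOpen Ω) {w : Rn n → ℝ} (hw : Integrable w) :
    ∀ᵐ x, x ∈ Ω → ∃ k, x ∈ maximalSublevel Ω w k := by
  filter_upwards [ae_isLebesguePoint hw.locallyIntegrable] with x hx hxΩ
  obtain ⟨ρ₀, hρ₀, h1⟩ := hx 1 one_pos
  have hω := unitVol_pos (n := n)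
  have hpos : 0 < Metric.infEDist x Ωᶜ := by
    rw [Metric.infEDist_pos_iff_notMem_closure, hΩ.isClosed_compl.closure_eq]
    exact fun h => h hxΩ
  have ht : Tendsto (fun k : ℕ => 2 * (1 / ((k : ℝ) + 1))) atTop (𝓝 0) := by
    simpa using (tendsto_one_div_add_atTop_nhds_zero_nat (𝕜 := ℝ)).const_mul 2
  have ht2 := ENNReal.tendsto_ofReal ht
  rw [ENNReal.ofReal_zero] at ht2
  obtain ⟨k, hk1, hk2, hk3⟩ := ((ht.eventually (gt_mem_nhds hρ₀)).and
    ((ht2.eventually (gt_mem_nhds hpos)).and (tendsto_natCast_atTop_atTop.eventually_ge_atTop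
      (1 + w x * unitVol n)))).exists
  refine ⟨k, hk2, ?_⟩
  simp only [Set.mem_iInter, Set.mem_ofPred_eq]
  intro s hs
  have h2 := h1 s hs.1 (hs.2.trans_lt hk1)
  have hsn := pow_pos hs.1 n
  have i2 : IntegrableOn (fun _ : Rn n => w x) (Metric.ball x s) :=
    integrableOn_const (volume_ball_ne_top x s)
  have i1 : IntegrableOn (fun y => ‖w y - w x‖) (Metric.ball x s) :=
    (hw.integrableOn.sub i2).norm
  have h3 : ∫ y in Metric.ball x s, w y ≤ ∫ y in Metric.ball x s, (‖w y - w x‖ + w x) := by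
    refine setIntegral_mono hw.integrableOn (i1.add i2) fun y => ?_
    have := le_abs_self (w y - w x)
    change w y ≤ |w y - w x| + w x
    linarith
  rw [integral_add i1 i2, setIntegral_const, volume_real_ball x hs.1, smul_eq_mul] at h3
  nlinarith

/-- A Sobolev `Q`-valued function is Lipschitz at small scales on sets exhausting the domain. -/
theorem DominatesGradients.exists_lipschitz_pieces (hΩ : IsOpen Ω) (hΩf : volume Ω ≠ ⊤)
    (h : DominatesGradients Ω f Θ) :
    ∃ E : ℕ → Set (Rn n), (∀ k, MeasurableSet (E k)) ∧ (∀ k, E k ⊆ Ω) ∧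
      (∀ k, ∃ K δ : ℝ, 0 ≤ K ∧ 0 < δ ∧
        ∀ x ∈ E k, ∀ y ∈ E k, dist x y < δ → AQ.G (f x) (f y) ≤ K * dist x y) ∧
      ∀ᵐ x, x ∈ Ω → ∃ k, x ∈ E k := by
  have hgood := h.ae_integral_ball_G_le hΩ
  -- The exceptional set is enlarged to a measurable null set so that the pieces are measurable.
  obtain ⟨N, hN, hNm, hN0⟩ := exists_measurable_superset_of_null (ae_iff.1 hgood)
  have : IsFiniteMeasure (volume.restrict Ω) := ⟨by simpa using hΩf.lt_top⟩
  have hΘi : Integrable (Ω.indicator Θ) :=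
    (integrable_indicator_iff hΩ.measurableSet).2 (h.memLp.integrable (by norm_num))
  have hsubΩ : ∀ k, ∀ x ∈ maximalSublevel Ω (Ω.indicator Θ) k,
      Metric.closedBall x (2 * (1 / ((k : ℝ) + 1))) ⊆ Ω := fun k x hx =>
    closedBall_subset_of_lt_infEDist hx.1
  have hω := unitVol_pos (n := n)
  refine ⟨fun k => maximalSublevel Ω (Ω.indicator Θ) k \ N,
    fun k => (measurableSet_maximalSublevel hΘi k).diff hNm, fun k x hx =>
      hsubΩ k x hx.1 (Metric.mem_closedBall_self (by positivity)), fun k => ?_, ?_⟩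
  · set δ : ℝ := 1 / ((k : ℝ) + 1)
    have hδ : 0 < δ := by positivity
    refine ⟨k * (1 + 2 * 2 ^ n) / unitVol n, δ, by positivity, hδ, fun x hx y hy hxy => ?_⟩
    rcases eq_or_ne x y with rfl | hne
    · simp [AQ.G_self]
    have hd : 0 < dist x y := dist_pos.2 hne
    set d := dist x y
    have key : ∀ x ∈ maximalSublevel Ω (Ω.indicator Θ) k \ N, ∀ r, 0 < r → r ≤ 2 * δ →
        IntegrableOn (fun z => AQ.G (f z) (f x)) (Metric.ball x r) ∧
        ∫ z in Metric.ball x r, AQ.G (f z) (f x) ≤ r * (k * r ^ n) := by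
      intro x hx r hr hrδ
      have hrΩ : Metric.closedBall x r ⊆ Ω :=
        (Metric.closedBall_subset_closedBall hrδ).trans (hsubΩ k x hx.1)
      refine ⟨integrableOn_ball_of_memLp (h.sobolev (f x)).1
        (Metric.ball_subset_closedBall.trans hrΩ), ?_⟩
      have hx' := not_not.1 fun hh => hx.2 (hN hh)
      refine hx' r k hr hrΩ (Nat.cast_nonneg k) fun s hs hsr => ?_
      have h1 := hx.1.2
      simp only [Set.mem_iInter] at h1
      refine le_trans (le_of_eq ?_) (h1 s ⟨hs, hsr.trans hrδ⟩)
      refine setIntegral_congr_fun Metric.isOpen_ball.measurableSet fun z hz => ?_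
      have : z ∈ Ω := hrΩ (Metric.ball_subset_closedBall (Metric.ball_subset_ball hsr hz))
      simp [this]
    obtain ⟨i1, h1⟩ := key y hy d hd (by linarith)
    obtain ⟨i2, h2⟩ := key x hx (2 * d) (by linarith) (by linarith)
    -- The triangle inequality through f(z) is averaged over z in this ball. The terms based at y
    -- and x contribute k and 2·2^n k respectively, up to the common factor d·d^n.
    have hsub : Metric.ball y d ⊆ Metric.ball x (2 * d) :=
      Metric.ball_subset_ball' (by rw [dist_comm y x]; change d + d ≤ _; linarith)
    have i2' := i2.mono_set hsub
    have h3 : ∫ z in Metric.ball y d, AQ.G (f x) (f y) ≤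
        ∫ z in Metric.ball y d, (AQ.G (f z) (f y) + AQ.G (f z) (f x)) := by
      refine setIntegral_mono (integrableOn_const (volume_ball_ne_top y d)) (i1.add i2') fun z => ?_
      have := AQ.G_triangle (f x) (f z) (f y)
      change AQ.G (f x) (f y) ≤ AQ.G (f z) (f y) + AQ.G (f z) (f x)
      linarith [AQ.G_comm (f x) (f z)]
    have h4 : ∫ z in Metric.ball y d, AQ.G (f z) (f x) ≤
        ∫ z in Metric.ball x (2 * d), AQ.G (f z) (f x) :=
      setIntegral_mono_set i2 (Eventually.of_forall fun z => AQ.G_nonneg _ _) hsub.eventuallyLE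
    rw [integral_add i1 i2', setIntegral_const, volume_real_ball y hd, smul_eq_mul] at h3
    have hdn := pow_pos hd n
    rw [mul_pow] at h2
    have h5 : AQ.G (f x) (f y) * unitVol n * d ^ n ≤ k * (1 + 2 * 2 ^ n) * d * d ^ n := by
      linarith
    have h6 := le_of_mul_le_mul_right h5 hdn
    rw [div_mul_eq_mul_div, le_div_iff₀ hω]
    exact h6
  · filter_upwards [ae_exists_mem_maximalSublevel hΩ hΘi, compl_mem_ae_iff.2 hN0]
      with x hx hxN hxΩ
    obtain ⟨k, hk⟩ := hx hxΩ
    exact ⟨k, hk, hxN⟩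

/-- On the measurable set `S`, the function `f` is given by globally defined Lipschitz functions,
any two of which are identical or disjoint on `S`. -/
structure IsSheet (f : Rn n → AQ Q m) (S : Set (Rn n)) (g : Fin Q → Rn n → Rn m) : Prop where
  measurableSet : MeasurableSet S
  lipschitz : ∀ i, ∃ K, LipschitzWith K (g i)
  eq_sum : ∀ y ∈ S, f y = AQ.sum fun i => g i y
  eqOn : ∀ i k, ∀ y ∈ S, g i y = g k y → ∀ z ∈ S, g i z = g k z

/-- The number of distinct values is lower semicontinuous along E, so its level sets are measurable.
On each one the local selections are Lipschitz; countably many balls suffice by Lindelöf, and the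
selections extend to the whole space. -/
theorem exists_sheets_of_lipschitz {E : Set (Rn n)} (hE : MeasurableSet E) {K δ₀ : ℝ} (hK : 0 ≤ K)
    (hδ₀ : 0 < δ₀)
    (hf : ∀ x ∈ E, ∀ y ∈ E, dist x y < δ₀ → AQ.G (f x) (f y) ≤ K * dist x y) :
    ∃ 𝒮 : Set (Set (Rn n)), 𝒮.Countable ∧ (∀ S ∈ 𝒮, S ⊆ E ∧ ∃ g, IsSheet f S g) ∧ E ⊆ ⋃₀ 𝒮 := by
  have hloc := fun x (hx : x ∈ E) => exists_local_selection hK hδ₀ hf hx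
  choose! ρ hρ hnum g hsum hlip hdich using hloc
  have hge : ∀ d, MeasurableSet {y ∈ E | d ≤ (f y).numPts} := by
    intro d
    have : {y ∈ E | d ≤ (f y).numPts} =
        E ∩ ⋃ x ∈ {y ∈ E | d ≤ (f y).numPts}, Metric.ball x (ρ x) := by
      ext y
      simp only [Set.mem_ofPred_eq, Set.mem_inter_iff, Set.mem_iUnion]
      constructor
      · rintro ⟨hy, hd⟩
        exact ⟨hy, y, ⟨hy, hd⟩, Metric.mem_ball_self (hρ y hy)⟩
      · rintro ⟨hy, x, ⟨hx, hd⟩, hyx⟩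
        exact ⟨hy, hd.trans (hnum x hx y ⟨hy, hyx⟩)⟩
    rw [this]
    exact hE.inter (isOpen_biUnion fun _ _ => Metric.isOpen_ball).measurableSet
  have heq : ∀ d, MeasurableSet {y ∈ E | (f y).numPts = d} := by
    intro d
    have : {y ∈ E | (f y).numPts = d} =
        {y ∈ E | d ≤ (f y).numPts} \ {y ∈ E | d + 1 ≤ (f y).numPts} := by
      ext y
      simp only [Set.mem_ofPred_eq, Set.mem_sdiff]
      constructor
      · rintro ⟨hy, rfl⟩
        exact ⟨⟨hy, le_rfl⟩, fun h => by omega⟩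
      · rintro ⟨⟨hy, h1⟩, h2⟩
        exact ⟨hy, by by_contra h3; exact h2 ⟨hy, by omega⟩⟩
    rw [this]
    exact (hge d).diff (hge (d + 1))
  have hcov : ∀ d : ℕ, ∃ t ⊆ {y ∈ E | (f y).numPts = d}, t.Countable ∧
      {y ∈ E | (f y).numPts = d} ⊆ ⋃ x ∈ t, Metric.ball x (ρ x) := fun d =>
    TopologicalSpace.countable_cover_nhdsWithin fun x hx =>
      mem_nhdsWithin_of_mem_nhds (Metric.ball_mem_nhds x (hρ x hx.1))
  choose t htE htc ht using hcov
  set S : Rn n → Set (Rn n) := fun x =>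
    {y ∈ E | (f y).numPts = (f x).numPts} ∩ Metric.ball x (ρ x)
  refine ⟨⋃ d, S '' t d, Set.countable_iUnion fun d => (htc d).image S, ?_, ?_⟩
  · simp only [Set.mem_iUnion]
    rintro _ ⟨d, x, hx, rfl⟩
    have hxE : x ∈ E := (htE d hx).1
    have hmem : ∀ y ∈ S x, y ∈ E ∩ Metric.ball x (ρ x) := fun y hy => ⟨hy.1.1, hy.2⟩
    refine ⟨fun y hy => hy.1.1, ?_⟩
    have hext : ∀ i, ∃ g' : Rn n → Rn m, (∃ L, LipschitzWith L g') ∧ Set.EqOn (g x i) g' (S x) := by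
      intro i
      have : LipschitzOnWith (Real.toNNReal K) (g x i) (S x) := by
        refine LipschitzOnWith.of_dist_le_mul fun y hy z hz => ?_
        rw [Real.coe_toNNReal K hK, dist_eq_norm]
        exact hlip x hxE i y (hmem y hy) hy.1.2 z (hmem z hz) hz.1.2
      obtain ⟨g', h1, h2⟩ := this.extend_finite_dimension
      exact ⟨g', ⟨_, h1⟩, h2⟩
    choose g' hg' heqg using hext
    refine ⟨g', (heq _).inter Metric.isOpen_ball.measurableSet, hg', fun y hy => ?_, ?_⟩
    · rw [hsum x hxE y (hmem y hy)]
      congr 1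
      exact funext fun i => heqg i hy
    · intro i k y hy hik z hz
      rw [← heqg i hz, ← heqg k hz]
      rw [← heqg i hy, ← heqg k hy] at hik
      exact hdich x hxE i k y (hmem y hy) hy.1.2 hik z (hmem z hz) hz.1.2
  · intro y hy
    obtain ⟨x, hx, hyx⟩ := Set.mem_iUnion₂.1 (ht (f y).numPts ⟨hy, rfl⟩)
    refine ⟨S x, Set.mem_iUnion.2 ⟨_, x, hx, rfl⟩, ⟨hy, ?_⟩, hyx⟩
    exact (htE _ hx).2.symm

/-- A Sobolev `Q`-valued function is described by countably many sheets up to a null set. -/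
theorem DominatesGradients.exists_sheets (hΩ : IsOpen Ω) (hΩf : volume Ω ≠ ⊤)
    (h : DominatesGradients Ω f Θ) :
    ∃ 𝒮 : Set (Set (Rn n)), 𝒮.Countable ∧ (∀ S ∈ 𝒮, S ⊆ Ω ∧ ∃ g, IsSheet f S g) ∧
      ∀ᵐ x, x ∈ Ω → ∃ S ∈ 𝒮, x ∈ S := by
  obtain ⟨E, hEm, hEΩ, hlip, hcov⟩ := h.exists_lipschitz_pieces hΩ hΩf
  choose K δ hK hδ hKδ using hlip
  choose 𝒮 hc hS hE using fun k => exists_sheets_of_lipschitz (hEm k) (hK k) (hδ k) (hKδ k)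
  refine ⟨⋃ k, 𝒮 k, Set.countable_iUnion hc, ?_, ?_⟩
  · simp only [Set.mem_iUnion]
    rintro S ⟨k, hSk⟩
    exact ⟨(hS k S hSk).1.trans (hEΩ k), (hS k S hSk).2⟩
  · filter_upwards [hcov] with x hx hxΩ
    obtain ⟨k, hk⟩ := hx hxΩ
    obtain ⟨S, hSk, hxS⟩ := hE k hk
    exact ⟨S, Set.mem_iUnion.2 ⟨k, hSk⟩, hxS⟩

end Sheets

/-! ### Approximate jets, their bounds and the chain rule. -/

section Jets

variable {Ω : Set (Rn n)} {f : Rn n → AQ Q m} {Θ : Rn n → ℝ}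

lemma exists_forall_norm_le_of_isLittleO {F : Type*} [NormedAddCommGroup F]
    {h : Rn n → F} {A : Set (Rn n)} {x : Rn n} (hL : h =o[𝓝[A] x] fun z => z - x) :
    ∀ ε > 0, ∃ ρ₀ > 0, ∀ z ∈ A, dist z x < ρ₀ → ‖h z‖ ≤ ε * ‖z - x‖ := by
  intro ε hε
  have h1 := hL.def hε
  rw [Metric.nhdsWithin_basis_ball.eventually_iff] at h1
  obtain ⟨ρ₀, hρ₀, h2⟩ := h1
  exact ⟨ρ₀, hρ₀, fun z hz hzx => h2 ⟨hzx, hz⟩⟩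

lemma exists_forall_norm_le_of_hasFDerivAt {F : Type*} [NormedAddCommGroup F] [NormedSpace ℝ F]
    {h : Rn n → F} {L : Rn n →L[ℝ] F} {x : Rn n} (hL : HasFDerivAt h L x) :
    ∀ ε > 0, ∃ ρ₀ > 0, ∀ z, dist z x < ρ₀ → ‖h z - h x - L (z - x)‖ ≤ ε * ‖z - x‖ := by
  intro ε hε
  have h1 := hasFDerivAt_iff_isLittleO.1 hL
  rw [← nhdsWithin_univ] at h1
  obtain ⟨ρ₀, hρ₀, h2⟩ := exists_forall_norm_le_of_isLittleO h1 ε hε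
  exact ⟨ρ₀, hρ₀, fun z hz => h2 z (Set.mem_univ z) hz⟩

lemma exists_forall_norm_sub_le_of_differentiableAt {F : Type*} [NormedAddCommGroup F]
    [NormedSpace ℝ F] {g : Fin Q → Rn n → F} {x : Rn n} (hd : ∀ i, DifferentiableAt ℝ (g i) x) :
    ∀ ε > 0, ∃ ρ₀ > 0, ∀ i, ∀ z, dist z x < ρ₀ →
      ‖g i z - g i x - fderiv ℝ (g i) x (z - x)‖ ≤ ε * ‖z - x‖ := by
  intro ε hε
  have h1 : ∀ i, ∀ᶠ z in 𝓝 x, ‖g i z - g i x - fderiv ℝ (g i) x (z - x)‖ ≤ ε * ‖z - x‖ := fun i =>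
    (hasFDerivAt_iff_isLittleO.1 (hd i).hasFDerivAt).def hε
  obtain ⟨ρ₀, hρ₀, h2⟩ := Metric.eventually_nhds_iff_ball.1 (eventually_all.2 h1)
  exact ⟨ρ₀, hρ₀, fun i z hz => h2 z hz i⟩

/-- The sheet itself serves as the density-one set. Selections meeting at x agree on all of S, so
the difference of their derivatives is o(|z - x|) along S and vanishes. -/
theorem IsSheet.isApproxJet {S : Set (Rn n)} {g : Fin Q → Rn n → Rn m} (h : IsSheet f S g)
    (hSΩ : S ⊆ Ω) {x : Rn n} (hx : x ∈ S) (hd : HasDensityOne S x)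
    (hg : ∀ i, DifferentiableAt ℝ (g i) x) :
    IsApproxJet Ω f x fun i => (g i x, fderiv ℝ (g i) x) := by
  refine ⟨h.eq_sum x hx, fun i k hik => ?_, S, h.measurableSet, hSΩ, hx,
    hd.tendsto h.measurableSet, ?_⟩
  · have hz := eq_zero_of_isLittleO_of_hasDensityOne h.measurableSet hd
      (fderiv ℝ (g i) x - fderiv ℝ (g k) x) (fun ε hε => by
        obtain ⟨ρ₀, hρ₀, h1⟩ := exists_forall_norm_le_of_hasFDerivAt
          ((hg i).hasFDerivAt.sub (hg k).hasFDerivAt) ε hε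
        refine ⟨ρ₀, hρ₀, fun z hz hzx => ?_⟩
        have h2 := h1 z hzx
        have h3 : g i x = g k x := hik
        simpa [h.eqOn i k x hx hik z hz, h3, norm_sub_rev] using h2)
    exact sub_eq_zero.1 hz
  · rw [isLittleO_iff]
    intro ε hε
    -- Summing Q squares costs a factor Q ≤ (Q + 1)².
    obtain ⟨ρ₀, hρ₀, h1⟩ := exists_forall_norm_sub_le_of_differentiableAt hg (ε / (Q + 1))
      (by positivity)
    filter_upwards [inter_mem_nhdsWithin S (Metric.ball_mem_nhds x hρ₀)] with z hz
    rw [Real.norm_of_nonneg (AQ.G_nonneg _ _), h.eq_sum z hz.1]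
    refine (AQ.G_sum_le_tupleDist _ _).trans ?_
    have h2 : ∀ i, ‖g i z - (g i x + fderiv ℝ (g i) x (z - x))‖ ^ 2 ≤
        (ε / (Q + 1) * ‖z - x‖) ^ 2 := fun i => by
      rw [← sub_sub]
      exact pow_le_pow_left₀ (norm_nonneg _) (h1 i z hz.2) 2
    refine Real.sqrt_le_iff.2 ⟨by positivity, (Finset.sum_le_sum fun i _ => h2 i).trans ?_⟩
    rw [Finset.sum_const, Finset.card_univ, Fintype.card_fin, nsmul_eq_mul, mul_pow, mul_pow,
      ← mul_assoc]
    refine mul_le_mul_of_nonneg_right ?_ (by positivity)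
    rw [div_pow, ← mul_div_assoc, div_le_iff₀ (by positivity), mul_comm]
    refine mul_le_mul_of_nonneg_left ?_ (by positivity)
    nlinarith [Nat.cast_nonneg (α := ℝ) Q]

/-- Approximate jets are unique up to a permutation. -/
theorem IsApproxJet.exists_perm {x : Rn n} {J J' : Fin Q → Rn m × (Rn n →L[ℝ] Rn m)}
    (h : IsApproxJet Ω f x J) (h' : IsApproxJet Ω f x J') :
    ∃ σ : Equiv.Perm (Fin Q), ∀ i, J' (σ i) = J i := by
  obtain ⟨hf, hJ, A, hAm, -, -, hAd, hAo⟩ := h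
  obtain ⟨hf', hJ', A', hAm', -, -, hAd', hAo'⟩ := h'
  obtain ⟨σ, hσ⟩ := AQ.sum_eq_sum_iff.1 (hf.symm.trans hf')
  refine ⟨σ, fun i => Prod.ext (hσ i) ?_⟩
  have hd := (HasDensityOne.of_tendsto hAm hAd).inter (HasDensityOne.of_tendsto hAm' hAd')
  obtain ⟨δ, hδ, hsep⟩ := exists_separation fun i => (J' i).1
  set M := ∑ k, (‖(J k).2‖ + ‖(J' k).2‖)
  have hM : ∀ k l, ‖(J k).2‖ + ‖(J' l).2‖ ≤ 2 * M := by
    intro k l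
    have h1 := Finset.single_le_sum (f := fun k => ‖(J k).2‖ + ‖(J' k).2‖)
      (fun _ _ => by positivity) (Finset.mem_univ k)
    have h2 := Finset.single_le_sum (f := fun k => ‖(J k).2‖ + ‖(J' k).2‖)
      (fun _ _ => by positivity) (Finset.mem_univ l)
    linarith [norm_nonneg (J' k).2, norm_nonneg (J l).2]
  have hM0 : 0 ≤ M := Finset.sum_nonneg fun _ _ => by positivity
  refine (sub_eq_zero.1 (eq_zero_of_isLittleO_of_hasDensityOne (hAm.inter hAm') hd
    ((J i).2 - (J' (σ i)).2) fun ε hε => ?_)).symm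
  obtain ⟨ρ₁, hρ₁, h1⟩ := exists_forall_norm_le_of_isLittleO hAo (ε / 2) (by positivity)
  obtain ⟨ρ₂, hρ₂, h2⟩ := exists_forall_norm_le_of_isLittleO hAo' (ε / 2) (by positivity)
  refine ⟨min (min ρ₁ ρ₂) (δ / (2 * M + ε + 1)), by positivity, fun z hz hzx => ?_⟩
  simp only [lt_min_iff] at hzx
  have h3 := h1 z hz.1 hzx.1.1
  have h4 := h2 z hz.2 hzx.1.2
  rw [Real.norm_of_nonneg (AQ.G_nonneg _ _)] at h3 h4
  have h5 : AQ.G (AQ.sum fun i => (J i).1 + (J i).2 (z - x))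
      (AQ.sum fun i => (J' i).1 + (J' i).2 (z - x)) ≤ ε * ‖z - x‖ := by
    refine (AQ.G_triangle _ (f z) _).trans ?_
    rw [AQ.G_comm _ (f z)]
    linarith
  obtain ⟨τ, hτ⟩ := AQ.exists_G_sum_eq (fun i => (J i).1 + (J i).2 (z - x))
    fun i => (J' i).1 + (J' i).2 (z - x)
  rw [hτ] at h5
  have h6 := (norm_sub_le_tupleDist _ _ i).trans h5
  simp only [Function.comp] at h6
  -- The optimal matching at z need not be σ, but near x it cannot pair branches with different base
  -- points, which are δ apart. Branches with equal base points have equal differentials, so the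
  -- difference between τ and σ is harmless.
  have h7 : (J' (τ i)).1 = (J i).1 := by
    by_contra hne
    rw [← hσ i] at hne
    have h8 := hsep _ _ hne
    have h9 : ‖(J' (τ i)).1 - (J' (σ i)).1‖ ≤ ε * ‖z - x‖ + 2 * M * ‖z - x‖ := by
      have e1 : (J' (τ i)).1 - (J' (σ i)).1 = -((J i).1 + (J i).2 (z - x) -
          ((J' (τ i)).1 + (J' (τ i)).2 (z - x))) + ((J i).2 (z - x) - (J' (τ i)).2 (z - x)) := by
        rw [hσ i]; abel
      rw [e1]
      refine (norm_add_le _ _).trans (add_le_add (by rwa [norm_neg]) ?_)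
      refine (norm_sub_le _ _).trans ?_
      refine (add_le_add ((J i).2.le_opNorm _) ((J' (τ i)).2.le_opNorm _)).trans ?_
      rw [← add_mul]
      exact mul_le_mul_of_nonneg_right (hM i (τ i)) (norm_nonneg _)
    have h10 : (2 * M + ε + 1) * ‖z - x‖ < δ := by
      have := hzx.2
      rw [dist_eq_norm, lt_div_iff₀ (by positivity)] at this
      linarith
    nlinarith [norm_nonneg (z - x)]
  have h11 : (J' (τ i)).2 = (J' (σ i)).2 := hJ' _ _ (h7.trans (hσ i).symm)
  rw [h11, h7, add_sub_add_left_eq_sub] at h6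
  simpa using h6

/-- The conditions that hold at almost every point of a sheet. -/
theorem IsSheet.ae_exists_perm {S : Set (Rn n)} {g : Fin Q → Rn n → Rn m} (h : IsSheet f S g)
    (hSΩ : S ⊆ Ω) : ∀ᵐ x, x ∈ S → HasDensityOne S x ∧ (∀ i, DifferentiableAt ℝ (g i) x) ∧
      ∃ σ : Equiv.Perm (Fin Q), ∀ i, approxJet Ω f x (σ i) = (g i x, fderiv ℝ (g i) x) := by
  have h1 : ∀ᵐ x, ∀ i, DifferentiableAt ℝ (g i) x := by
    rw [ae_all_iff]
    intro i
    obtain ⟨K, hK⟩ := h.lipschitz i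
    exact hK.ae_differentiableAt
  filter_upwards [ae_hasDensityOne h.measurableSet, h1] with x hx hd hxS
  have hJ := h.isApproxJet hSΩ hxS (hx hxS) hd
  have hex : ∃ J, IsApproxJet Ω f x J := ⟨_, hJ⟩
  refine ⟨hx hxS, hd, ?_⟩
  have : approxJet Ω f x = hex.choose := by rw [approxJet, dif_pos hex]
  rw [this]
  exact hJ.exists_perm hex.choose_spec

/-- Countably many sheets cover almost all of Ω, so almost-everywhere statements can be proved one
sheet at a time, with classical derivatives. -/
lemma DominatesGradients.ae_of_sheets (hΩ : IsOpen Ω) (hΩf : volume Ω ≠ ⊤)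
    (h : DominatesGradients Ω f Θ) {p : Rn n → Prop}
    (hp : ∀ S g, S ⊆ Ω → IsSheet f S g → ∀ᵐ x, x ∈ S → p x) :
    ∀ᵐ x ∂(volume.restrict Ω), p x := by
  obtain ⟨𝒮, hc, hS, hcov⟩ := h.exists_sheets hΩ hΩf
  rw [ae_restrict_iff' hΩ.measurableSet]
  have h1 : ∀ᵐ x, ∀ S ∈ 𝒮, x ∈ S → p x := by
    rw [ae_ball_iff hc]
    intro S hSS
    obtain ⟨hSΩ, g, hg⟩ := hS S hSS
    exact hp S g hSΩ hg
  filter_upwards [h1, hcov] with x hx hxc hxΩ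
  obtain ⟨S, hSS, hxS⟩ := hxc hxΩ
  exact hx S hSS hxS

/-- Symmetric expressions in the approximate jets are measurable. -/
theorem DominatesGradients.aemeasurable_sum (hΩ : IsOpen Ω) (hΩf : volume Ω ≠ ⊤)
    (h : DominatesGradients Ω f Θ) {q : Rn n × Rn m × (Rn n →L[ℝ] Rn m) → ℝ} (hq : Continuous q) :
    AEMeasurable (fun x => ∑ i, q (x, approxJet Ω f x i)) (volume.restrict Ω) := by
  obtain ⟨𝒮, hc, hS, hcov⟩ := h.exists_sheets hΩ hΩf
  have h1 : ∀ S ∈ 𝒮, AEMeasurable (fun x => ∑ i, q (x, approxJet Ω f x i)) (volume.restrict S) := by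
    intro S hSS
    obtain ⟨hSΩ, g, hg⟩ := hS S hSS
    have hm : Measurable fun x => ∑ i, q (x, g i x, fderiv ℝ (g i) x) := by
      refine Finset.measurable_sum _ fun i _ => hq.measurable.comp ?_
      obtain ⟨K, hK⟩ := hg.lipschitz i
      exact measurable_id.prodMk (hK.continuous.measurable.prodMk (measurable_fderiv ℝ (g i)))
    refine hm.aemeasurable.congr ?_
    rw [EventuallyEq, ae_restrict_iff' hg.measurableSet]
    filter_upwards [hg.ae_exists_perm hSΩ] with x hx hxS
    obtain ⟨-, -, σ, hσ⟩ := hx hxS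
    rw [← Equiv.sum_comp σ fun i => q (x, approxJet Ω f x i)]
    exact Finset.sum_congr rfl fun i _ => by rw [hσ i]
  have h2 : AEMeasurable (fun x => ∑ i, q (x, approxJet Ω f x i)) (volume.restrict (⋃₀ 𝒮)) := by
    have := hc.to_subtype
    rw [Set.sUnion_eq_iUnion]
    exact aemeasurable_iUnion_iff.2 fun S => h1 S S.2
  refine h2.mono_measure (Measure.restrict_mono_ae ?_)
  filter_upwards [hcov] with x hx hxΩ
  obtain ⟨S, hSS, hxS⟩ := hx hxΩ
  exact ⟨S, hSS, hxS⟩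

theorem DominatesGradients.ae_sq_abs (hΩ : IsOpen Ω) (hΩf : volume Ω ≠ ⊤)
    (h : DominatesGradients Ω f Θ) :
    ∀ᵐ x ∂(volume.restrict Ω), (f x).abs ^ 2 = ∑ i, ‖(approxJet Ω f x i).1‖ ^ 2 := by
  refine h.ae_of_sheets hΩ hΩf fun S g hSΩ hg => ?_
  filter_upwards [hg.ae_exists_perm hSΩ] with x hx hxS
  obtain ⟨-, -, σ, hσ⟩ := hx hxS
  rw [hg.eq_sum x hxS, AQ.sq_abs_sum, ← Equiv.sum_comp σ fun i => ‖(approxJet Ω f x i).1‖ ^ 2]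
  exact Finset.sum_congr rfl fun i _ => by rw [hσ i]

lemma IsLebesguePoint.exists_integral_norm_sub_le {F : Type*} [NormedAddCommGroup F]
    {w : Rn n → F} (hΩ : IsOpen Ω) {x : Rn n} (hx : x ∈ Ω)
    (h : IsLebesguePoint (Ω.indicator w) x) {ε : ℝ} (hε : 0 < ε) :
    ∃ ρ₀ > 0, Metric.closedBall x ρ₀ ⊆ Ω ∧
      ∀ ρ, 0 < ρ → ρ ≤ ρ₀ → ∫ y in Metric.ball x ρ, ‖w y - w x‖ ≤ ε * ρ ^ n := by
  obtain ⟨ρ₁, hρ₁, h1⟩ := h ε hε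
  obtain ⟨ρ₂, hρ₂, h2⟩ := Metric.isOpen_iff.1 hΩ x hx
  have hρ : 0 < min ρ₁ ρ₂ := lt_min hρ₁ hρ₂
  have hlt : min ρ₁ ρ₂ / 2 < min ρ₁ ρ₂ := by linarith
  have hsub : Metric.closedBall x (min ρ₁ ρ₂ / 2) ⊆ Ω :=
    (Metric.closedBall_subset_ball (hlt.trans_le (min_le_right _ _))).trans h2
  refine ⟨min ρ₁ ρ₂ / 2, by positivity, hsub, fun ρ h0 hle => ?_⟩
  refine le_trans (le_of_eq ?_) (h1 ρ h0 ((hle.trans_lt hlt).trans_le (min_le_left _ _)))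
  refine setIntegral_congr_fun Metric.isOpen_ball.measurableSet fun y hy => ?_
  have : y ∈ Ω := hsub (Metric.ball_subset_closedBall (Metric.ball_subset_ball hle hy))
  simp [this, hx]

/-- Near x the value gᵢ(z) is closer to gᵢ(x) than to any other distinct value of f(x), so even the
optimal matching costs at least |gᵢ(z) - gᵢ(x)|. -/
lemma IsSheet.exists_norm_sub_le_G {S : Set (Rn n)} {g : Fin Q → Rn n → Rn m} (h : IsSheet f S g)
    {x : Rn n} (hx : x ∈ S) (i : Fin Q) :
    ∃ ρ₀ > 0, ∀ z ∈ S, dist z x < ρ₀ → ‖g i z - g i x‖ ≤ AQ.G (f z) (f x) := by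
  obtain ⟨δ, hδ, hsep⟩ := exists_separation fun i => g i x
  obtain ⟨K, hK⟩ := h.lipschitz i
  obtain ⟨ρ₀, hρ₀, h1⟩ := Metric.continuous_iff.1 hK.continuous x (δ / 2) (by positivity)
  refine ⟨ρ₀, hρ₀, fun z hz hzx => ?_⟩
  have h2 := h1 z hzx
  rw [dist_eq_norm] at h2
  obtain ⟨σ, hσ⟩ := AQ.exists_G_sum_eq (fun i => g i z) fun i => g i x
  rw [h.eq_sum z hz, h.eq_sum x hx, hσ]
  have h3 := norm_sub_le_tupleDist (fun i => g i z) ((fun i => g i x) ∘ σ) i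
  simp only [Function.comp] at h3
  by_cases he : g (σ i) x = g i x
  · rwa [he] at h3
  · have h4 := hsep _ _ he
    have h5 : ‖g (σ i) x - g i x‖ ≤ ‖g i z - g (σ i) x‖ + ‖g i z - g i x‖ := by
      rw [norm_sub_rev (g i z) (g (σ i) x)]
      refine le_trans (le_of_eq ?_) (norm_add_le _ _)
      congr 1; abel
    linarith

/-- The approximate differentials are dominated by `Θ`. -/
theorem DominatesGradients.ae_norm_le (hΩ : IsOpen Ω) (hΩf : volume Ω ≠ ⊤)
    (h : DominatesGradients Ω f Θ) :
    ∀ᵐ x ∂(volume.restrict Ω), ∀ i, ‖(approxJet Ω f x i).2‖ ≤ 8 * 8 ^ n * Θ x := by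
  refine h.ae_of_sheets hΩ hΩf fun S g hSΩ hg => ?_
  have hω := unitVol_pos (n := n)
  filter_upwards [hg.ae_exists_perm hSΩ, h.ae_integral_ball_G_le hΩ,
    ae_isLebesguePoint (MemLp.locallyIntegrable_two (memLp_indicator hΩ h.memLp))] with
    x hx hav hleb hxS
  obtain ⟨hd, hdiff, σ, hσ⟩ := hx hxS
  have key : ∀ i, ‖fderiv ℝ (g i) x‖ ≤ 8 * 8 ^ n * Θ x := by
    intro i
    obtain ⟨R, hR, hRΩ, -⟩ := hleb.exists_integral_norm_sub_le hΩ (hSΩ hxS) one_pos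
    -- The derivative is compared with the oscillation G(f(z), f(x)), whose averages are controlled
    -- by Θ(x) through the Poincaré inequality at a Lebesgue point of Θ.
    have h1 := opNorm_le_of_average_le hg.measurableSet hd (fderiv ℝ (g i) x)
      (h := fun z => AQ.G (f z) (f x)) (a := Θ x * unitVol n) hR (fun z => AQ.G_nonneg _ _)
      (integrableOn_ball_of_memLp (h.sobolev (f x)).1 (Metric.ball_subset_closedBall.trans hRΩ))
      (fun ε hε => by
        obtain ⟨ρ₁, hρ₁, h1⟩ := hg.exists_norm_sub_le_G hxS i
        obtain ⟨ρ₂, hρ₂, h2⟩ := exists_forall_norm_le_of_hasFDerivAt (hdiff i).hasFDerivAt ε hε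
        refine ⟨min ρ₁ ρ₂, lt_min hρ₁ hρ₂, fun z hz hzx => ?_⟩
        have h3 := h1 z hz (hzx.trans_le (min_le_left _ _))
        have h4 := h2 z (hzx.trans_le (min_le_right _ _))
        have h5 : ‖fderiv ℝ (g i) x (z - x)‖ ≤ ‖g i z - g i x‖ +
            ‖g i z - g i x - fderiv ℝ (g i) x (z - x)‖ := by
          simpa using norm_sub_le (g i z - g i x) (g i z - g i x - fderiv ℝ (g i) x (z - x))
        linarith)
      (fun ε hε => by
        obtain ⟨ρ₀, hρ₀, hρΩ, h1⟩ := hleb.exists_integral_norm_sub_le hΩ (hSΩ hxS) hε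
        refine ⟨ρ₀, hρ₀, fun ρ h0 hρ => ?_⟩
        have h2 := hav ρ (Θ x * unitVol n + ε) h0
          ((Metric.closedBall_subset_closedBall hρ.le).trans hρΩ)
          (by have := h.nonneg x; positivity) (fun s hs hsρ => by
            have hsΩ : Metric.ball x s ⊆ Ω := Metric.ball_subset_closedBall.trans
              ((Metric.closedBall_subset_closedBall (hsρ.trans hρ.le)).trans hρΩ)
            have i0 := integrableOn_ball_of_memLp h.memLp hsΩ
            have i2 : IntegrableOn (fun _ : Rn n => Θ x) (Metric.ball x s) :=
              integrableOn_const (volume_ball_ne_top x s)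
            have i1 : IntegrableOn (fun y => ‖Θ y - Θ x‖) (Metric.ball x s) := (i0.sub i2).norm
            have h3 : ∫ y in Metric.ball x s, Θ y ≤
                ∫ y in Metric.ball x s, (‖Θ y - Θ x‖ + Θ x) := by
              refine setIntegral_mono i0 (i1.add i2) fun y => ?_
              have := le_abs_self (Θ y - Θ x)
              change Θ y ≤ |Θ y - Θ x| + Θ x
              linarith
            rw [integral_add i1 i2, setIntegral_const, volume_real_ball x hs, smul_eq_mul] at h3
            have h4 := h1 s hs (hsρ.trans hρ.le)
            nlinarith)
        refine h2.trans (le_of_eq ?_)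
        ring)
    have h8 : (8 : ℝ) ^ n * (1 / 8) ^ n = 1 := by rw [← mul_pow]; norm_num
    have h2 : ‖fderiv ℝ (g i) x‖ * (1 / 8) ^ n ≤ 8 * Θ x := by
      refine le_of_mul_le_mul_right ?_ hω
      linarith
    calc ‖fderiv ℝ (g i) x‖ = 8 ^ n * (‖fderiv ℝ (g i) x‖ * (1 / 8) ^ n) := by
          rw [mul_left_comm, h8, mul_one]
      _ ≤ 8 ^ n * (8 * Θ x) := mul_le_mul_of_nonneg_left h2 (by positivity)
      _ = 8 * 8 ^ n * Θ x := by ring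
  intro i
  have h1 := hσ (σ.symm i)
  rw [Equiv.apply_symm_apply] at h1
  rw [h1]
  exact key _

/-- The chain rule for the modulus of a Sobolev `Q`-valued function. -/
theorem DominatesGradients.ae_abs_mul_grad (hΩ : IsOpen Ω) (hΩf : volume Ω ≠ ⊤)
    (h : DominatesGradients Ω f Θ) {G : Rn n → Rn n}
    (hG : MemLp G 2 (volume.restrict Ω)) (hw : HasWeakGradient Ω (fun x => (f x).abs) G) :
    ∀ᵐ x ∂(volume.restrict Ω), ∀ v, (f x).abs * inner ℝ (G x) v =
      ∑ i, inner ℝ (approxJet Ω f x i).1 ((approxJet Ω f x i).2 v) := by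
  refine h.ae_of_sheets hΩ hΩf fun S g hSΩ hg => ?_
  have hu : MemLp (fun x => (f x).abs) 2 (volume.restrict Ω) := (h.sobolev _).1
  filter_upwards [hg.ae_exists_perm hSΩ,
    ae_isLebesguePoint (MemLp.locallyIntegrable_two (memLp_indicator hΩ hu)),
    ae_isLebesguePoint (MemLp.locallyIntegrable_two (memLp_indicator hΩ hG))] with
    x hx hlu hlG hxS v
  obtain ⟨hd, hdiff, σ, hσ⟩ := hx hxS
  have hsum : ∑ i, inner ℝ (approxJet Ω f x i).1 ((approxJet Ω f x i).2 v) =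
      ∑ i, inner ℝ (g i x) (fderiv ℝ (g i) x v) := by
    rw [← Equiv.sum_comp σ]
    exact Finset.sum_congr rfl fun i _ => by rw [hσ i]
  rw [hsum]
  have habs : ∀ z ∈ S, (f z).abs ^ 2 = ∑ i, ‖g i z‖ ^ 2 := fun z hz => by
    rw [hg.eq_sum z hz, AQ.sq_abs_sum]
  -- Where f vanishes the square root is not differentiable, but both sides are zero.
  rcases (AQ.abs_nonneg (f x)).eq_or_lt with h0 | hpos
  · have h1 := habs x hxS
    rw [← h0, zero_pow two_ne_zero] at h1
    have h2 := (Finset.sum_eq_zero_iff_of_nonneg fun i _ => by positivity).1 h1.symm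
    rw [← h0, zero_mul]
    refine (Finset.sum_eq_zero fun i hi => ?_).symm
    have : g i x = 0 := by simpa using h2 i hi
    rw [this, inner_zero_left]
  · set W : Rn n →L[ℝ] ℝ := ∑ i, (2 : ℕ) • (innerSL ℝ (g i x)).comp (fderiv ℝ (g i) x)
    have hW : HasFDerivAt (fun z => ∑ i, ‖g i z‖ ^ 2) W x :=
      HasFDerivAt.fun_sum fun i _ => (hdiff i).hasFDerivAt.norm_sq
    have hwx : ∑ i, ‖g i x‖ ^ 2 ≠ 0 := by rw [← habs x hxS]; positivity
    have hsq := hW.sqrt hwx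
    have hsx : ∀ z ∈ S, Real.sqrt (∑ i, ‖g i z‖ ^ 2) = (f z).abs := fun z hz => by
      rw [← habs z hz, Real.sqrt_sq (AQ.abs_nonneg _)]
    rw [hsx x hxS] at hsq
    -- The classical derivative of the square root of ∑ |gᵢ|² minus the weak gradient. The Poincaré
    -- inequality with a = G(x) makes the affine remainder of |f| of average o(ρ), which forces L =
    -- 0.
    set L := (1 / (2 * (f x).abs)) • W - innerSL ℝ (G x)
    have hL0 : L = 0 := by
      obtain ⟨R, hR, hRΩ, -⟩ := hlG.exists_integral_norm_sub_le hΩ (hSΩ hxS) one_pos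
      have hRb : Metric.ball x R ⊆ Ω := Metric.ball_subset_closedBall.trans hRΩ
      have hc2 : Continuous fun z : Rn n => inner ℝ (G x) (z - x) := by fun_prop
      have i1 : IntegrableOn (fun z => |(f z).abs - (f x).abs - inner ℝ (G x) (z - x)|)
          (Metric.ball x R) :=
        (((integrableOn_ball_of_memLp hu hRb).sub (integrableOn_const (volume_ball_ne_top x R))).sub
          ((hc2.continuousOn.integrableOn_compact (isCompact_closedBall x R)).mono_set
            Metric.ball_subset_closedBall)).abs
      have h1 := opNorm_le_of_average_le hg.measurableSet hd L
        (h := fun z => |(f z).abs - (f x).abs - inner ℝ (G x) (z - x)|) (a := 0) hR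
        (fun z => abs_nonneg _) i1
        (fun ε hε => by
          obtain ⟨ρ₀, hρ₀, h1⟩ := exists_forall_norm_le_of_hasFDerivAt hsq ε hε
          refine ⟨ρ₀, hρ₀, fun z hz hzx => ?_⟩
          have h2 := h1 z hzx
          rw [hsx z hz, hsx x hxS] at h2
          have h3 : L (z - x) = ((f z).abs - (f x).abs - inner ℝ (G x) (z - x)) -
              ((f z).abs - (f x).abs - ((1 / (2 * (f x).abs)) • W) (z - x)) := by
            simp only [L, sub_apply, innerSL_apply_apply]; ring
          rw [h3]
          refine (norm_sub_le _ _).trans (add_le_add (le_of_eq ?_) h2)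
          rw [Real.norm_eq_abs])
        (fun ε hε => by
          obtain ⟨ρ₀, hρ₀, hρΩ, h1⟩ := hlG.exists_integral_norm_sub_le hΩ (hSΩ hxS) hε
          refine ⟨ρ₀, hρ₀, fun ρ hρ0 hρ => ?_⟩
          have h2 := integral_ball_sub_affine_le hΩ hu hG hw hlu (G x) hρ0
            ((Metric.closedBall_subset_closedBall hρ.le).trans hρΩ) hε.le
            (fun s hs hsρ => h1 s hs (hsρ.trans hρ.le))
          refine h2.trans (le_of_eq ?_)
          ring)
      have hω := unitVol_pos (n := n)
      rw [mul_zero] at h1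
      exact norm_le_zero_iff.1 (nonpos_of_mul_nonpos_left h1 (by positivity))
    have h1 : L v = 0 := by rw [hL0]; rfl
    simp only [L, W, sub_apply, smul_apply, sum_apply, ContinuousLinearMap.comp_apply,
      innerSL_apply_apply, smul_eq_mul, nsmul_eq_mul, Nat.cast_ofNat,
      ← Finset.mul_sum] at h1
    field_simp at h1
    linarith

end Jets

/-! ### The cutoff profile and differentiation in the radius. -/

section Profile

/-- A smooth cutoff profile supported in `(-∞, 1]`. -/
def cutoff (s : ℝ) : ℝ := expNegInvGlue (1 - s)

/-- The negative derivative of `cutoff`. -/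
def weight (s : ℝ) : ℝ := (1 - s)⁻¹ ^ 2 * expNegInvGlue (1 - s)

lemma hasDerivAt_cutoff (s : ℝ) : HasDerivAt cutoff (-weight s) s := by
  have h := expNegInvGlue.hasDerivAt_polynomial_eval_inv_mul 1 (1 - s)
  have h2 := h.comp s ((hasDerivAt_id s).const_sub 1)
  have h3 : HasDerivAt cutoff (((Polynomial.X ^ 2 * (1 - Polynomial.derivative 1) :
      Polynomial ℝ).eval (1 - s)⁻¹ * expNegInvGlue (1 - s)) * -1) s := by
    refine h2.congr_of_eventuallyEq (Eventually.of_forall fun t => ?_)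
    simp [cutoff]
  refine h3.congr_deriv ?_
  simp [weight]

lemma contDiff_cutoff : ContDiff ℝ ∞ cutoff :=
  expNegInvGlue.contDiff.comp (contDiff_const.sub contDiff_id)

lemma contDiff_weight : ContDiff ℝ ∞ weight := by
  have h : weight = fun s => -deriv cutoff s :=
    funext fun s => by rw [(hasDerivAt_cutoff s).deriv, neg_neg]
  rw [h]
  exact ((contDiff_infty_iff_deriv.1 contDiff_cutoff).2).neg

lemma weight_nonneg (s : ℝ) : 0 ≤ weight s :=
  mul_nonneg (sq_nonneg _) (expNegInvGlue.nonneg _)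

lemma weight_pos {s : ℝ} (hs : s < 1) : 0 < weight s :=
  mul_pos (pow_pos (inv_pos.2 (by linarith)) 2) (expNegInvGlue.pos_of_pos (by linarith))

lemma cutoff_eq_zero {s : ℝ} (hs : 1 ≤ s) : cutoff s = 0 :=
  expNegInvGlue.zero_of_nonpos (by linarith)

lemma weight_eq_zero {s : ℝ} (hs : 1 ≤ s) : weight s = 0 := by
  rw [weight, expNegInvGlue.zero_of_nonpos (by linarith), mul_zero]

/-- Only nonnegative arguments matter, since the profiles are evaluated at |z - x|²/r²; compactness
of [0, 1] then suffices. -/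
lemma exists_bound_profile {χ : ℝ → ℝ} (hχ : Continuous χ) (h0 : ∀ s, 1 ≤ s → χ s = 0) :
    ∃ M, 0 ≤ M ∧ ∀ s, 0 ≤ s → |χ s| ≤ M := by
  obtain ⟨M, hM⟩ := (isCompact_Icc (a := (0 : ℝ)) (b := 1)).exists_bound_of_continuousOn
    hχ.continuousOn
  refine ⟨M, (norm_nonneg _).trans (hM 0 (by simp)), fun s hs => ?_⟩
  rcases le_total s 1 with h | h
  · exact hM s ⟨hs, h⟩
  · rw [h0 s h, abs_zero]
    exact (norm_nonneg _).trans (hM 0 (by simp))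

lemma deriv_eq_zero_of_one_le {χ : ℝ → ℝ} (hχ : ContDiff ℝ ∞ χ) (h0 : ∀ s, 1 ≤ s → χ s = 0) :
    ∀ s, 1 ≤ s → deriv χ s = 0 := by
  have hc : Continuous (deriv χ) := (contDiff_infty_iff_deriv.1 hχ).2.continuous
  have h1 : ∀ s ∈ Set.Ioi (1 : ℝ), deriv χ s = 0 := by
    intro s hs
    have : χ =ᶠ[𝓝 s] fun _ => 0 := by
      filter_upwards [Ioi_mem_nhds hs] with t ht using h0 t (le_of_lt ht)
    rw [this.deriv_eq, deriv_const]
  intro s hs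
  have h2 : Set.EqOn (deriv χ) (fun _ => 0) (closure (Set.Ioi (1 : ℝ))) :=
    Set.EqOn.closure h1 hc continuous_const
  rw [closure_Ioi] at h2
  exact h2 hs

/-- Differentiation of weighted integrals with respect to the radius. -/
theorem hasDerivAt_integral_profile {μ : Measure (Rn n)} {F : Rn n → ℝ} (hF : Integrable F μ)
    {χ : ℝ → ℝ} (hχ : ContDiff ℝ ∞ χ) (h0 : ∀ s, 1 ≤ s → χ s = 0) (x : Rn n) {r : ℝ}
    (hr : 0 < r) :
    HasDerivAt (fun r => ∫ z, χ (‖z - x‖ ^ 2 / r ^ 2) * F z ∂μ)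
      (∫ z, (-(2 / r) * (deriv χ (‖z - x‖ ^ 2 / r ^ 2) * (‖z - x‖ ^ 2 / r ^ 2))) * F z ∂μ) r := by
  have hdc : Continuous (deriv χ) := (contDiff_infty_iff_deriv.1 hχ).2.continuous
  obtain ⟨M, hM0, hM⟩ := exists_bound_profile hχ.continuous h0
  obtain ⟨M', hM0', hM'⟩ := exists_bound_profile (hdc.mul continuous_id)
    fun s hs => by simp [deriv_eq_zero_of_one_le hχ h0 s hs]
  have hq : ∀ z : Rn n, ∀ r : ℝ, 0 ≤ ‖z - x‖ ^ 2 / r ^ 2 := fun z r => by positivity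
  have hcz : ∀ r : ℝ, Continuous fun z : Rn n => ‖z - x‖ ^ 2 / r ^ 2 := fun r =>
    ((continuous_id.sub continuous_const).norm.pow 2).div_const _
  -- For t > r/2 one has 2/t ≤ 4/r, and s χ'(s) is bounded by M'; this gives a dominating function
  -- independent of t.
  refine (hasDerivAt_integral_of_dominated_loc_of_deriv_le (s := Set.Ioi (r / 2))
    (bound := fun z => (4 / r * M') * |F z|)
    (F' := fun r z => (-(2 / r) * (deriv χ (‖z - x‖ ^ 2 / r ^ 2) * (‖z - x‖ ^ 2 / r ^ 2))) * F z)
    (Ioi_mem_nhds (by linarith)) ?_ ?_ ?_ ?_ ?_ ?_).2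
  · exact Eventually.of_forall fun r =>
      (hχ.continuous.comp (hcz r)).aestronglyMeasurable.mul hF.aestronglyMeasurable
  · refine hF.bdd_mul (c := M) (hχ.continuous.comp (hcz r)).aestronglyMeasurable ?_
    exact Eventually.of_forall fun z => hM _ (hq z r)
  · exact ((continuous_const.mul ((hdc.comp (hcz r)).mul (hcz r))).aestronglyMeasurable).mul
      hF.aestronglyMeasurable
  · refine Eventually.of_forall fun z t ht => ?_
    have ht' : r / 2 < t := ht
    have ht0 : 0 < t := by linarith
    rw [norm_mul, norm_mul, norm_neg, Real.norm_of_nonneg (by positivity), Real.norm_eq_abs (F z)]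
    refine mul_le_mul_of_nonneg_right ?_ (abs_nonneg _)
    refine mul_le_mul ?_ (hM' _ (hq z t)) (norm_nonneg _) (by positivity)
    rw [div_le_div_iff₀ ht0 hr]; linarith
  · exact hF.abs.const_mul _
  · refine Eventually.of_forall fun z t ht => ?_
    have ht' : r / 2 < t := ht
    have ht0 : t ≠ 0 := by linarith
    have h1 : HasDerivAt (fun t : ℝ => ‖z - x‖ ^ 2 / t ^ 2)
        (-(2 / t) * (‖z - x‖ ^ 2 / t ^ 2)) t := by
      have := ((hasDerivAt_pow 2 t).inv (pow_ne_zero 2 ht0)).const_mul (‖z - x‖ ^ 2)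
      refine (this.congr_deriv ?_).congr_of_eventuallyEq
        (Eventually.of_forall fun s => by simp [div_eq_mul_inv])
      field_simp
      norm_num
      ring
    have h2 := (((hχ.differentiable (by simp)) (‖z - x‖ ^ 2 / t ^ 2)).hasDerivAt.comp t h1).mul_const
      (F z)
    refine h2.congr_deriv ?_
    ring

end Profile

/-! ### Monotonicity of the frequency. -/

section Frequency

/-- Monotonicity of the frequency function and the resulting doubling property. -/
theorem exists_doubling_of_frequency {H D E : ℝ → ℝ} {a R : ℝ} (hR : 0 < R)
    (hH : ∀ r, 0 < r → r < R → HasDerivAt H ((a * H r + r ^ 2 * D r) / r) r)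
    (hD : ∀ r, 0 < r → r < R → HasDerivAt D (((a - 2) * D r + 4 / r ^ 2 * E r) / r) r)
    (hHpos : ∀ r, 0 < r → r < R → 0 < H r)
    (hCS : ∀ r, 0 < r → r < R → (r ^ 2 * D r) ^ 2 ≤ 4 * (H r * E r)) :
    ∃ C, 0 ≤ C ∧ ∀ r, 0 < r → r ≤ R / 8 → H (4 * r) ≤ C * H r := by
  -- The dimensional terms with a cancel, and the numerator left is exactly the Cauchy–Schwarz
  -- deficit.
  have hI : ∀ r ∈ Set.Ioo 0 R, HasDerivAt (fun r => r ^ 2 * D r / H r)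
      ((4 * (H r * E r) - (r ^ 2 * D r) ^ 2) / (r * H r ^ 2)) r := by
    intro r hr
    have hr0 : r ≠ 0 := hr.1.ne'
    have hHr := (hHpos r hr.1 hr.2).ne'
    have := (((hasDerivAt_pow 2 r).mul (hD r hr.1 hr.2)).div (hH r hr.1 hr.2) hHr)
    refine this.congr_deriv ?_
    simp only [Pi.mul_apply]
    field_simp
    push_cast
    ring
  have hmono : MonotoneOn (fun r => r ^ 2 * D r / H r) (Set.Ioo 0 R) := by
    refine monotoneOn_of_deriv_nonneg (convex_Ioo 0 R)
      (fun r hr => (hI r hr).continuousAt.continuousWithinAt)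
      (fun r hr => ?_) fun r hr => ?_
    · rw [interior_Ioo] at hr
      exact (hI r hr).differentiableAt.differentiableWithinAt
    · rw [interior_Ioo] at hr
      rw [(hI r hr).deriv]
      have := hCS r hr.1 hr.2
      exact div_nonneg (by linarith) (mul_nonneg hr.1.le (sq_nonneg _))
  set R' := R / 2
  have hR'm : R' ∈ Set.Ioo 0 R := ⟨by positivity, by simp only [R']; linarith⟩
  -- The logarithmic derivative of H is (a + I)/r, and I(r) ≤ I(R') for r ≤ R'. A natural exponent k
  -- above a + I(R') therefore makes H / r^k nonincreasing.
  obtain ⟨k, hk⟩ := exists_nat_ge (a + R' ^ 2 * D R' / H R')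
  have hK : ∀ r ∈ Set.Ioo 0 R, HasDerivAt (fun r => H r / r ^ k)
      (((a * H r + r ^ 2 * D r) - k * H r) / (r * r ^ k)) r := by
    intro r hr
    have hr0 : r ≠ 0 := hr.1.ne'
    have := (hH r hr.1 hr.2).div (hasDerivAt_pow k r) (pow_ne_zero k hr0)
    refine this.congr_deriv ?_
    rcases k with _ | k
    · simp
    · simp only [Nat.add_sub_cancel]
      field_simp
      ring
  have hanti : AntitoneOn (fun r => H r / r ^ k) (Set.Ioc 0 R') := by
    have hsub : ∀ r ∈ Set.Ioc 0 R', r ∈ Set.Ioo 0 R := fun r hr =>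
      ⟨hr.1, hr.2.trans_lt hR'm.2⟩
    refine antitoneOn_of_deriv_nonpos (convex_Ioc 0 R')
      (fun r hr => (hK r (hsub r hr)).continuousAt.continuousWithinAt)
      (fun r hr => ?_) fun r hr => ?_
    · exact (hK r (hsub r (interior_subset hr))).differentiableAt.differentiableWithinAt
    · have hr' := interior_subset hr
      have hr'' := hsub r hr'
      rw [(hK r hr'').deriv]
      have h1 := hmono hr'' hR'm hr'.2
      have hHr := hHpos r hr''.1 hr''.2
      have h2 : r ^ 2 * D r / H r ≤ k - a := by linarith
      rw [div_le_iff₀ hHr] at h2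
      exact div_nonpos_of_nonpos_of_nonneg (by linarith) (by have := hr''.1; positivity)
  refine ⟨4 ^ k, by positivity, fun r hr hrR => ?_⟩
  have h4 : 4 * r ≤ R' := by simp only [R']; linarith
  have h1 := hanti (a := r) ⟨hr, by linarith⟩ (b := 4 * r) ⟨by linarith, h4⟩ (by linarith)
  simp only at h1
  rw [mul_pow, div_le_div_iff₀ (by positivity) (by positivity)] at h1
  have hrk := pow_pos hr k
  refine le_of_mul_le_mul_right ?_ hrk
  linarith

end Frequency

/-! ### The identities from the outer variation, the inner variation and the height. -/

section Variations

lemma sum_coord_smul_e (v : Rn n) : ∑ j, v j • e j = v := by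
  have h := (EuclideanSpace.basisFun (Fin n) ℝ).sum_repr v
  simpa [e] using h

lemma norm_e (j : Fin n) : ‖(e j : Rn n)‖ = 1 := by simp [e]

lemma sum_coord_mul_clm {F : Type*} [NormedAddCommGroup F] [NormedSpace ℝ F] (L : Rn n →L[ℝ] F)
    (v : Rn n) : ∑ j, v j • L (e j) = L v := by
  conv_rhs => rw [← sum_coord_smul_e v, map_sum]
  simp only [map_smul]

lemma inner_e_right (v : Rn n) (j : Fin n) : inner ℝ v (e j) = v j := by
  simp [e, EuclideanSpace.inner_single_right]

/-- The squared distance from `x`, normalized by `r`. -/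
def sqRatio (x : Rn n) (r : ℝ) (z : Rn n) : ℝ := ‖z - x‖ ^ 2 / r ^ 2

lemma sqRatio_nonneg (x : Rn n) (r : ℝ) (z : Rn n) : 0 ≤ sqRatio x r z := by
  unfold sqRatio; positivity

lemma contDiff_sqRatio (x : Rn n) (r : ℝ) : ContDiff ℝ ∞ (sqRatio x r) :=
  ((contDiff_id.sub contDiff_const).norm_sq ℝ).div_const _

lemma fderiv_sqRatio (x : Rn n) (r : ℝ) (z v : Rn n) :
    fderiv ℝ (sqRatio x r) z v = 2 / r ^ 2 * inner ℝ (z - x) v := by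
  have h := (((hasFDerivAt_id z).sub_const x).norm_sq).mul_const ((r ^ 2)⁻¹)
  have h2 : HasFDerivAt (sqRatio x r) _ z := h
  rw [h2.fderiv]
  simp [inner_sub_left]
  ring

lemma fderiv_comp_sqRatio {χ : ℝ → ℝ} {χ' : ℝ} {x : Rn n} {r : ℝ} {z : Rn n}
    (hχ : HasDerivAt χ χ' (sqRatio x r z)) (v : Rn n) :
    fderiv ℝ (fun z => χ (sqRatio x r z)) z v = χ' * (2 / r ^ 2 * inner ℝ (z - x) v) := by
  have h1 := ((contDiff_sqRatio x r).differentiable (by simp) z).hasFDerivAt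
  have h2 := hχ.comp_hasFDerivAt z h1
  have h3 : HasFDerivAt (fun z => χ (sqRatio x r z)) (χ' • fderiv ℝ (sqRatio x r) z) z := h2
  rw [h3.fderiv, smul_apply, fderiv_sqRatio, smul_eq_mul]

lemma one_le_sqRatio {x : Rn n} {r : ℝ} (hr : 0 < r) {z : Rn n}
    (hz : z ∉ Metric.closedBall x r) : 1 ≤ sqRatio x r z := by
  rw [Metric.mem_closedBall, dist_eq_norm, not_le] at hz
  rw [sqRatio, le_div_iff₀ (by positivity), one_mul]
  exact pow_le_pow_left₀ hr.le hz.le 2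

lemma tsupport_subset_of_eq_zero {F : Type*} [Zero F] {x : Rn n} {r : ℝ} {h : Rn n → F}
    (h0 : ∀ z, z ∉ Metric.closedBall x r → h z = 0) : tsupport h ⊆ Metric.closedBall x r := by
  refine closure_minimal (fun z hz => ?_) Metric.isClosed_closedBall
  by_contra hn
  exact hz (h0 z hn)

variable {Ω : Set (Rn n)} {f : Rn n → AQ Q m}

/-- The energy density `|Df|²`. -/
def energyDensity (Ω : Set (Rn n)) (f : Rn n → AQ Q m) (z : Rn n) : ℝ :=
  ∑ i, hsInner (approxJet Ω f z i).2 (approxJet Ω f z i).2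

/-- The squared radial derivative `∑ᵢ |Dfᵢ(z)(z - x)|²`. -/
def radialDensity (Ω : Set (Rn n)) (f : Rn n → AQ Q m) (x z : Rn n) : ℝ :=
  ∑ i, ‖(approxJet Ω f z i).2 (z - x)‖ ^ 2

/-- The product `∑ᵢ ⟨fᵢ(z), Dfᵢ(z)(z - x)⟩`. -/
def radialProduct (Ω : Set (Rn n)) (f : Rn n → AQ Q m) (x z : Rn n) : ℝ :=
  ∑ i, inner ℝ (approxJet Ω f z i).1 ((approxJet Ω f z i).2 (z - x))

lemma hsInner_self_nonneg (A : Rn n →L[ℝ] Rn m) : 0 ≤ hsInner A A :=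
  Finset.sum_nonneg fun _ _ => real_inner_self_nonneg

lemma hsInner_self_le (A : Rn n →L[ℝ] Rn m) : hsInner A A ≤ n * ‖A‖ ^ 2 := by
  have h : ∀ j : Fin n, inner ℝ (A (e j)) (A (e j)) ≤ ‖A‖ ^ 2 := fun j => by
    rw [real_inner_self_eq_norm_sq]
    refine pow_le_pow_left₀ (norm_nonneg _) ?_ 2
    simpa [norm_e] using A.le_opNorm (e j)
  refine (Finset.sum_le_sum fun j _ => h j).trans_eq ?_
  simp

lemma hsInner_add_right (A B C : Rn n →L[ℝ] Rn m) :
    hsInner A (B + C) = hsInner A B + hsInner A C := by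
  simp [hsInner, inner_add_right, Finset.sum_add_distrib]

lemma hsInner_smul_right (A B : Rn n →L[ℝ] Rn m) (c : ℝ) : hsInner A (c • B) = c * hsInner A B := by
  simp [hsInner, inner_smul_right, Finset.mul_sum]

/-- Pairing A with a rank-one map evaluates A in the direction w; this converts gradients of the
cutoff into radial derivatives. -/
lemma hsInner_smulRight (A : Rn n →L[ℝ] Rn m) (w : Rn n) (p : Rn m) :
    hsInner A ((innerSL ℝ w).smulRight p) = inner ℝ p (A w) := by
  rw [← sum_coord_mul_clm A w, inner_sum]
  refine Finset.sum_congr rfl fun j _ => ?_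
  rw [ContinuousLinearMap.smulRight_apply, innerSL_apply_apply, inner_e_right, inner_smul_right,
    inner_smul_right, real_inner_comm]

lemma fderiv_eq_of_apply {h : Rn n → ℝ} {z w : Rn n} {c : ℝ}
    (H : ∀ v, fderiv ℝ h z v = c * inner ℝ w v) : fderiv ℝ h z = c • innerSL ℝ w := by
  ext v
  simp [H]

/-- The outer variation along `(z, u) ↦ φ(|z - x|² / r²) u`. -/
theorem outer_identity (hst : IsDirStationary Ω f) {x : Rn n} {r : ℝ} (hr : 0 < r)
    (hrΩ : Metric.closedBall x r ⊆ Ω) :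
    ∫ z in Ω, (cutoff (sqRatio x r z) * energyDensity Ω f z -
      2 / r ^ 2 * (weight (sqRatio x r z) * radialProduct Ω f x z)) = 0 := by
  set c : Rn n → ℝ := fun z => cutoff (sqRatio x r z) with hc
  have hcs : ContDiff ℝ ∞ c := contDiff_cutoff.comp (contDiff_sqRatio x r)
  have hc0 : ∀ z, z ∉ Metric.closedBall x r → c z = 0 := fun z hz =>
    cutoff_eq_zero (one_le_sqRatio hr hz)
  have hcc : HasCompactSupport c :=
    HasCompactSupport.intro (isCompact_closedBall x r) fun z hz => hc0 z hz
  have hcd : ∀ z, fderiv ℝ c z = (-(2 / r ^ 2 * weight (sqRatio x r z))) • innerSL ℝ (z - x) :=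
    fun z => fderiv_eq_of_apply fun v => by
      rw [hc, fderiv_comp_sqRatio (hasDerivAt_cutoff _)]; ring
  obtain ⟨M, hM⟩ := hcc.exists_bound_of_continuous hcs.continuous
  obtain ⟨M', hM'⟩ := (hcc.fderiv (𝕜 := ℝ)).exists_bound_of_continuous
    (hcs.continuous_fderiv (by simp))
  have hM0 : 0 ≤ M := (norm_nonneg _).trans (hM 0)
  have hM0' : 0 ≤ M' := (norm_nonneg _).trans (hM' 0)
  have hdu : ∀ z (u : Rn m), fderiv ℝ (fun v : Rn m => c z • v) u =
      c z • ContinuousLinearMap.id ℝ (Rn m) := fun z u =>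
    ((hasFDerivAt_id u).const_smul (c z)).fderiv
  have hdx : ∀ z (u : Rn m), fderiv ℝ (fun y => c y • u) z = (fderiv ℝ c z).smulRight u :=
    fun z u => ((hcs.differentiable (by simp) z).hasFDerivAt.smul_const u).fderiv
  -- The field is linear in u, so D_u is bounded and the growth is linear, as the test class allows.
  have htest : IsOuterTest Ω fun z (u : Rn m) => c z • u := by
    refine ⟨(hcs.comp contDiff_fst).smul contDiff_snd, ⟨Metric.closedBall x r,
      isCompact_closedBall x r, hrΩ, fun z hz u => by
        change c z • u = 0
        rw [hc0 z hz, zero_smul]⟩, M + M',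
      fun z u => ⟨?_, ?_⟩⟩
    · rw [hdu, norm_smul]
      refine (mul_le_mul (hM z) ContinuousLinearMap.norm_id_le (norm_nonneg _) hM0).trans ?_
      linarith
    · rw [hdx, ContinuousLinearMap.norm_smulRight_apply, norm_smul]
      have h1 := mul_le_mul_of_nonneg_right (hM z) (norm_nonneg u)
      have h2 := mul_le_mul_of_nonneg_right (hM' z) (norm_nonneg u)
      nlinarith
  have h := hst.2.1 _ htest
  rw [outerVariation] at h
  refine Eq.trans (integral_congr_ae (Eventually.of_forall fun z => ?_)) h
  simp only [hdu, hdx, hcd]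
  rw [energyDensity, radialProduct, Finset.mul_sum, Finset.mul_sum, Finset.mul_sum,
    ← Finset.sum_sub_distrib]
  refine Finset.sum_congr rfl fun i _ => ?_
  have e1 : ((-(2 / r ^ 2 * weight (sqRatio x r z))) • innerSL ℝ (z - x)).smulRight
      (approxJet Ω f z i).1 = (-(2 / r ^ 2 * weight (sqRatio x r z))) •
        (innerSL ℝ (z - x)).smulRight (approxJet Ω f z i).1 := by
    ext1 v; simp [mul_smul]
  rw [e1, hsInner_smul_right, hsInner_smulRight, ContinuousLinearMap.smul_comp,
    ContinuousLinearMap.id_comp, hsInner_smul_right]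
  ring

/-- The inner variation along `z ↦ φ(|z - x|² / r²) (z - x)`. -/
theorem inner_identity (hst : IsDirStationary Ω f) {x : Rn n} {r : ℝ} (hr : 0 < r)
    (hrΩ : Metric.closedBall x r ⊆ Ω) :
    2 * (∫ z in Ω, (cutoff (sqRatio x r z) * energyDensity Ω f z -
      2 / r ^ 2 * (weight (sqRatio x r z) * radialDensity Ω f x z))) -
      ∫ z in Ω, energyDensity Ω f z * (n * cutoff (sqRatio x r z) -
        2 * (weight (sqRatio x r z) * sqRatio x r z)) = 0 := by
  set c : Rn n → ℝ := fun z => cutoff (sqRatio x r z) with hc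
  have hcs : ContDiff ℝ ∞ c := contDiff_cutoff.comp (contDiff_sqRatio x r)
  have hc0 : ∀ z, z ∉ Metric.closedBall x r → c z = 0 := fun z hz =>
    cutoff_eq_zero (one_le_sqRatio hr hz)
  have hcd : ∀ z, fderiv ℝ c z = (-(2 / r ^ 2 * weight (sqRatio x r z))) • innerSL ℝ (z - x) :=
    fun z => fderiv_eq_of_apply fun v => by
      rw [hc, fderiv_comp_sqRatio (hasDerivAt_cutoff _)]; ring
  set X : Rn n → Rn n := fun z => c z • (z - x)
  have hXs : ContDiff ℝ ∞ X := hcs.smul (contDiff_id.sub contDiff_const)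
  have hX0 : ∀ z, z ∉ Metric.closedBall x r → X z = 0 := fun z hz => by
    simp [X, hc0 z hz]
  have hXd : ∀ z, fderiv ℝ X z =
      c z • ContinuousLinearMap.id ℝ (Rn n) + (fderiv ℝ c z).smulRight (z - x) := fun z =>
    ((hcs.differentiable (by simp) z).hasFDerivAt.smul ((hasFDerivAt_id z).sub_const x)).fderiv
  have h := hst.2.2 X hXs (HasCompactSupport.intro (isCompact_closedBall x r) fun z hz => hX0 z hz)
    ((tsupport_subset_of_eq_zero hX0).trans hrΩ)
  rw [innerVariation] at h
  refine Eq.trans (congrArg₂ (fun a b : ℝ => 2 * a - b)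
    (integral_congr_ae (Eventually.of_forall fun z => ?_))
    (integral_congr_ae (Eventually.of_forall fun z => ?_))) h
  · simp only [hXd, hcd]
    rw [energyDensity, radialDensity, Finset.mul_sum, Finset.mul_sum, Finset.mul_sum,
      ← Finset.sum_sub_distrib]
    refine Finset.sum_congr rfl fun i _ => ?_
    have e1 : (approxJet Ω f z i).2.comp (c z • ContinuousLinearMap.id ℝ (Rn n) +
        ((-(2 / r ^ 2 * weight (sqRatio x r z))) • innerSL ℝ (z - x)).smulRight (z - x)) =
        c z • (approxJet Ω f z i).2 + (-(2 / r ^ 2 * weight (sqRatio x r z))) •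
          (innerSL ℝ (z - x)).smulRight ((approxJet Ω f z i).2 (z - x)) := by
      ext1 v; simp [mul_smul]
    rw [e1, hsInner_add_right, hsInner_smul_right, hsInner_smul_right, hsInner_smulRight,
      real_inner_self_eq_norm_sq]
    ring
  · change energyDensity Ω f z * _ = energyDensity Ω f z * divergence X z
    congr 1
    -- Summed over j this gives the divergence n φ - 2 w s, with s = |z - x|²/r².
    have e1 : ∀ j : Fin n, (fderiv ℝ X z (e j)) j =
        c z - 2 / r ^ 2 * weight (sqRatio x r z) * ((z - x) j) ^ 2 := fun j => by
      rw [hXd, hcd]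
      have : (e j : Rn n) j = 1 := by simp [e]
      simp only [add_apply, smul_apply, ContinuousLinearMap.id_apply,
        ContinuousLinearMap.smulRight_apply, innerSL_apply_apply, inner_e_right, PiLp.add_apply,
        PiLp.smul_apply, smul_eq_mul, this]
      ring
    rw [divergence, Finset.sum_congr rfl fun j _ => e1 j, Finset.sum_sub_distrib, ← Finset.mul_sum,
      ← EuclideanSpace.real_norm_sq_eq]
    simp only [Finset.sum_const, Finset.card_univ, Fintype.card_fin, nsmul_eq_mul, sqRatio, hc]
    ring

/-- The weak derivative of `|f|²` tested with `z ↦ ψ(|z - x|² / r²) (z - x)`. -/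
theorem height_identity (hΩ : IsOpen Ω) {u : Rn n → ℝ} {g : Rn n → Rn n}
    (hu : MemLp u 2 (volume.restrict Ω)) (hg : MemLp g 2 (volume.restrict Ω))
    (h : HasWeakGradient Ω u g) {x : Rn n} {r : ℝ} (hr : 0 < r)
    (hrΩ : Metric.closedBall x r ⊆ Ω) :
    ∫ z in Ω, (n * weight (sqRatio x r z) +
        2 * (deriv weight (sqRatio x r z) * sqRatio x r z)) * u z ^ 2 =
      -(2 * ∫ z in Ω, weight (sqRatio x r z) * (u z * inner ℝ (g z) (z - x))) := by
  set w : Rn n → ℝ := fun z => weight (sqRatio x r z) with hw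
  have hws : ContDiff ℝ ∞ w := contDiff_weight.comp (contDiff_sqRatio x r)
  have hw0 : ∀ z, z ∉ Metric.closedBall x r → w z = 0 := fun z hz =>
    weight_eq_zero (one_le_sqRatio hr hz)
  -- The radial vector field is tested one coordinate at a time, and the scalar product rules are
  -- then added.
  set φ : Fin n → Rn n → ℝ := fun j z => w z * (z - x) j
  have hcs : ∀ j : Fin n, ContDiff ℝ ∞ fun z : Rn n => (z - x) j := fun j =>
    (EuclideanSpace.proj (𝕜 := ℝ) j).contDiff.comp (contDiff_id.sub contDiff_const)
  have hφs : ∀ j, ContDiff ℝ ∞ (φ j) := fun j => hws.mul (hcs j)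
  have hφ0 : ∀ j z, z ∉ Metric.closedBall x r → φ j z = 0 := fun j z hz => by
    simp [φ, hw0 z hz]
  have hφc : ∀ j, HasCompactSupport (φ j) := fun j =>
    HasCompactSupport.intro (isCompact_closedBall x r) fun z hz => hφ0 j z hz
  have hφd : ∀ j z, fderiv ℝ (φ j) z (e j) =
      w z + deriv weight (sqRatio x r z) * (2 / r ^ 2) * (z - x) j ^ 2 := by
    intro j z
    have h1 : HasFDerivAt (fun z : Rn n => (z - x) j) (EuclideanSpace.proj (𝕜 := ℝ) j) z :=
      (EuclideanSpace.proj (𝕜 := ℝ) j).hasFDerivAt.comp z ((hasFDerivAt_id z).sub_const x)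
    have h2 := ((hws.differentiable (by simp) z).hasFDerivAt.mul h1).fderiv
    have h3 : fderiv ℝ w z (e j) = _ := fderiv_comp_sqRatio
      ((contDiff_weight.differentiable (by simp) _).hasDerivAt) (e j)
    have h4 : fderiv ℝ (φ j) z = _ := h2
    have : EuclideanSpace.proj (𝕜 := ℝ) j (e j) = 1 := by simp [e]
    rw [h4, add_apply, smul_apply, smul_apply, h3, inner_e_right, this]
    simp only [smul_eq_mul]
    ring
  have hid : ∀ j, ∫ z in Ω, u z ^ 2 * fderiv ℝ (φ j) z (e j) =
      - ∫ z in Ω, 2 * (u z * g z j) * φ j z := fun j =>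
    integral_sq_mul_fderiv hΩ hu hg h (hφs j) (hφc j)
      ((tsupport_subset_of_eq_zero (hφ0 j)).trans hrΩ) j
  have hbd : ∀ {F ζ : Rn n → ℝ}, Integrable F (volume.restrict Ω) → Continuous ζ →
      HasCompactSupport ζ → Integrable (fun z => F z * ζ z) (volume.restrict Ω) := by
    intro F ζ hF hζ hζc
    obtain ⟨M, hM⟩ := hζc.exists_bound_of_continuous hζ
    exact hF.mul_bdd (c := M) hζ.aestronglyMeasurable (Eventually.of_forall hM)
  have hsum := Finset.sum_congr rfl fun j (_ : j ∈ Finset.univ) => hid j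
  rw [← integral_finsetSum _ fun j _ => hbd hu.integrable_sq
      (((hφs j).continuous_fderiv (by simp)).clm_apply continuous_const)
      ((hφc j).fderiv_apply ℝ (e j)), Finset.sum_neg_distrib,
    ← integral_finsetSum _ fun j _ => hbd ((integrable_mul_of_memLp hu (memLp_coord hg j)).const_mul
      2) (hφs j).continuous (hφc j)] at hsum
  rw [← integral_const_mul]
  refine Eq.trans (integral_congr_ae (Eventually.of_forall fun z => ?_)) (hsum.trans
    (congrArg Neg.neg (integral_congr_ae (Eventually.of_forall fun z => ?_))))
  · simp only [hφd]
    rw [← Finset.mul_sum, Finset.sum_add_distrib, ← Finset.mul_sum,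
      ← EuclideanSpace.real_norm_sq_eq]
    simp only [Finset.sum_const, Finset.card_univ, Fintype.card_fin, nsmul_eq_mul, sqRatio, hw]
    ring
  · simp only [φ]
    have : inner ℝ (g z) (z - x) = ∑ j, g z j * (z - x) j := by
      simp [PiLp.inner_apply, mul_comm]
    rw [this, Finset.mul_sum, Finset.mul_sum, Finset.mul_sum]
    exact Finset.sum_congr rfl fun j _ => by ring

end Variations

/-! ### Integrability of the densities and the frequency data. -/

section Doubling

variable {Ω : Set (Rn n)} {f : Rn n → AQ Q m} {Θ : Rn n → ℝ}

lemma integrable_profile_mul {μ : Measure (Rn n)} {F : Rn n → ℝ} (hF : Integrable F μ)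
    {χ : ℝ → ℝ} (hχ : Continuous χ) (h0 : ∀ s, 1 ≤ s → χ s = 0) (x : Rn n) (r : ℝ) :
    Integrable (fun z => χ (sqRatio x r z) * F z) μ := by
  obtain ⟨M, -, hM⟩ := exists_bound_profile hχ h0
  exact hF.bdd_mul (c := M) (hχ.comp (contDiff_sqRatio x r).continuous).aestronglyMeasurable
    (Eventually.of_forall fun z => hM _ (sqRatio_nonneg x r z))

lemma continuous_hsInner_self : Continuous fun A : Rn n →L[ℝ] Rn m => hsInner A A := by
  unfold hsInner
  fun_prop

/-- Domination of the differentials by Θ in L². Without integrability the integrals in the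
variations could not be split. -/
theorem DominatesGradients.integrable_energyDensity (hΩ : IsOpen Ω) (hΩf : volume Ω ≠ ⊤)
    (h : DominatesGradients Ω f Θ) : Integrable (energyDensity Ω f) (volume.restrict Ω) := by
  have hm := h.aemeasurable_sum hΩ hΩf (q := fun p => hsInner p.2.2 p.2.2)
    (continuous_hsInner_self.comp (continuous_snd.comp continuous_snd))
  refine Integrable.mono' (h.memLp.integrable_sq.const_mul (Q * (n * (8 * 8 ^ n) ^ 2)))
    hm.aestronglyMeasurable ?_
  filter_upwards [h.ae_norm_le hΩ hΩf] with z hz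
  rw [energyDensity, Real.norm_of_nonneg (Finset.sum_nonneg fun i _ => hsInner_self_nonneg _)]
  refine (Finset.sum_le_sum fun i _ => (hsInner_self_le _).trans
    (mul_le_mul_of_nonneg_left (pow_le_pow_left₀ (norm_nonneg _) (hz i) 2)
      (Nat.cast_nonneg n))).trans_eq ?_
  rw [Finset.sum_const, Finset.card_univ, Fintype.card_fin, nsmul_eq_mul]
  ring

theorem DominatesGradients.integrable_radialDensity (hΩ : IsOpen Ω) (hΩf : volume Ω ≠ ⊤)
    (hΩb : Bornology.IsBounded Ω) (h : DominatesGradients Ω f Θ) (x : Rn n) :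
    Integrable (radialDensity Ω f x) (volume.restrict Ω) := by
  have hm := h.aemeasurable_sum hΩ hΩf (q := fun p => ‖p.2.2 (p.1 - x)‖ ^ 2) (by fun_prop)
  obtain ⟨d, hd⟩ := hΩb.subset_closedBall x
  refine Integrable.mono' (h.memLp.integrable_sq.const_mul (Q * ((8 * 8 ^ n) ^ 2 * d ^ 2)))
    hm.aestronglyMeasurable ?_
  filter_upwards [h.ae_norm_le hΩ hΩf, ae_restrict_mem hΩ.measurableSet] with z hz hzΩ
  have hzd : ‖z - x‖ ≤ d := by rw [← dist_eq_norm]; exact hd hzΩ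
  rw [radialDensity, Real.norm_of_nonneg (Finset.sum_nonneg fun i _ => sq_nonneg _)]
  have h1 : ∀ i, ‖(approxJet Ω f z i).2 (z - x)‖ ^ 2 ≤ (8 * 8 ^ n * Θ z * d) ^ 2 := fun i =>
    pow_le_pow_left₀ (norm_nonneg _) (((approxJet Ω f z i).2.le_opNorm _).trans
      (mul_le_mul (hz i) hzd (norm_nonneg _) ((norm_nonneg _).trans (hz i)))) 2
  refine (Finset.sum_le_sum fun i _ => h1 i).trans_eq ?_
  rw [Finset.sum_const, Finset.card_univ, Fintype.card_fin, nsmul_eq_mul]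
  ring

lemma abs_sum_inner_le (P R : Fin Q → Rn m) :
    |∑ i, inner ℝ (P i) (R i)| ≤ Real.sqrt (∑ i, ‖P i‖ ^ 2) * Real.sqrt (∑ i, ‖R i‖ ^ 2) := by
  refine (Finset.abs_sum_le_sum_abs _ _).trans ((Finset.sum_le_sum fun i _ =>
    abs_real_inner_le_norm (P i) (R i)).trans ?_)
  exact Real.sum_mul_le_sqrt_mul_sqrt _ _ _

/-- The height, energy and radial energy integrals of a Dir-stationary function around `x`. -/
theorem IsDirStationary.exists_frequency_data (hΩ : IsOpen Ω) (hΩf : volume Ω ≠ ⊤)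
    (hΩb : Bornology.IsBounded Ω) (hst : IsDirStationary Ω f) (x : Rn n) {R : ℝ}
    (hR : ∀ r < R, Metric.closedBall x r ⊆ Ω) :
    ∃ D E : ℝ → ℝ, ∀ H : ℝ → ℝ,
      (H = fun r => ∫ z in Ω, weight (‖z - x‖ ^ 2 / r ^ 2) * (f z).abs ^ 2) →
      (∀ r, 0 < r → r < R → HasDerivAt H ((n * H r + r ^ 2 * D r) / r) r) ∧
      (∀ r, 0 < r → r < R → HasDerivAt D (((n - 2) * D r + 4 / r ^ 2 * E r) / r) r) ∧
      (∀ r, 0 < r → r < R → (r ^ 2 * D r) ^ 2 ≤ 4 * (H r * E r)) := by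
  obtain ⟨Θ, h⟩ := hst.1.exists_dominatesGradients
  have hA := h.integrable_energyDensity hΩ hΩf
  have hB := h.integrable_radialDensity hΩ hΩf hΩb x
  obtain ⟨hu, g, hg, hw, -⟩ := h.sobolev (AQ.sum fun _ => 0)
  change MemLp (fun x => (f x).abs) 2 (volume.restrict Ω) at hu
  change HasWeakGradient Ω (fun x => (f x).abs) g at hw
  have hU := hu.integrable_sq
  -- The chain rule identifies the term in the height identity, written with ∇|f|, with the one in
  -- the outer variation, written with the jets.
  have hV : (fun z => (f z).abs * inner ℝ (g z) (z - x)) =ᵐ[volume.restrict Ω]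
      radialProduct Ω f x := by
    filter_upwards [h.ae_abs_mul_grad hΩ hΩf hg hw] with z hz using hz (z - x)
  have hVi : Integrable (radialProduct Ω f x) (volume.restrict Ω) := by
    obtain ⟨d, hd⟩ := hΩb.subset_closedBall x
    refine Integrable.mono' ((hU.add hB).const_mul 1) ?_ ?_
    · refine AEStronglyMeasurable.congr ?_ hV
      exact hu.1.mul (hg.1.inner (continuous_id.sub continuous_const).aestronglyMeasurable)
    · filter_upwards [h.ae_sq_abs hΩ hΩf] with z hz
      have h1 := abs_sum_inner_le (fun i => (approxJet Ω f z i).1)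
        fun i => (approxJet Ω f z i).2 (z - x)
      rw [← hz] at h1
      have h2 := Real.sq_sqrt (sq_nonneg (f z).abs)
      have h3 : Real.sqrt (radialDensity Ω f x z) ^ 2 = radialDensity Ω f x z :=
        Real.sq_sqrt (Finset.sum_nonneg fun i _ => sq_nonneg _)
      change |radialProduct Ω f x z| ≤ _ * Real.sqrt (radialDensity Ω f x z) at h1
      simp only [Pi.add_apply, Real.norm_eq_abs, one_mul]
      nlinarith [sq_nonneg (Real.sqrt ((f z).abs ^ 2) - Real.sqrt (radialDensity Ω f x z)),
        Real.sqrt_nonneg ((f z).abs ^ 2), Real.sqrt_nonneg (radialDensity Ω f x z)]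
  have hwc := contDiff_weight.continuous
  have hdw : Continuous (deriv weight) := (contDiff_infty_iff_deriv.1 contDiff_weight).2.continuous
  have hw0 : ∀ s, 1 ≤ s → weight s = 0 := fun s => weight_eq_zero
  have hc0 : ∀ s, 1 ≤ s → cutoff s = 0 := fun s => cutoff_eq_zero
  have hw0' : ∀ s, 1 ≤ s → weight s * s = 0 := fun s hs => by rw [weight_eq_zero hs, zero_mul]
  have hdw0 : ∀ s, 1 ≤ s → deriv weight s * s = 0 := fun s hs => by
    rw [deriv_eq_zero_of_one_le contDiff_weight hw0 s hs, zero_mul]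
  set D : ℝ → ℝ := fun r => ∫ z in Ω, cutoff (sqRatio x r z) * energyDensity Ω f z with hD
  set E : ℝ → ℝ := fun r => ∫ z in Ω, weight (sqRatio x r z) * radialDensity Ω f x z
  set P : ℝ → ℝ := fun r => ∫ z in Ω, weight (sqRatio x r z) * radialProduct Ω f x z with hP
  set H : ℝ → ℝ := fun r => ∫ z in Ω, weight (sqRatio x r z) * (f z).abs ^ 2 with hH
  have iD := fun r => integrable_profile_mul hA contDiff_cutoff.continuous hc0 x r
  have iE := fun r => integrable_profile_mul hB hwc hw0 x r
  have iP := fun r => integrable_profile_mul hVi hwc hw0 x r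
  have iH := fun r => integrable_profile_mul hU hwc hw0 x r
  have iA : ∀ r, Integrable (fun z => weight (sqRatio x r z) * sqRatio x r z *
      energyDensity Ω f z) (volume.restrict Ω) := fun r =>
    integrable_profile_mul hA (hwc.mul continuous_id) hw0' x r
  have iU : ∀ r, Integrable (fun z => deriv weight (sqRatio x r z) * sqRatio x r z *
      (f z).abs ^ 2) (volume.restrict Ω) := fun r =>
    integrable_profile_mul hU (hdw.mul continuous_id) hdw0 x r
  -- the outer variation
  have hO : ∀ r, 0 < r → r < R → r ^ 2 * D r = 2 * P r := by
    intro r hr hrR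
    have h1 := outer_identity hst hr (hR r hrR)
    rw [integral_sub (iD r) ((iP r).const_mul _), integral_const_mul] at h1
    change D r - 2 / r ^ 2 * P r = 0 at h1
    field_simp at h1
    linarith
  refine ⟨D, E, ?_⟩
  rintro _ rfl
  refine ⟨fun r hr hrR => ?_, fun r hr hrR => ?_, fun r hr hrR => ?_⟩
  · have h1 := height_identity hΩ hu hg hw hr (hR r hrR)
    have h2 : ∫ z in Ω, weight (sqRatio x r z) * ((f z).abs * inner ℝ (g z) (z - x)) = P r := by
      refine integral_congr_ae ?_
      filter_upwards [hV] with z hz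
      rw [hz]
    have h3 : ∫ z in Ω, (n * weight (sqRatio x r z) +
        2 * (deriv weight (sqRatio x r z) * sqRatio x r z)) * (f z).abs ^ 2 =
        n * H r + 2 * ∫ z in Ω, deriv weight (sqRatio x r z) * sqRatio x r z * (f z).abs ^ 2 := by
      rw [hH, ← integral_const_mul, ← integral_const_mul,
        ← integral_add ((iH r).const_mul _) ((iU r).const_mul _)]
      congr 1; ext z
      ring
    rw [h2, h3] at h1
    have h4 := hasDerivAt_integral_profile hU contDiff_weight hw0 x hr
    refine h4.congr_deriv ?_
    have h5 : ∫ z in Ω, -(2 / r) * (deriv weight (‖z - x‖ ^ 2 / r ^ 2) *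
        (‖z - x‖ ^ 2 / r ^ 2)) * (f z).abs ^ 2 = -(2 / r) *
          ∫ z in Ω, deriv weight (sqRatio x r z) * sqRatio x r z * (f z).abs ^ 2 := by
      rw [← integral_const_mul]
      simp only [mul_assoc, sqRatio]
    rw [h5, hO r hr hrR]
    change _ = (n * H r + _) / r
    field_simp
    linarith
  · have h1 := inner_identity hst hr (hR r hrR)
    have h2 : ∫ z in Ω, energyDensity Ω f z * (n * cutoff (sqRatio x r z) -
        2 * (weight (sqRatio x r z) * sqRatio x r z)) =
        n * D r - 2 * ∫ z in Ω, weight (sqRatio x r z) * sqRatio x r z * energyDensity Ω f z := by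
      rw [hD, ← integral_const_mul, ← integral_const_mul,
        ← integral_sub ((iD r).const_mul _) ((iA r).const_mul _)]
      congr 1; ext z
      ring
    rw [h2, integral_sub (iD r) ((iE r).const_mul _), integral_const_mul] at h1
    change 2 * (D r - 2 / r ^ 2 * E r) - _ = 0 at h1
    have h4 := hasDerivAt_integral_profile hA contDiff_cutoff hc0 x hr
    refine h4.congr_deriv ?_
    have h5 : ∫ z in Ω, -(2 / r) * (deriv cutoff (‖z - x‖ ^ 2 / r ^ 2) *
        (‖z - x‖ ^ 2 / r ^ 2)) * energyDensity Ω f z = (2 / r) *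
          ∫ z in Ω, weight (sqRatio x r z) * sqRatio x r z * energyDensity Ω f z := by
      rw [← integral_const_mul]
      congr 1; ext z
      rw [(hasDerivAt_cutoff _).deriv, sqRatio]
      ring
    rw [h5]
    field_simp
    field_simp at h1
    linarith
  -- Cauchy–Schwarz twice: over the Q branches at each point, then over Ω for the square roots of
  -- the weighted densities, giving P² ≤ H E.
  · have ha : MemLp (fun z => Real.sqrt (weight (sqRatio x r z) * (f z).abs ^ 2)) 2
        (volume.restrict Ω) := by
      refine (memLp_two_iff_integrable_sq (Real.continuous_sqrt.comp_aestronglyMeasurable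
        (iH r).aestronglyMeasurable)).2 ((iH r).congr (Eventually.of_forall fun z => ?_))
      exact (Real.sq_sqrt (mul_nonneg (weight_nonneg _) (sq_nonneg _))).symm
    have hB0 : ∀ z, 0 ≤ weight (sqRatio x r z) * radialDensity Ω f x z := fun z =>
      mul_nonneg (weight_nonneg _) (Finset.sum_nonneg fun i _ => sq_nonneg _)
    have hb : MemLp (fun z => Real.sqrt (weight (sqRatio x r z) * radialDensity Ω f x z)) 2
        (volume.restrict Ω) := by
      refine (memLp_two_iff_integrable_sq (Real.continuous_sqrt.comp_aestronglyMeasurable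
        (iE r).aestronglyMeasurable)).2 ((iE r).congr (Eventually.of_forall fun z => ?_))
      exact (Real.sq_sqrt (hB0 z)).symm
    have h1 := sq_integral_mul_le ha hb
    have h2 : |P r| ≤ ∫ z in Ω, Real.sqrt (weight (sqRatio x r z) * (f z).abs ^ 2) *
        Real.sqrt (weight (sqRatio x r z) * radialDensity Ω f x z) := by
      refine (abs_integral_le_integral_abs).trans (integral_mono_ae (iP r).abs
        (integrable_mul_of_memLp ha hb) ?_)
      filter_upwards [h.ae_sq_abs hΩ hΩf] with z hz
      have h3 := abs_sum_inner_le (fun i => (approxJet Ω f z i).1)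
        fun i => (approxJet Ω f z i).2 (z - x)
      rw [← hz] at h3
      have hwn := weight_nonneg (sqRatio x r z)
      rw [abs_mul, abs_of_nonneg hwn, Real.sqrt_mul hwn, Real.sqrt_mul hwn,
        mul_mul_mul_comm, Real.mul_self_sqrt hwn]
      exact mul_le_mul_of_nonneg_left h3 hwn
    have h4 : ∫ z in Ω, Real.sqrt (weight (sqRatio x r z) * (f z).abs ^ 2) ^ 2 = H r :=
      integral_congr_ae (Eventually.of_forall fun z =>
        Real.sq_sqrt (mul_nonneg (weight_nonneg _) (sq_nonneg _)))
    have h5 : ∫ z in Ω, Real.sqrt (weight (sqRatio x r z) * radialDensity Ω f x z) ^ 2 = E r :=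
      integral_congr_ae (Eventually.of_forall fun z => Real.sq_sqrt (hB0 z))
    rw [h4, h5] at h1
    rw [hO r hr hrR]
    have h6 := pow_le_pow_left₀ (abs_nonneg _) h2 2
    rw [sq_abs] at h6
    change (2 * P r) ^ 2 ≤ 4 * (H r * E r)
    linarith

end Doubling

end QValued

end

/-! ### From doubling of the weighted height to doubling on balls. -/

theorem proposition4p3 (n m Q : ℕ) (f : QValued.Rn n → QValued.AQ Q m)
    (hf : QValued.IsDirStationary (Metric.ball (0 : QValued.Rn n) 1) f)
    (x : QValued.Rn n) (hx : x ∈ Metric.ball (0 : QValued.Rn n) 1) :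
    ∃ r_x : ℝ, 0 < r_x ∧ Metric.ball x (2 * r_x) ⊆ Metric.ball (0 : QValued.Rn n) 1 ∧
      ∃ C_x : ℝ, ∀ r : ℝ, 0 < r → r ≤ r_x →
        ∫ y in Metric.ball x (2 * r), (f y).abs ^ 2 ≤
          C_x * ∫ y in Metric.ball x r, (f y).abs ^ 2 := by
  open QValued in
  set Ω := Metric.ball (0 : Rn n) 1
  obtain ⟨Θ, h⟩ := hf.1.exists_dominatesGradients
  have hU : Integrable (fun z => (f z).abs ^ 2) (volume.restrict Ω) :=
    (h.sobolev (AQ.sum fun _ => 0)).1.integrable_sq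
  obtain ⟨R, hR, hRΩ⟩ := Metric.isOpen_iff.1 Metric.isOpen_ball x hx
  have hRc : ∀ r < R, Metric.closedBall x r ⊆ Ω := fun r hr =>
    (Metric.closedBall_subset_ball hr).trans hRΩ
  have hsubΩ : ∀ r, r ≤ R → Metric.ball x r ⊆ Ω := fun r hr =>
    (Metric.ball_subset_ball hr).trans hRΩ
  have hUb : ∀ r, r ≤ R → IntegrableOn (fun z => (f z).abs ^ 2) (Metric.ball x r) := fun r hr =>
    IntegrableOn.mono_set hU (hsubΩ r hr)
  obtain ⟨D, E, hDE⟩ := hf.exists_frequency_data Metric.isOpen_ball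
    (volume_ball_ne_top 0 1) Metric.isBounded_ball x hRc
  set H : ℝ → ℝ := fun r => ∫ z in Ω, weight (‖z - x‖ ^ 2 / r ^ 2) * (f z).abs ^ 2
  obtain ⟨h1, h2, h3⟩ := hDE H rfl
  have hwi := fun r => integrable_profile_mul hU contDiff_weight.continuous
    (fun s => weight_eq_zero) x r
  have hw0 : ∀ r z, 0 ≤ weight (sqRatio x r z) * (f z).abs ^ 2 := fun r z =>
    mul_nonneg (weight_nonneg _) (sq_nonneg _)
  -- The weight degenerates at s = 1, so the lower bound is taken on s ≤ 1/4, that is, on the ball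
  -- of half the radius. This loss is why doubling of H is needed with factor 4.
  obtain ⟨c, hc, hcw⟩ : ∃ c : ℝ, 0 < c ∧ ∀ s, 0 ≤ s → s ≤ 1 / 4 → c ≤ weight s := by
    obtain ⟨s₀, hs₀, hmin⟩ := (isCompact_Icc (a := (0 : ℝ)) (b := 1 / 4)).exists_isMinOn
      ⟨0, by norm_num⟩ contDiff_weight.continuous.continuousOn
    exact ⟨weight s₀, weight_pos (by linarith [hs₀.2]), fun s h0 h4 => hmin ⟨h0, h4⟩⟩
  have hlow : ∀ r, 0 < r → r ≤ R →
      c * ∫ z in Metric.ball x r, (f z).abs ^ 2 ≤ H (2 * r) := by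
    intro r hr hrR
    rw [← integral_const_mul]
    refine (setIntegral_mono_on ((hUb r hrR).const_mul c)
      (IntegrableOn.mono_set (hwi (2 * r)) (hsubΩ r hrR)) Metric.isOpen_ball.measurableSet
      fun z hz => mul_le_mul_of_nonneg_right (hcw _ (sqRatio_nonneg _ _ _) ?_)
        (sq_nonneg _)).trans (setIntegral_mono_set (hwi (2 * r))
          (Eventually.of_forall (hw0 (2 * r))) (hsubΩ r hrR).eventuallyLE)
    rw [sqRatio, div_le_iff₀ (by positivity)]
    rw [Metric.mem_ball, dist_eq_norm] at hz
    nlinarith [norm_nonneg (z - x)]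
  by_cases hpos : ∀ r, 0 < r → r < R → 0 < H r
  · obtain ⟨C, hC0, hC⟩ := exists_doubling_of_frequency hR h1 h2 hpos h3
    obtain ⟨M, hM0, hM⟩ := exists_bound_profile contDiff_weight.continuous
      fun s => weight_eq_zero
    -- The chain is c ∫_{B_{2r}} |f|² ≤ H(4r) ≤ C H(r) ≤ C M ∫_{B_r} |f|².
    refine ⟨R / 8, by positivity, hsubΩ _ (by linarith), C * M / c, fun r hr hrR => ?_⟩
    have hup : H r ≤ M * ∫ z in Metric.ball x r, (f z).abs ^ 2 := by
      have e1 : H r = ∫ z in Metric.ball x r, weight (sqRatio x r z) * (f z).abs ^ 2 := by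
        refine setIntegral_eq_of_subset_of_forall_sdiff_eq_zero Metric.isOpen_ball.measurableSet
          (hsubΩ r (by linarith)) fun z hz => ?_
        have hz2 := hz.2
        rw [Metric.mem_ball, dist_eq_norm, not_lt] at hz2
        have hz1 : 1 ≤ sqRatio x r z := by
          rw [sqRatio, le_div_iff₀ (by positivity), one_mul]
          exact pow_le_pow_left₀ hr.le hz2 2
        change weight (sqRatio x r z) * _ = 0
        rw [weight_eq_zero hz1, zero_mul]
      rw [e1, ← integral_const_mul]
      refine setIntegral_mono (IntegrableOn.mono_set (hwi r) (hsubΩ r (by linarith)))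
        ((hUb r (by linarith)).const_mul M) fun z => ?_
      exact mul_le_mul_of_nonneg_right ((le_abs_self _).trans (hM _ (sqRatio_nonneg x r z)))
        (sq_nonneg _)
    have h4 := hC r hr hrR
    have h5 := hlow (2 * r) (by linarith) (by linarith)
    have h6 : 2 * (2 * r) = 4 * r := by ring
    rw [h6] at h5
    rw [div_mul_eq_mul_div, le_div_iff₀ hc, mul_comm _ c, mul_assoc]
    exact h5.trans (h4.trans (mul_le_mul_of_nonneg_left hup hC0))
  -- If H(ρ) ≤ 0, the lower bound makes |f|² integrate to zero on the ball of radius ρ/2, so the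
  -- constant 0 works for r ≤ ρ/4.
  · push Not at hpos
    obtain ⟨ρ, hρ, hρR, hHρ⟩ := hpos
    have h4 := hlow (ρ / 2) (by linarith) (by linarith)
    have h5 : 2 * (ρ / 2) = ρ := by ring
    rw [h5] at h4
    have h6 : ∫ z in Metric.ball x (ρ / 2), (f z).abs ^ 2 ≤ 0 :=
      nonpos_of_mul_nonpos_right (h4.trans hHρ) hc
    refine ⟨ρ / 4, by positivity, hsubΩ _ (by linarith), 0, fun r hr hrρ => ?_⟩
    rw [zero_mul]
    refine (setIntegral_mono_set (hUb (ρ / 2) (by linarith))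
      (Eventually.of_forall fun z => sq_nonneg _) ?_).trans h6
    exact (Metric.ball_subset_ball (by linarith)).eventuallyLE
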